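/- **Setting.** A multi-objective Markov decision process (MOMDP) $M$ has a finite state set $\mathcal S$, a finite nonempty action set $\mathcal A$ (both numbered), transition probabilities $Pr(s'\mid s,a)$ and deterministic rewards $\mathbf R(s,a)\in[0,1]^d$, $d\ge 1$. Let $T\ge 1$ be a horizon, $0\le\gamma<1$ a discount factor, and $W:\mathbb R^d\to\mathbb R$ a welfare function that is uniformly continuous for the $\ell_1$ norm on the nonnegative orthant, with modulus $\delta$: for every $\eta>0$ we have $\delta_\eta>0$, and $|W(\mathbf x)-W(\mathbf y)|<\eta$ whenever $\mathbf x,\mathbf y\ge 0$ and $\|\mathbf x-\mathbf y\|_1<\delta_\eta$. A policy $\pi(a\mid\tau,s)$ maps the past trajectory $\tau$ and the current state $s$ to a probability distribution over actions. Let $$V^\pi_M(s,0,T)=\sum_\tau Pr^\pi[\tau]\;W\Big(\sum_{t=1}^T\gamma^{t-1}\mathbf R(s_t,a_t)\Big),$$ the sum being over the trajectories $\tau=(s_1,a_1),\dots,(s_T,a_T)$ with $s_1=s$, and let $V^*(s,0,T)=\sup_\pi V^\pi_M(s,0,T)$. **Algorithms.** Algorithms run on a real random access machine: real arithmetic and comparisons,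 addition and truncated subtraction of natural numbers, and array accesses cost one step each; there are no real constants and no unit-time rounding of reals to integers; a query to the oracle for $\eta\mapsto\delta_\eta$ costs one step and a query to the oracle for $W$ costs $d+1$ steps. The input consists of $|\mathcal S|,|\mathcal A|,d,T,\gamma,\varepsilon,\beta$ and these oracles. The transition probabilities and the rewards of $M$ are unknown: the algorithm only observes the current state and the reward of the action that it has just taken. When it halts it outputs a policy, as a second program that works on the memory left by the first one and is told the visited states. **Theorem (RAEE).** There are a single algorithm $A$ and constants $C,k\in\mathbb N$ such that the following holds for all $d\ge1$, $W$, $\delta$, $T\ge1$, $\gamma\in[0,1)$, $\varepsilon>0$, $\beta\in(0,1)$, every MOMDP $M$ as above and every starting state. Put $$N=\tfrac1\varepsilon+\tfrac1\beta+|\mathcal S|+|\mathcal A|+T+d+\tfrac1{\delta_1}.$$ 1. $A$ always takes at most $C N^k$ actions, and its total computation time is always at most $$C N^k\left(\frac{d\,T^2}{\delta_{\varepsilon/4}}+2\right)^d .$$ 2. With probability at least $1-\beta$, $A$ halts (after at most $CN^k$ actions) in some state $s$ and outputs a policy $\hat\pi$ with $$V^{\hat\pi}_M(s,0,T)\ \ge\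 V^*(s,0,T)-\varepsilon ,$$ each of whose decisions within the horizon $T$ is computed within the time bound of 1. (For fixed $W$ and $d$, $1/\delta_1$ is a constant. So the number of actions is polynomial in $1/\varepsilon,1/\beta,|\mathcal S|,|\mathcal A|,T$; so is the time if $1/\delta_{\eta}$ is polynomial in $1/\eta$, e.g. for Lipschitz $W$, with an exponential dependence on $d$.) -/

import Mathlib

/-! ### Multi-objective Markov decision processes -/

/-- A multi-objective Markov decision process with states `Fin n`, actions `Fin m`, and a
deterministic reward vector in `[0,1]^d` for every state-action pair. -/
structure MOMDP (n m d : ℕ) where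
  /-- `trans s a` is the law of the next state after action `a` in state `s`. -/
  trans : Fin n → Fin m → PMF (Fin n)
  reward : Fin n → Fin m → Fin d → ℝ
  reward_mem : ∀ s a i, reward s a i ∈ Set.Icc (0 : ℝ) 1

/-- A (randomized, history dependent) policy: it maps a past trajectory and the current state to
a probability distribution over actions. -/
abbrev Policy (n m : ℕ) := List (Fin n × Fin m) → Fin n → PMF (Fin m)

namespace MOMDP

variable {n m d : ℕ}

/-- The total discounted reward vector of the length `T` trajectory `τ`. -/
noncomputable def totalReward (M : MOMDP n m d) (γ : ℝ) {T : ℕ} (τ : Fin T → Fin n × Fin m) :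
    Fin d → ℝ :=
  fun i => ∑ t : Fin T, γ ^ (t : ℕ) * M.reward (τ t).1 (τ t).2 i

open Classical in
/-- The probability that the length `T` trajectory `τ` is traversed upon starting in `s` and
executing `π`: the product of the probabilities of all the actions (given the sub-trajectory
before them and the state at which they are taken) and of all the transitions inside `τ`. -/
noncomputable def trajProb (M : MOMDP n m d) (π : Policy n m) (s : Fin n) {T : ℕ}
    (τ : Fin T → Fin n × Fin m) : ℝ :=
  (if ∀ h : 0 < T, (τ ⟨0, h⟩).1 = s then 1 else 0) *
    ∏ t : Fin T,
      (π ((List.ofFn τ).take t) (τ t).1 (τ t).2).toReal *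
        (if h : (t : ℕ) + 1 < T then
          (M.trans (τ t).1 (τ t).2 (τ ⟨(t : ℕ) + 1, h⟩).1).toReal
        else 1)

/-- `V^π(s, 0, T)`: the expected welfare of the total discounted reward over `T` steps. -/
noncomputable def value (M : MOMDP n m d) (W : (Fin d → ℝ) → ℝ) (γ : ℝ) (T : ℕ)
    (π : Policy n m) (s : Fin n) : ℝ :=
  ∑ τ : Fin T → Fin n × Fin m, M.trajProb π s τ * W (M.totalReward γ τ)

/-- `V^*(s, 0, T)`: the optimum of `V^π(s, 0, T)` over all policies. -/
noncomputable def optValue (M : MOMDP n m d) (W : (Fin d → ℝ) → ℝ) (γ : ℝ) (T : ℕ)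
    (s : Fin n) : ℝ :=
  ⨆ π : Policy n m, M.value W γ T π s

theorem trajProb_nonneg (M : MOMDP n m d) (π : Policy n m) (s : Fin n) {T : ℕ}
    (τ : Fin T → Fin n × Fin m) : 0 ≤ M.trajProb π s τ := by
  unfold trajProb
  refine mul_nonneg (by split_ifs <;> norm_num) (Finset.prod_nonneg fun t _ => ?_)
  refine mul_nonneg ENNReal.toReal_nonneg ?_
  split_ifs
  · exact ENNReal.toReal_nonneg
  · norm_num

theorem trajProb_le_one (M : MOMDP n m d) (π : Policy n m) (s : Fin n) {T : ℕ}
    (τ : Fin T → Fin n × Fin m) : M.trajProb π s τ ≤ 1 := by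
  have key : ∀ {α : Type} (p : PMF α) (a : α), (p a).toReal ≤ 1 := fun p a =>
    ENNReal.toReal_le_of_le_ofReal zero_le_one (by simpa using p.coe_le_one a)
  have h2 : ∀ t : Fin T, (π ((List.ofFn τ).take t) (τ t).1 (τ t).2).toReal *
        (if h : (t : ℕ) + 1 < T then
          (M.trans (τ t).1 (τ t).2 (τ ⟨(t : ℕ) + 1, h⟩).1).toReal
        else 1) ∈ Set.Icc (0 : ℝ) 1 := by
    intro t
    have h3 : (if h : (t : ℕ) + 1 < T then
          (M.trans (τ t).1 (τ t).2 (τ ⟨(t : ℕ) + 1, h⟩).1).toReal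
        else 1) ∈ Set.Icc (0 : ℝ) 1 := by
      split_ifs
      · exact ⟨ENNReal.toReal_nonneg, key _ _⟩
      · exact ⟨zero_le_one, le_refl _⟩
    exact ⟨mul_nonneg ENNReal.toReal_nonneg h3.1,
      mul_le_one₀ (key _ _) h3.1 h3.2⟩
  unfold trajProb
  refine mul_le_one₀ (by split_ifs <;> norm_num) (Finset.prod_nonneg fun t _ => (h2 t).1) ?_
  exact Finset.prod_le_one (fun t _ => (h2 t).1) (fun t _ => (h2 t).2)

/-- The supremum that defines `optValue` is over a bounded set. -/
theorem bddAbove_value (M : MOMDP n m d) (W : (Fin d → ℝ) → ℝ) (γ : ℝ) (T : ℕ) (s : Fin n) :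
    BddAbove (Set.range fun π : Policy n m => M.value W γ T π s) := by
  refine ⟨∑ τ : Fin T → Fin n × Fin m, |W (M.totalReward γ τ)|, ?_⟩
  rintro _ ⟨π, rfl⟩
  refine Finset.sum_le_sum fun τ _ => ?_
  calc M.trajProb π s τ * W (M.totalReward γ τ)
      ≤ M.trajProb π s τ * |W (M.totalReward γ τ)| :=
        mul_le_mul_of_nonneg_left (le_abs_self _) (M.trajProb_nonneg π s τ)
    _ ≤ 1 * |W (M.totalReward γ τ)| :=
        mul_le_mul_of_nonneg_right (M.trajProb_le_one π s τ) (abs_nonneg _)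
    _ = _ := one_mul _

end MOMDP

/-- `W` is uniformly continuous for the L1 norm on the nonnegative orthant, and `ω` is a modulus
of uniform continuity for it, that is, `ω η` is an admissible `δ_η` for every `η > 0`. -/
def IsUnifContModulus {d : ℕ} (W : (Fin d → ℝ) → ℝ) (ω : ℝ → ℝ) : Prop :=
  ∀ η : ℝ, 0 < η → 0 < ω η ∧
    ∀ x y : Fin d → ℝ, (∀ i, 0 ≤ x i) → (∀ i, 0 ≤ y i) →
      ∑ i, |x i - y i| < ω η → |W x - W y| < η

/-! ### The machine model

A real random access machine. Its memory consists of arrays of natural numbers and arrays of real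
numbers, all with three indices, all initially zero. Arithmetic on reals, comparison of reals,
addition and truncated subtraction of naturals and array accesses cost one step each. There is no
rounding of a real to an integer and no multiplication of integers in unit time, and programs
contain no real constants. The only loops are bounded ones, so every program terminates. -/

/-- Expressions for natural numbers. -/
inductive NatExpr where
  | const (c : ℕ)
  | numStates
  | numActions
  | dim
  | horizon
  /-- the (number of the) current state of the environment -/
  | state
  /-- the entry `[i, j, k]` of the array `a` of naturals -/
  | get (a : ℕ) (i j k : NatExpr)
  | add (e f : NatExpr)
  | sub (e f : NatExpr)

/-- Expressions for real numbers. -/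
inductive RealExpr where
  | ofNat (e : NatExpr)
  | discount
  /-- the accuracy `ε` -/
  | accuracy
  /-- the admissible failure probability `β` -/
  | failure
  /-- coordinate `i` of the reward vector received for the last action -/
  | reward (i : NatExpr)
  /-- the entry `[i, j, k]` of the array `a` of reals -/
  | get (a : ℕ) (i j k : NatExpr)
  | add (x y : RealExpr)
  | sub (x y : RealExpr)
  | mul (x y : RealExpr)
  | div (x y : RealExpr)
  /-- the value of the welfare function at the vector with coordinates `a[i, j, 0]`, ...,
  `a[i, j, d - 1]` -/
  | welfare (a : ℕ) (i j : NatExpr)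
  /-- the value at `x` of the modulus of uniform continuity of the welfare function -/
  | modulus (x : RealExpr)

/-- Programs. -/
inductive Prog where
  | skip
  /-- `a[i, j, k] := e` -/
  | setNat (a : ℕ) (i j k e : NatExpr)
  /-- `a[i, j, k] := x` -/
  | setReal (a : ℕ) (i j k : NatExpr) (x : RealExpr)
  | seq (p q : Prog)
  /-- if `x ≤ y` then `p` else `q` -/
  | ite (x y : RealExpr) (p q : Prog)
  /-- for `c = 0, 1, 2, ...` as long as `c < x`: set `a[0, 0, 0] := c` and run `p`; the bound `x`
  is evaluated once, before the loop -/
  | loop (a : ℕ) (x : RealExpr) (p : Prog)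

/-- What a program can read besides its memory: the parameters of the problem, the welfare
function and its modulus of continuity as oracles, and the current observation. -/
structure View where
  numStates : ℕ
  numActions : ℕ
  dim : ℕ
  horizon : ℕ
  discount : ℝ
  accuracy : ℝ
  failure : ℝ
  welfare : (Fin dim → ℝ) → ℝ
  modulus : ℝ → ℝ
  state : ℕ
  reward : Fin dim → ℝ

/-- The memory, together with the number of steps made so far (which programs cannot read). -/
structure Memory where
  nat : ℕ → ℕ → ℕ → ℕ → ℕ
  real : ℕ → ℕ → ℕ → ℕ → ℝ
  time : ℕ

namespace Memory

def init : Memory := ⟨fun _ _ _ _ => 0, fun _ _ _ _ => 0, 0⟩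

def setNat (μ : Memory) (a i j k v : ℕ) : Memory :=
  { μ with nat := fun a' i' j' k' =>
      if a' = a ∧ i' = i ∧ j' = j ∧ k' = k then v else μ.nat a' i' j' k' }

noncomputable def setReal (μ : Memory) (a i j k : ℕ) (v : ℝ) : Memory :=
  { μ with real := fun a' i' j' k' =>
      if a' = a ∧ i' = i ∧ j' = j ∧ k' = k then v else μ.real a' i' j' k' }

def tick (μ : Memory) (c : ℕ) : Memory := { μ with time := μ.time + c }

end Memory

namespace NatExpr

def eval (v : View) (μ : Memory) : NatExpr → ℕ
  | const c => c
  | numStates => v.numStates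
  | numActions => v.numActions
  | dim => v.dim
  | horizon => v.horizon
  | state => v.state
  | get a i j k => μ.nat a (i.eval v μ) (j.eval v μ) (k.eval v μ)
  | add e f => e.eval v μ + f.eval v μ
  | sub e f => e.eval v μ - f.eval v μ

/-- The number of steps that the evaluation takes. -/
def cost : NatExpr → ℕ
  | get _ i j k => 1 + i.cost + j.cost + k.cost
  | add e f => 1 + e.cost + f.cost
  | sub e f => 1 + e.cost + f.cost
  | _ => 1

end NatExpr

namespace RealExpr

noncomputable def eval (v : View) (μ : Memory) : RealExpr → ℝ
  | ofNat e => (e.eval v μ : ℝ)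
  | discount => v.discount
  | accuracy => v.accuracy
  | failure => v.failure
  | reward i => if h : i.eval v μ < v.dim then v.reward ⟨i.eval v μ, h⟩ else 0
  | get a i j k => μ.real a (i.eval v μ) (j.eval v μ) (k.eval v μ)
  | add x y => x.eval v μ + y.eval v μ
  | sub x y => x.eval v μ - y.eval v μ
  | mul x y => x.eval v μ * y.eval v μ
  | div x y => x.eval v μ / y.eval v μ
  | welfare a i j => v.welfare fun l => μ.real a (i.eval v μ) (j.eval v μ) l
  | modulus x => v.modulus (x.eval v μ)

/-- The number of steps that the evaluation takes; a query to the welfare function takes as many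
steps as its argument has coordinates, and one more. -/
def cost (dim : ℕ) : RealExpr → ℕ
  | ofNat e => 1 + e.cost
  | reward i => 1 + i.cost
  | get _ i j k => 1 + i.cost + j.cost + k.cost
  | add x y => 1 + x.cost dim + y.cost dim
  | sub x y => 1 + x.cost dim + y.cost dim
  | mul x y => 1 + x.cost dim + y.cost dim
  | div x y => 1 + x.cost dim + y.cost dim
  | welfare _ i j => 1 + dim + i.cost + j.cost
  | modulus x => 1 + x.cost dim
  | _ => 1

end RealExpr

/-- The memory after the execution of a program. -/
noncomputable def Prog.exec (v : View) : Prog → Memory → Memory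
  | skip, μ => μ.tick 1
  | setNat a i j k e, μ =>
      (μ.setNat a (i.eval v μ) (j.eval v μ) (k.eval v μ) (e.eval v μ)).tick
        (1 + i.cost + j.cost + k.cost + e.cost)
  | setReal a i j k x, μ =>
      (μ.setReal a (i.eval v μ) (j.eval v μ) (k.eval v μ) (x.eval v μ)).tick
        (1 + i.cost + j.cost + k.cost + x.cost v.dim)
  | seq p q, μ => q.exec v (p.exec v μ)
  | ite x y p q, μ =>
      if x.eval v μ ≤ y.eval v μ then p.exec v (μ.tick (1 + x.cost v.dim + y.cost v.dim))
      else q.exec v (μ.tick (1 + x.cost v.dim + y.cost v.dim))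
  | loop a x p, μ =>
      (List.range ⌈x.eval v μ⌉₊).foldl
        (fun ν c => p.exec v ((ν.setNat a 0 0 0 c).tick 1)) (μ.tick (1 + x.cost v.dim))

/-! ### Learning algorithms -/

/-- A learning algorithm. The program `learn` is run whenever the environment is in a new state.
It halts by making entry `[0, 0, 0]` of the array 0 of naturals nonzero; otherwise it takes the
action whose number it has put in entry `[0, 0, 0]` of the array 1 of naturals. The policy that it
outputs is the one that runs the program `decide`, starting from the memory that `learn` has left,
once for each visited state, and takes the action found in entry `[0, 0, 0]` of the array 1. -/
structure Learner where
  learn : Prog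
  decide : Prog

/-- The problem that a learner faces, without the unknown process: the numbers of states, of
actions and of objectives, the horizon, the discount factor, the accuracy, the admissible failure
probability, and the welfare function with a modulus of continuity. -/
structure Problem (n m d : ℕ) where
  T : ℕ
  γ : ℝ
  ε : ℝ
  β : ℝ
  W : (Fin d → ℝ) → ℝ
  ω : ℝ → ℝ

def Problem.view {n m d : ℕ} (I : Problem n m d) (s : Fin n) (r : Fin d → ℝ) : View where
  numStates := n
  numActions := m
  dim := d
  horizon := I.T
  discount := I.γ
  accuracy := I.ε
  failure := I.β
  welfare := I.W
  modulus := I.ω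
  state := s
  reward := r

/-- A configuration of the interaction between a learner and its environment. -/
structure Config (n d : ℕ) where
  memory : Memory
  state : Fin n
  /-- the reward vector received for the last action (zero before the first one) -/
  lastReward : Fin d → ℝ
  actions : ℕ
  halted : Bool

def Config.init {n d : ℕ} (s : Fin n) : Config n d := ⟨Memory.init, s, fun _ => 0, 0, false⟩

namespace Learner

variable {n m d : ℕ} [NeZero m]

/-- The action encoded in the memory. -/
def action (m : ℕ) [NeZero m] (μ : Memory) : Fin m := Fin.ofNat m (μ.nat 1 0 0 0)

/-- One round: the learner computes, and then halts or takes an action in the environment `M`. -/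
noncomputable def round (L : Learner) (I : Problem n m d) (M : MOMDP n m d) (c : Config n d) :
    PMF (Config n d) :=
  if c.halted then PMF.pure c
  else
    let μ := L.learn.exec (I.view c.state c.lastReward) c.memory
    if μ.nat 0 0 0 0 ≠ 0 then PMF.pure { c with memory := μ, halted := true }
    else (M.trans c.state (action m μ)).map fun s' =>
      { memory := μ
        state := s'
        lastReward := M.reward c.state (action m μ)
        actions := c.actions + 1
        halted := false }

/-- The law of the configuration after `N` rounds, upon starting in the state `s`. -/
noncomputable def run (L : Learner) (I : Problem n m d) (M : MOMDP n m d) (s : Fin n) :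
    ℕ → PMF (Config n d)
  | 0 => PMF.pure (Config.init s)
  | N + 1 => (L.run I M s N).bind (L.round I M)

/-- The memory of the output policy after a run of `decide` in the state `s`. -/
noncomputable def decideStep (L : Learner) (I : Problem n m d) (μ : Memory) (s : Fin n) : Memory :=
  L.decide.exec (I.view s fun _ => 0) μ

/-- The memory of the output policy after the history `τ`, if `learn` has left the memory `μ`. -/
noncomputable def decideMem (L : Learner) (I : Problem n m d) (μ : Memory)
    (τ : List (Fin n × Fin m)) : Memory :=
  τ.foldl (fun ν x => L.decideStep I ν x.1) μ

/-- The policy that is output if `learn` halts with the memory `μ`. -/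
noncomputable def output (L : Learner) (I : Problem n m d) (μ : Memory) : Policy n m :=
  fun τ s => PMF.pure (action m (L.decideStep I (L.decideMem I μ τ) s))

end Learner

namespace Problem

variable {n m d : ℕ}

/-- The standing assumptions on the parameters. -/
structure Valid (I : Problem n m d) : Prop where
  horizon_pos : 1 ≤ I.T
  discount_mem : I.γ ∈ Set.Ico (0 : ℝ) 1
  accuracy_pos : 0 < I.ε
  failure_mem : I.β ∈ Set.Ioo (0 : ℝ) 1
  isModulus : IsUnifContModulus I.W I.ω

/-- The sum of `1/ε`, `1/β`, `|S|`, `|A|`, `T`, `d` and a constant `1/ω(1)` of the welfare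
function. -/
noncomputable def size (I : Problem n m d) : ℝ :=
  1 / I.ε + 1 / I.β + n + m + I.T + d + 1 / I.ω 1

/-- The bound on the number of actions: polynomial. -/
noncomputable def actionBound (I : Problem n m d) (C k : ℕ) : ℝ := C * I.size ^ k

/-- The bound on the computation time: polynomial, times a `d`-th power. -/
noncomputable def timeBound (I : Problem n m d) (C k : ℕ) : ℝ :=
  C * I.size ^ k * (d * I.T ^ 2 / I.ω (I.ε / 4) + 2) ^ d

end Problem

/-! ### Verification of programs -/

/-! The algorithm is a model-based explorer. A state-action pair is sampled until its count reaches
`quota`; then it is known and its counts are frozen. In the empirical model, `explore` is the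
largest expectation of λ^τ, restricted to τ ≤ T, where τ is the number of actions up to and
including the first unknown one. Here λ = 1 - 1/(2T), so that λ^T ≥ 1/2. If this value at the
current state is at least `threshold`, the learner takes the maximizing action; otherwise it solves
the empirical decision problem and halts.

Exploitation. When `explore` is small, every policy has a small empirical probability of meeting an
unknown pair within the horizon, and meeting one changes the value by at most 2 `osc`, since all
welfares differ from W(0) by at most `osc`. At known pairs the model errs by at most `drift * osc`
per step. Both losses, and ε/4 for rounding, are collected in `Know.error`, which propagates through
one Bellman step by `Know.Sound.error_step`. Hence the computed value exceeds the value of every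
policy up to one error (`Know.Sound.value_le`), and the output policy attains it up to one error
(`Know.Sound.le_value`). Two errors are at most ε at the halting state.

The welfare is not additive, so the state has to be augmented by the accumulated discounted reward.
This vector is rounded down to a grid of mesh ω(ε/4)/(dT): T roundings move it by less than ω(ε/4)
in the ℓ1 norm, hence the welfare by less than ε/4. Grid points are coded as d-digit numbers in base
`grid`. All accumulated rewards stay below T, so no digit overflows, and a transition just adds a
precomputed offset to the code. The table over codes is the source of the d-th power in the time
bound.

Exploration. While the estimates are accurate, the number of missing samples minus `explore` drops
in expectation by at least `drift` with every action (`Know.Sound.progress`): a sample of an unknown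
pair removes 1 from the first term, and after a known pair the discount λ makes `explore` grow.
Accuracy is controlled by second moments: the sum of squared deviations of the counts minus the
number of samples is a supermartingale (`Know.sum_mul_deviation_observe_le`). The suitably scaled
sum of the two quantities, `Know.potential`, is a nonnegative supermartingale that starts below β
and is at least 1 at every kind of failure. Markov's inequality then bounds the failure probability.

Programs are verified by a frame rule (a program changes only the arrays it mentions as targets) and
by loop invariants. Running times follow because all loop bounds depend only on the parameters and
on one array that is not written while it is in use. -/

namespace Memory

variable (μ : Memory) (a b i j k v c : ℕ) (x : ℝ)

@[simp] theorem tick_nat : (μ.tick c).nat = μ.nat := rfl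
@[simp] theorem tick_real : (μ.tick c).real = μ.real := rfl
@[simp] theorem tick_time : (μ.tick c).time = μ.time + c := rfl
@[simp] theorem setNat_real : (μ.setNat a i j k v).real = μ.real := rfl
@[simp] theorem setNat_time : (μ.setNat a i j k v).time = μ.time := rfl
@[simp] theorem setReal_nat : (μ.setReal a i j k x).nat = μ.nat := rfl
@[simp] theorem setReal_time : (μ.setReal a i j k x).time = μ.time := rfl

theorem setNat_nat_self :
    (μ.setNat a i j k v).nat a =
      fun i' j' k' => if i' = i ∧ j' = j ∧ k' = k then v else μ.nat a i' j' k' := by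
  funext i' j' k'
  simp [setNat]

theorem setReal_real_self :
    (μ.setReal a i j k x).real a =
      fun i' j' k' => if i' = i ∧ j' = j ∧ k' = k then x else μ.real a i' j' k' := by
  funext i' j' k'
  simp [setReal]

variable {a b}

theorem setNat_nat_of_ne (h : b ≠ a) : (μ.setNat a i j k v).nat b = μ.nat b := by
  funext i' j' k'
  simp [setNat, h]

theorem setReal_real_of_ne (h : b ≠ a) : (μ.setReal a i j k x).real b = μ.real b := by
  funext i' j' k'
  simp [setReal, h]

end Memory

namespace NatExpr

/-- The scalar variable held in entry `[0, 0, 0]` of the array `a` of naturals. -/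
def var (a : ℕ) : NatExpr := get a (const 0) (const 0) (const 0)

@[simp] theorem eval_var (v : View) (μ : Memory) (a : ℕ) : (var a).eval v μ = μ.nat a 0 0 0 := rfl

@[simp] theorem cost_var (a : ℕ) : (var a).cost = 4 := rfl

/-- Whether the expression reads no array other than `b`. -/
def readsOnly (b : ℕ) : NatExpr → Bool
  | get a i j k => a == b && i.readsOnly b && j.readsOnly b && k.readsOnly b
  | add e f => e.readsOnly b && f.readsOnly b
  | sub e f => e.readsOnly b && f.readsOnly b
  | _ => true

/-- Lets loop bounds be evaluated in any earlier memory that has the same array `b`, which is what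
the time analysis needs. -/
theorem eval_eq_of_readsOnly {v : View} {μ ν : Memory} {b : ℕ} (h : μ.nat b = ν.nat b)
    (e : NatExpr) (he : e.readsOnly b = true) : e.eval v μ = e.eval v ν := by
  induction e with
  | get a i j k hi hj hk =>
    simp only [readsOnly, Bool.and_eq_true, beq_iff_eq] at he
    obtain ⟨⟨⟨rfl, h1⟩, h2⟩, h3⟩ := he
    simp only [eval, hi h1, hj h2, hk h3, h]
  | add e f h1 h2 =>
    simp only [readsOnly, Bool.and_eq_true] at he
    simp only [eval, h1 he.1, h2 he.2]
  | sub e f h1 h2 =>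
    simp only [readsOnly, Bool.and_eq_true] at he
    simp only [eval, h1 he.1, h2 he.2]
  | _ => rfl

end NatExpr

namespace RealExpr

/-- The scalar variable held in entry `[0, 0, 0]` of the array `a` of reals. -/
def var (a : ℕ) : RealExpr := get a (.const 0) (.const 0) (.const 0)

@[simp] theorem eval_var (v : View) (μ : Memory) (a : ℕ) : (var a).eval v μ = μ.real a 0 0 0 := rfl

@[simp] theorem cost_var (d a : ℕ) : (var a).cost d = 4 := rfl

/-- Whether the expression reads no array other than the array `b` of naturals. -/
def readsOnly (b : ℕ) : RealExpr → Bool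
  | ofNat e => e.readsOnly b
  | discount => true
  | accuracy => true
  | failure => true
  | reward i => i.readsOnly b
  | get _ _ _ _ => false
  | add x y => x.readsOnly b && y.readsOnly b
  | sub x y => x.readsOnly b && y.readsOnly b
  | mul x y => x.readsOnly b && y.readsOnly b
  | div x y => x.readsOnly b && y.readsOnly b
  | welfare _ _ _ => false
  | modulus x => x.readsOnly b

theorem eval_eq_of_readsOnly {v : View} {μ ν : Memory} {b : ℕ} (h : μ.nat b = ν.nat b)
    (e : RealExpr) (he : e.readsOnly b = true) : e.eval v μ = e.eval v ν := by
  induction e with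
  | ofNat e => simp only [eval, e.eval_eq_of_readsOnly h he]
  | reward i => simp only [eval, i.eval_eq_of_readsOnly h he]
  | get => cases he
  | welfare => cases he
  | modulus x hx => simp only [eval, hx he]
  | add x y h1 h2 =>
    simp only [readsOnly, Bool.and_eq_true] at he
    simp only [eval, h1 he.1, h2 he.2]
  | sub x y h1 h2 =>
    simp only [readsOnly, Bool.and_eq_true] at he
    simp only [eval, h1 he.1, h2 he.2]
  | mul x y h1 h2 =>
    simp only [readsOnly, Bool.and_eq_true] at he
    simp only [eval, h1 he.1, h2 he.2]
  | div x y h1 h2 =>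
    simp only [readsOnly, Bool.and_eq_true] at he
    simp only [eval, h1 he.1, h2 he.2]
  | _ => rfl

end RealExpr

namespace Prog

/-- The arrays of naturals to which the program may write. -/
def natTargets : Prog → List ℕ
  | skip => []
  | setNat a _ _ _ _ => [a]
  | setReal _ _ _ _ _ => []
  | seq p q => p.natTargets ++ q.natTargets
  | ite _ _ p q => p.natTargets ++ q.natTargets
  | loop a _ p => a :: p.natTargets

/-- The arrays of reals to which the program may write. -/
def realTargets : Prog → List ℕ
  | skip => []
  | setNat _ _ _ _ _ => []
  | setReal a _ _ _ _ => [a]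
  | seq p q => p.realTargets ++ q.realTargets
  | ite _ _ p q => p.realTargets ++ q.realTargets
  | loop _ _ p => p.realTargets

theorem foldl_preserves {α β : Type*} (f : α → β → α) (P : α → Prop)
    (hf : ∀ x c, P x → P (f x c)) (l : List β) (x : α) (hx : P x) : P (l.foldl f x) := by
  induction l generalizing x with
  | nil => exact hx
  | cons c l ih => exact ih _ (hf _ _ hx)

/-- The frame rule: the only writes are those listed syntactically, loop counters included. -/
theorem exec_nat {v : View} {b : ℕ} (p : Prog) (hp : b ∉ p.natTargets) (μ : Memory) :
    (p.exec v μ).nat b = μ.nat b := by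
  induction p generalizing μ with
  | skip => rfl
  | setNat a i j k e =>
    simp only [natTargets, List.mem_singleton] at hp
    exact Memory.setNat_nat_of_ne _ _ _ _ _ hp
  | setReal => rfl
  | seq p q h1 h2 =>
    simp only [natTargets, List.mem_append, not_or] at hp
    simp only [exec, h2 hp.2, h1 hp.1]
  | ite x y p q h1 h2 =>
    simp only [natTargets, List.mem_append, not_or] at hp
    simp only [exec]
    split_ifs
    · rw [h1 hp.1, Memory.tick_nat]
    · rw [h2 hp.2, Memory.tick_nat]
  | loop a x p h =>
    simp only [natTargets, List.mem_cons, not_or] at hp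
    simp only [exec]
    refine foldl_preserves _ (fun ν : Memory => ν.nat b = μ.nat b) (fun ν c hν => ?_) _ _ rfl
    rw [h hp.2, Memory.tick_nat, Memory.setNat_nat_of_ne _ _ _ _ _ hp.1, hν]

theorem exec_real {v : View} {b : ℕ} (p : Prog) (hp : b ∉ p.realTargets) (μ : Memory) :
    (p.exec v μ).real b = μ.real b := by
  induction p generalizing μ with
  | skip => rfl
  | setNat => rfl
  | setReal a i j k e =>
    simp only [realTargets, List.mem_singleton] at hp
    exact Memory.setReal_real_of_ne _ _ _ _ _ hp
  | seq p q h1 h2 =>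
    simp only [realTargets, List.mem_append, not_or] at hp
    simp only [exec, h2 hp.2, h1 hp.1]
  | ite x y p q h1 h2 =>
    simp only [realTargets, List.mem_append, not_or] at hp
    simp only [exec]
    split_ifs
    · rw [h1 hp.1, Memory.tick_real]
    · rw [h2 hp.2, Memory.tick_real]
  | loop a x p h =>
    simp only [realTargets] at hp
    simp only [exec]
    refine foldl_preserves _ (fun ν : Memory => ν.real b = μ.real b) (fun ν c hν => ?_) _ _ rfl
    rw [h hp, Memory.tick_real, Memory.setNat_real, hν]

theorem foldl_range_induction {α : Type*} (f : α → ℕ → α) (P : ℕ → α → Prop) (K : ℕ) (x : α)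
    (zero : P 0 x) (step : ∀ c < K, ∀ y, P c y → P (c + 1) (f y c)) :
    P K ((List.range K).foldl f x) := by
  induction K with
  | zero => exact zero
  | succ K ih =>
    rw [List.range_succ, List.foldl_append]
    exact step K (Nat.lt_succ_self K) _ (ih fun c hc => step c (hc.trans (Nat.lt_succ_self K)))

/-- The memories agree on all arrays of naturals outside `A` and all arrays of reals outside `R`. -/
structure Agree (A R : List ℕ) (μ ν : Memory) : Prop where
  nat : ∀ b, b ∉ A → ν.nat b = μ.nat b
  real : ∀ b, b ∉ R → ν.real b = μ.real b

theorem Agree.trans {A R : List ℕ} {μ ν ξ : Memory} (h : Agree A R μ ν) (h' : Agree A R ν ξ) :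
    Agree A R μ ξ :=
  ⟨fun b hb => (h'.nat b hb).trans (h.nat b hb), fun b hb => (h'.real b hb).trans (h.real b hb)⟩

theorem Agree.mono {A R A' R' : List ℕ} {μ ν : Memory} (h : Agree A R μ ν) (hA : A ⊆ A')
    (hR : R ⊆ R') : Agree A' R' μ ν :=
  ⟨fun b hb => h.nat b fun h' => hb (hA h'), fun b hb => h.real b fun h' => hb (hR h')⟩

/-- The form in which the frame rule is applied. For concrete programs both inclusions are
decidable, and everything outside the two lists can then be rewritten back to the earlier memory. -/
theorem agree_exec {A R : List ℕ} (v : View) (p : Prog) (hA : p.natTargets ⊆ A)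
    (hR : p.realTargets ⊆ R) (μ : Memory) : Agree A R μ (p.exec v μ) :=
  ⟨fun _ hb => exec_nat _ (fun h => hb (hA h)) _, fun _ hb => exec_real _ (fun h => hb (hR h)) _⟩

/-- The invariant rule for loops. -/
theorem exec_loop {v : View} {a : ℕ} {x : RealExpr} {p : Prog} {μ : Memory} {K : ℕ}
    {A R : List ℕ} (hK : ⌈x.eval v μ⌉₊ = K) (hA : a :: p.natTargets ⊆ A)
    (hR : p.realTargets ⊆ R) (P : ℕ → Memory → Prop)
    (zero : ∀ ν : Memory, ν.nat = μ.nat → ν.real = μ.real → P 0 ν)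
    (step : ∀ c < K, ∀ ν ν' : Memory, P c ν → ν'.real = ν.real →
      (∀ b, b ≠ a → ν'.nat b = ν.nat b) → ν'.nat a 0 0 0 = c → Agree A R μ ν' →
      P (c + 1) (p.exec v ν')) :
    P K ((loop a x p).exec v μ) := by
  subst hK
  simp only [exec]
  -- The frame condition relative to the memory before the loop is carried along with the invariant,
  -- so that the step may use it.
  refine (foldl_range_induction (α := Memory) _ (fun c ν => P c ν ∧ Agree A R μ ν) _ (μ.tick _)
      ⟨zero _ rfl rfl, fun _ _ => rfl, fun _ _ => rfl⟩ ?_).1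
  rintro c hc ν ⟨h1, h2⟩
  have hne : ∀ b, b ≠ a → ((ν.setNat a 0 0 0 c).tick 1).nat b = ν.nat b :=
    fun b hb => Memory.setNat_nat_of_ne _ _ _ _ _ hb
  have key : Agree A R μ ((ν.setNat a 0 0 0 c).tick 1) :=
    h2.trans ⟨fun b hb => hne b fun h => hb (hA (by simp [h])), fun _ _ => rfl⟩
  exact ⟨step c hc ν _ h1 rfl hne (by simp [Memory.setNat]) key,
    key.trans (agree_exec v p (fun b hb => hA (List.mem_cons_of_mem _ hb)) hR _)⟩

/-- The loops of the program read no array other than the array `b` of naturals in their bounds. -/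
def boundsReadOnly (b : ℕ) : Prog → Bool
  | seq p q => p.boundsReadOnly b && q.boundsReadOnly b
  | ite _ _ p q => p.boundsReadOnly b && q.boundsReadOnly b
  | loop _ x p => x.readsOnly b && p.boundsReadOnly b
  | _ => true

/-- An upper bound for the number of steps of a program, if the bounds of its loops have in its
course the values that they have in the memory `ν`. -/
noncomputable def costBound (v : View) (ν : Memory) : Prog → ℕ
  | skip => 1
  | setNat _ i j k e => 1 + i.cost + j.cost + k.cost + e.cost
  | setReal _ i j k x => 1 + i.cost + j.cost + k.cost + x.cost v.dim
  | seq p q => p.costBound v ν + q.costBound v ν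
  | ite x y p q => 1 + x.cost v.dim + y.cost v.dim + (p.costBound v ν + q.costBound v ν)
  | loop _ x p => 1 + x.cost v.dim + ⌈x.eval v ν⌉₊ * (1 + p.costBound v ν)

/-- Since the program never writes the array `b`, each loop bound keeps the value it has in `ν`,
however often the loop is entered. This makes the time bound a purely syntactic recursion. -/
theorem time_exec_le {v : View} {b : ℕ} {ν : Memory} (p : Prog)
    (hp : b ∉ p.natTargets) (hb : p.boundsReadOnly b = true)
    (μ : Memory) (hμ : μ.nat b = ν.nat b) :
    (p.exec v μ).time ≤ μ.time + p.costBound v ν := by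
  induction p generalizing μ with
  | skip => rfl
  | setNat a i j k e => simp [exec, costBound]
  | setReal => simp [exec, costBound]
  | seq p q h1 h2 =>
    simp only [natTargets, List.mem_append, not_or] at hp
    simp only [boundsReadOnly, Bool.and_eq_true] at hb
    have e1 := h1 hp.1 hb.1 μ hμ
    have e2 := h2 hp.2 hb.2 (p.exec v μ) (by rw [exec_nat _ hp.1, hμ])
    simp only [exec, costBound]
    omega
  | ite x y p q h1 h2 =>
    simp only [natTargets, List.mem_append, not_or] at hp
    simp only [boundsReadOnly, Bool.and_eq_true] at hb
    simp only [exec, costBound]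
    split_ifs
    · have := h1 hp.1 hb.1 (μ.tick (1 + x.cost v.dim + y.cost v.dim)) hμ
      simp only [Memory.tick_time] at this
      omega
    · have := h2 hp.2 hb.2 (μ.tick (1 + x.cost v.dim + y.cost v.dim)) hμ
      simp only [Memory.tick_time] at this
      omega
  | loop a x p h =>
    have hp' := hp
    simp only [natTargets, List.mem_cons, not_or] at hp
    simp only [boundsReadOnly, Bool.and_eq_true] at hb
    simp only [exec, costBound]
    rw [← x.eval_eq_of_readsOnly hμ hb.1]
    refine (foldl_range_induction _ (fun c (ν' : Memory) => ν'.nat b = ν.nat b ∧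
      ν'.time ≤ μ.time + (1 + x.cost v.dim + c * (1 + p.costBound v ν))) _ (μ.tick _)
      ⟨hμ, by simp⟩ ?_).2
    rintro c - ν' ⟨h1, h2⟩
    have e1 : ((ν'.setNat a 0 0 0 c).tick 1).nat b = ν.nat b :=
      (Memory.setNat_nat_of_ne _ _ _ _ _ hp.1).trans h1
    refine ⟨(exec_nat _ hp.2 _).trans e1, (h hp.2 hb.2 _ e1).trans ?_⟩
    simp only [Memory.tick_time, Memory.setNat_time]
    linarith

end Prog

/-! ### Sums over states and maximization over actions -/

open Finset in
theorem eval_congr_range {n : ℕ} {f g : ℕ → ℝ} (h : ∀ c < n, f c = g c) :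
    ∑ c ∈ range n, f c = ∑ c ∈ range n, g c :=
  sum_congr rfl fun c hc => h c (mem_range.1 hc)

/-- The last maximizer of `Q` on `{0, ..., c - 1}`. -/
noncomputable def bestArg (Q : ℕ → ℝ) : ℕ → ℕ
  | 0 => 0
  | c + 1 => if Q (bestArg Q c) ≤ Q c then c else bestArg Q c

theorem bestArg_lt (Q : ℕ → ℝ) {c : ℕ} (hc : 0 < c) : bestArg Q c < c := by
  induction c with
  | zero => omega
  | succ c ih =>
    simp only [bestArg]
    split_ifs with h
    · omega
    · rcases Nat.eq_zero_or_pos c with rfl | hc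
      · simp [bestArg] at h
      · exact (ih hc).trans (Nat.lt_succ_self c)

theorem le_bestArg (Q : ℕ → ℝ) {c a : ℕ} (ha : a < c) : Q a ≤ Q (bestArg Q c) := by
  induction c with
  | zero => omega
  | succ c ih =>
    simp only [bestArg]
    rcases Nat.lt_succ_iff_lt_or_eq.1 ha with h | rfl
    · split_ifs with h'
      · exact (ih h).trans h'
      · exact ih h
    · split_ifs with h'
      · exact le_rfl
      · exact (not_le.1 h').le

namespace Prog

@[simp] theorem exec_seq (v : View) (p q : Prog) (μ : Memory) :
    (seq p q).exec v μ = q.exec v (p.exec v μ) := rfl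

/-- Sums the values of `e` over all states, held in the variable 8, into the real variable 5. -/
def sumStates (e : RealExpr) : Prog :=
  seq (setReal 5 (.const 0) (.const 0) (.const 0) (.ofNat (.const 0)))
    (loop 8 (.ofNat .numStates)
      (setReal 5 (.const 0) (.const 0) (.const 0) (.add (.var 5) e)))

/-- The summand may read anything except the accumulator 5; the counter 8 enters only through its
current value. Hence `he` ranges over all memories that differ from `μ` in these two arrays. -/
theorem exec_sumStates {v : View} {e : RealExpr} {μ : Memory} (f : ℕ → ℝ)
    (he : ∀ c < v.numStates, ∀ ν, Agree [8] [5] μ ν → ν.nat 8 0 0 0 = c → e.eval v ν = f c) :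
    ((sumStates e).exec v μ).real 5 0 0 0 = ∑ c ∈ Finset.range v.numStates, f c := by
  simp only [sumStates, exec_seq]
  have h0 := agree_exec (A := [8]) (R := [5]) v
    (setReal 5 (.const 0) (.const 0) (.const 0) (.ofNat (.const 0))) (by decide) (by decide) μ
  refine exec_loop (A := [8]) (R := [5]) (K := v.numStates)
    (by simp [RealExpr.eval, NatExpr.eval])
    (by simp [natTargets]) (by simp [realTargets])
    (fun c ν => ν.real 5 0 0 0 = ∑ c ∈ Finset.range c, f c) ?_ ?_
  · intro ν _ hν
    simp [hν, exec, Memory.setReal, RealExpr.eval, NatExpr.eval]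
  · intro c hc ν ν' h1 h2 h3 h4 h5
    rw [Finset.sum_range_succ, ← h1, ← he c hc ν' (h0.trans h5) h4, ← h2]
    simp [exec, Memory.setReal, RealExpr.eval, NatExpr.eval]

/-- Stores the maximum over all actions, held in the variable 7, of the value that `p` computes
into the real variable 5, and a maximizer. -/
def argmax (tV tA : ℕ) (i j l : NatExpr) (p : Prog) : Prog :=
  loop 7 (.ofNat .numActions)
    (seq p
      (ite (.ofNat (.var 7)) (.ofNat (.const 0))
        (seq (setReal tV i j l (.var 5)) (setNat tA i j l (.var 7)))
        (ite (.get tV i j l) (.var 5)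
          (seq (setReal tV i j l (.var 5)) (setNat tA i j l (.var 7))) skip)))

/-- The body `p` may read the table `tV` that is being written, but `hQ` only grants it the entries
other than the target one. This is what allows one row of a table to be computed from another row of
the same table. -/
theorem exec_argmax {v : View} {tV tA : ℕ} {i j l : NatExpr} {p : Prog} {μ : Memory}
    {i₀ j₀ l₀ : ℕ} (hm : 0 < v.numActions) (hV : tV ≠ 5) (hA7 : tA ≠ 7)
    (hpN : p.natTargets ⊆ [8]) (hpR : p.realTargets ⊆ [5])
    (hi : ∀ ν, Agree [7, 8, tA] [5, tV] μ ν → i.eval v ν = i₀)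
    (hj : ∀ ν, Agree [7, 8, tA] [5, tV] μ ν → j.eval v ν = j₀)
    (hl : ∀ ν, Agree [7, 8, tA] [5, tV] μ ν → l.eval v ν = l₀) (hA8 : tA ≠ 8)
    (Q : ℕ → ℝ)
    (hQ : ∀ a < v.numActions, ∀ ν, Agree [7, 8, tA] [5, tV] μ ν → ν.nat 7 0 0 0 = a →
      (∀ i' j' l', ¬(i' = i₀ ∧ j' = j₀ ∧ l' = l₀) → ν.real tV i' j' l' = μ.real tV i' j' l') →
      (p.exec v ν).real 5 0 0 0 = Q a) :
    let μ' := (argmax tV tA i j l p).exec v μ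
    (μ'.real tV = fun i' j' l' => if i' = i₀ ∧ j' = j₀ ∧ l' = l₀ then
        Q (bestArg Q v.numActions) else μ.real tV i' j' l') ∧
      (μ'.nat tA = fun i' j' l' => if i' = i₀ ∧ j' = j₀ ∧ l' = l₀ then
        bestArg Q v.numActions else μ.nat tA i' j' l') := by
  intro μ'
  obtain ⟨h1, h2, h3⟩ : (0 < v.numActions →
        (μ'.real tV i₀ j₀ l₀ = Q (bestArg Q v.numActions) ∧ μ'.nat tA i₀ j₀ l₀ = bestArg Q v.numActions)) ∧
      (∀ i' j' l', ¬(i' = i₀ ∧ j' = j₀ ∧ l' = l₀) → μ'.real tV i' j' l' = μ.real tV i' j' l') ∧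
      (∀ i' j' l', ¬(i' = i₀ ∧ j' = j₀ ∧ l' = l₀) → μ'.nat tA i' j' l' = μ.nat tA i' j' l') := by
    have hpN' : ∀ b, b ∈ p.natTargets → b = 8 := fun b hb => by simpa using hpN hb
    have hpR' : ∀ b, b ∈ p.realTargets → b = 5 := fun b hb => by simpa using hpR hb
    refine exec_loop (A := [7, 8, tA]) (R := [5, tV]) (by simp [RealExpr.eval, NatExpr.eval])
      ?_ ?_ (fun (c : ℕ) (ν : Memory) => (0 < c →
        (ν.real tV i₀ j₀ l₀ = Q (bestArg Q c) ∧ ν.nat tA i₀ j₀ l₀ = bestArg Q c)) ∧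
      (∀ i' j' l', ¬(i' = i₀ ∧ j' = j₀ ∧ l' = l₀) → ν.real tV i' j' l' = μ.real tV i' j' l') ∧
      (∀ i' j' l', ¬(i' = i₀ ∧ j' = j₀ ∧ l' = l₀) → ν.nat tA i' j' l' = μ.nat tA i' j' l')) ?_ ?_
    · intro b hb
      simp only [natTargets, List.mem_cons, List.mem_append, List.not_mem_nil, or_false] at hb ⊢
      have := hpN' b
      tauto
    · intro b hb
      simp only [realTargets, List.mem_cons, List.mem_append, List.not_mem_nil, or_false] at hb ⊢
      have := hpR' b
      tauto
    · intro ν h1 h2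
      exact ⟨fun h => absurd h (lt_irrefl 0), fun _ _ _ _ => by rw [h2],
        fun _ _ _ _ => by rw [h1]⟩
    · intro c hc ν ν' ⟨h1, h2, h3⟩ hr hn hc' hag
      have e5 := hQ c hc ν' hag hc' (by rw [hr]; exact h2)
      have hp := agree_exec (A := [8]) (R := [5]) v p hpN hpR ν'
      have hag' := hag.trans (hp.mono (A' := [7, 8, tA]) (R' := [5, tV]) (by simp) (by simp))
      have e7 : (p.exec v ν').nat 7 0 0 0 = c := by rw [hp.nat 7 (by decide), hc']
      have eA : (p.exec v ν').nat tA = ν.nat tA := by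
        rw [hp.nat tA (by simpa using hA8), hn _ hA7]
      have eV : (p.exec v ν').real tV = ν.real tV := by
        rw [hp.real tV (by simpa using hV), hr]
      rw [exec_seq]
      generalize p.exec v ν' = ξ at *
      have ei : ∀ k : ℕ, i.eval v (ξ.tick k) = i₀ := fun k => hi _ ⟨hag'.nat, hag'.real⟩
      have ej : ∀ k : ℕ, j.eval v (ξ.tick k) = j₀ := fun k => hj _ ⟨hag'.nat, hag'.real⟩
      have el : ∀ k : ℕ, l.eval v (ξ.tick k) = l₀ := fun k => hl _ ⟨hag'.nat, hag'.real⟩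
      -- The effect of storing a new record. It occurs in two branches that differ only in the time
      -- spent.
      have upd : ∀ ζ : Memory, ζ.nat = ξ.nat → ζ.real = ξ.real →
          (((seq (setReal tV i j l (.var 5)) (setNat tA i j l (.var 7))).exec v ζ).real tV =
            fun i' j' l' => if i' = i₀ ∧ j' = j₀ ∧ l' = l₀ then Q c else ν.real tV i' j' l') ∧
          (((seq (setReal tV i j l (.var 5)) (setNat tA i j l (.var 7))).exec v ζ).nat tA =
            fun i' j' l' => if i' = i₀ ∧ j' = j₀ ∧ l' = l₀ then c else ν.nat tA i' j' l') := by
        intro ζ hz1 hz2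
        have hz : Agree [7, 8, tA] [5, tV] μ ζ :=
          ⟨fun b hb => by rw [hz1, hag'.nat b hb], fun b hb => by rw [hz2, hag'.real b hb]⟩
        have hz' := hz.trans (agree_exec (A := [7, 8, tA]) (R := [5, tV]) v
          (setReal tV i j l (.var 5)) (by simp [natTargets]) (by simp [realTargets]) ζ)
        simp only [exec_seq]
        constructor
        · simp only [exec, Memory.tick_real, Memory.setNat_real, Memory.setReal_real_self,
            hi _ hz, hj _ hz, hl _ hz, RealExpr.eval_var, hz2, e5, eV]
        · have e : ((setReal tV i j l (.var 5)).exec v ζ).nat = ξ.nat := by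
            simp [exec, hz1]
          generalize (setReal tV i j l (.var 5)).exec v ζ = ζ' at *
          simp only [exec, Memory.tick_nat, Memory.setNat_nat_self, hi _ hz', hj _ hz', hl _ hz',
            NatExpr.eval_var, e, e7, eA]
      have fin : ∀ ζ : Memory, bestArg Q (c + 1) = c →
          (ζ.real tV = fun i' j' l' => if i' = i₀ ∧ j' = j₀ ∧ l' = l₀ then Q c
            else ν.real tV i' j' l') ∧
          (ζ.nat tA = fun i' j' l' => if i' = i₀ ∧ j' = j₀ ∧ l' = l₀ then c
            else ν.nat tA i' j' l') →
          (0 < c + 1 → (ζ.real tV i₀ j₀ l₀ = Q (bestArg Q (c + 1)) ∧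
            ζ.nat tA i₀ j₀ l₀ = bestArg Q (c + 1))) ∧
          (∀ i' j' l', ¬(i' = i₀ ∧ j' = j₀ ∧ l' = l₀) →
            ζ.real tV i' j' l' = μ.real tV i' j' l') ∧
          (∀ i' j' l', ¬(i' = i₀ ∧ j' = j₀ ∧ l' = l₀) →
            ζ.nat tA i' j' l' = μ.nat tA i' j' l') := by
        rintro ζ hb ⟨hz1, hz2⟩
        refine ⟨fun _ => ?_, fun i' j' l' h => ?_, fun i' j' l' h => ?_⟩
        · rw [hz1, hz2, hb]; simp
        · rw [hz1]; simp only [if_neg h, h2 _ _ _ h]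
        · rw [hz2]; simp only [if_neg h, h3 _ _ _ h]
      rw [exec]
      -- For action 0 the table entry may be a leftover of an earlier computation, so it is
      -- overwritten without a comparison.
      split_ifs with hc0
      · simp only [RealExpr.eval, NatExpr.eval_var, e7, NatExpr.eval, Nat.cast_le,
          nonpos_iff_eq_zero] at hc0
        subst hc0
        exact fin _ (by simp [bestArg]) (upd _ rfl rfl)
      · simp only [RealExpr.eval, NatExpr.eval_var, e7, NatExpr.eval, Nat.cast_le,
          nonpos_iff_eq_zero] at hc0
        have hcp := Nat.pos_of_ne_zero hc0
        rw [exec]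
        split_ifs with hle
        · simp only [RealExpr.eval, ei, ej, el, Memory.tick_real, eV,
            RealExpr.eval_var, e5, (h1 hcp).1] at hle
          exact fin _ (by simp [bestArg, hle]) (upd _ rfl rfl)
        · simp only [RealExpr.eval, ei, ej, el, Memory.tick_real, eV,
            RealExpr.eval_var, e5, (h1 hcp).1] at hle
          have hb : bestArg Q (c + 1) = bestArg Q c := by simp [bestArg, hle]
          simp only [exec, Memory.tick_nat, Memory.tick_real, eV, eA, hb]
          exact ⟨fun _ => h1 hcp, h2, h3⟩
  constructor
  · funext i' j' l'
    split_ifs with h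
    · rw [h.1, h.2.1, h.2.2, (h1 hm).1]
    · exact h2 _ _ _ h
  · funext i' j' l'
    split_ifs with h
    · rw [h.1, h.2.1, h.2.2, (h1 hm).2]
    · exact h3 _ _ _ h

end Prog

/-! ### Backward induction -/

namespace Prog

/-- Backward induction: for `k = 0, 1, ...` the entries `[k + 1, s, x]` with `x < X` of the array
`tV` are computed by maximization over all actions of the values computed by `p`. -/
def bellman (tV tA : ℕ) (X : RealExpr) (p : Prog) : Prog :=
  loop 5 (.ofNat .horizon) (loop 6 (.ofNat .numStates) (loop 11 X
    (argmax tV tA (.add (.var 5) (.const 1)) (.var 6) (.var 11) p)))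

section

variable {v : View} {tV tA : ℕ} {X : RealExpr} {p : Prog} {μ : Memory} {X₀ : ℕ}
  (hm : 0 < v.numActions) (hV : tV ≠ 5) (hA : tA ∉ [5, 6, 7, 8, 11])
  (hpN : p.natTargets ⊆ [8]) (hpR : p.realTargets ⊆ [5])
  (hX : ∀ ν, Agree [5, 6, 7, 8, 11, tA] [5, tV] μ ν → ⌈X.eval v ν⌉₊ = X₀)
  (Q : (ℕ → ℕ → ℝ) → ℕ → ℕ → ℕ → ℕ → ℝ)
  (hQ : ∀ ν, Agree [5, 6, 7, 8, 11, tA] [5, tV] μ ν → ν.nat 5 0 0 0 < v.horizon →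
    ν.nat 6 0 0 0 < v.numStates → ν.nat 11 0 0 0 < X₀ → ν.nat 7 0 0 0 < v.numActions →
    (p.exec v ν).real 5 0 0 0 = Q (ν.real tV (ν.nat 5 0 0 0)) (ν.nat 5 0 0 0) (ν.nat 6 0 0 0)
      (ν.nat 11 0 0 0) (ν.nat 7 0 0 0))

include hpN in
theorem natTargets_argmax_subset (i j l : NatExpr) :
    (argmax tV tA i j l p).natTargets ⊆ [7, 8, tA] := by
  intro b hb
  simp only [argmax, natTargets, List.mem_cons, List.mem_append, List.not_mem_nil, or_false]
    at hb ⊢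
  have : b ∈ p.natTargets → b = 8 := fun hb => by simpa using hpN hb
  tauto

include hpR in
theorem realTargets_argmax_subset (i j l : NatExpr) :
    (argmax tV tA i j l p).realTargets ⊆ [5, tV] := by
  intro b hb
  simp only [argmax, realTargets, List.mem_cons, List.mem_append, List.not_mem_nil, or_false]
    at hb ⊢
  have : b ∈ p.realTargets → b = 5 := fun hb => by simpa using hpR hb
  tauto

include hm hV hA hpN hpR hX hQ

/-- Row `k` stays intact while row `k + 1` is filled, so all maximizations refer to the same
function `Q (μ₁.real tV k)`. -/
theorem exec_bellman_row {k s : ℕ} (hk : k < v.horizon) (hs : s < v.numStates) {μ₁ : Memory}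
    (h1 : Agree [5, 6, 7, 8, 11, tA] [5, tV] μ μ₁) (hk' : μ₁.nat 5 0 0 0 = k)
    (hs' : μ₁.nat 6 0 0 0 = s) :
    (((loop 11 X (argmax tV tA (.add (.var 5) (.const 1)) (.var 6) (.var 11) p)).exec v μ₁).real tV
      = fun i j l => if i = k + 1 ∧ j = s ∧ l < X₀ then
        Q (μ₁.real tV k) k s l (bestArg (Q (μ₁.real tV k) k s l) v.numActions)
        else μ₁.real tV i j l) ∧
    ((loop 11 X (argmax tV tA (.add (.var 5) (.const 1)) (.var 6) (.var 11) p)).exec v μ₁).nat tA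
      = fun i j l => if i = k + 1 ∧ j = s ∧ l < X₀ then
        bestArg (Q (μ₁.real tV k) k s l) v.numActions else μ₁.nat tA i j l := by
  simp only [List.mem_cons, List.not_mem_nil, or_false, not_or] at hA
  have e1 := natTargets_argmax_subset (tV := tV) (tA := tA) hpN (.add (.var 5) (.const 1))
    (.var 6) (.var 11)
  have e2 := realTargets_argmax_subset (tV := tV) (tA := tA) hpR (.add (.var 5) (.const 1))
    (.var 6) (.var 11)
  refine exec_loop (A := [7, 8, 11, tA]) (R := [5, tV]) (hX _ h1) ?_ e2
    (fun c ν => (ν.real tV = fun i j l => if i = k + 1 ∧ j = s ∧ l < c then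
        Q (μ₁.real tV k) k s l (bestArg (Q (μ₁.real tV k) k s l) v.numActions)
        else μ₁.real tV i j l) ∧
      ν.nat tA = fun i j l => if i = k + 1 ∧ j = s ∧ l < c then
        bestArg (Q (μ₁.real tV k) k s l) v.numActions else μ₁.nat tA i j l) ?_ ?_
  · refine List.cons_subset.2 ⟨by simp, List.Subset.trans e1 ?_⟩
    simp
  · intro ν hν1 hν2
    simp [hν1, hν2]
  · rintro c hc ν ν' ⟨i1, i2⟩ hr hn hc' hag
    have hk2 : ν'.nat 5 0 0 0 = k := by
      rw [hag.nat 5 (by simp; omega), hk']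
    have hs2 : ν'.nat 6 0 0 0 = s := by
      rw [hag.nat 6 (by simp; omega), hs']
    have hag' : Agree [5, 6, 7, 8, 11, tA] [5, tV] μ ν' :=
      h1.trans (hag.mono (by simp) (by simp))
    obtain ⟨r1, r2⟩ := exec_argmax (v := v) (tV := tV) (tA := tA) (p := p) (μ := ν')
      (i := .add (.var 5) (.const 1)) (j := .var 6) (l := .var 11) (i₀ := k + 1) (j₀ := s)
      (l₀ := c) hm hV (by omega) hpN hpR
      (fun ζ hζ => by
        simp only [NatExpr.eval, NatExpr.eval_var, hζ.nat 5 (by simp; omega), hk2])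
      (fun ζ hζ => by
        simp only [NatExpr.eval_var, hζ.nat 6 (by simp; omega), hs2])
      (fun ζ hζ => by
        simp only [NatExpr.eval_var, hζ.nat 11 (by simp; omega), hc'])
      (by omega)
      (Q (μ₁.real tV k) k s c) (by
        intro a ha ζ hζ h7 htV
        have q1 : ζ.nat 5 0 0 0 = k := by rw [hζ.nat 5 (by simp; omega), hk2]
        have q2 : ζ.nat 6 0 0 0 = s := by rw [hζ.nat 6 (by simp; omega), hs2]
        have q3 : ζ.nat 11 0 0 0 = c := by rw [hζ.nat 11 (by simp; omega), hc']
        have q4 : ζ.real tV k = μ₁.real tV k := by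
          funext j l
          rw [htV _ _ _ (by omega), hr, i1]
          simp
        have := hQ ζ (hag'.trans (hζ.mono (by simp) (by simp))) (by omega) (by omega) (by omega)
          (by omega)
        rwa [q1, q2, q3, q4, h7] at this)
    constructor
    · rw [r1]
      funext i j l
      rw [hr, i1]
      by_cases h : i = k + 1 ∧ j = s
      · rcases lt_trichotomy l c with h' | rfl | h'
        · simp [h, h'.ne, h', h'.trans (Nat.lt_succ_self c)]
        · simp [h]
        · simp [h, h'.ne', h'.not_gt, not_lt.2 (Nat.succ_le_of_lt h')]
      · have : ∀ P : Prop, ¬(i = k + 1 ∧ j = s ∧ P) := by tauto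
        simp only [this, if_false]
    · rw [r2]
      funext i j l
      rw [hn tA (by omega), i2]
      by_cases h : i = k + 1 ∧ j = s
      · rcases lt_trichotomy l c with h' | rfl | h'
        · simp [h, h'.ne, h', h'.trans (Nat.lt_succ_self c)]
        · simp [h]
        · simp [h, h'.ne', h'.not_gt, not_lt.2 (Nat.succ_le_of_lt h')]
      · have : ∀ P : Prop, ¬(i = k + 1 ∧ j = s ∧ P) := by tauto
        simp only [this, if_false]

theorem exec_bellman_stage {k : ℕ} (hk : k < v.horizon) {μ₁ : Memory}
    (h1 : Agree [5, 6, 7, 8, 11, tA] [5, tV] μ μ₁) (hk' : μ₁.nat 5 0 0 0 = k) :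
    (((loop 6 (.ofNat .numStates) (loop 11 X
      (argmax tV tA (.add (.var 5) (.const 1)) (.var 6) (.var 11) p))).exec v μ₁).real tV
      = fun i j l => if i = k + 1 ∧ j < v.numStates ∧ l < X₀ then
        Q (μ₁.real tV k) k j l (bestArg (Q (μ₁.real tV k) k j l) v.numActions)
        else μ₁.real tV i j l) ∧
    ((loop 6 (.ofNat .numStates) (loop 11 X
      (argmax tV tA (.add (.var 5) (.const 1)) (.var 6) (.var 11) p))).exec v μ₁).nat tA
      = fun i j l => if i = k + 1 ∧ j < v.numStates ∧ l < X₀ then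
        bestArg (Q (μ₁.real tV k) k j l) v.numActions else μ₁.nat tA i j l := by
  have hA' := hA
  simp only [List.mem_cons, List.not_mem_nil, or_false, not_or] at hA
  have e1 := natTargets_argmax_subset (tV := tV) (tA := tA) hpN (.add (.var 5) (.const 1))
    (.var 6) (.var 11)
  have e2 := realTargets_argmax_subset (tV := tV) (tA := tA) hpR (.add (.var 5) (.const 1))
    (.var 6) (.var 11)
  refine exec_loop (A := [6, 7, 8, 11, tA]) (R := [5, tV]) (K := v.numStates)
    ?_ ?_ ?_
    (fun c ν => (ν.real tV = fun i j l => if i = k + 1 ∧ j < c ∧ l < X₀ then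
        Q (μ₁.real tV k) k j l (bestArg (Q (μ₁.real tV k) k j l) v.numActions)
        else μ₁.real tV i j l) ∧
      ν.nat tA = fun i j l => if i = k + 1 ∧ j < c ∧ l < X₀ then
        bestArg (Q (μ₁.real tV k) k j l) v.numActions else μ₁.nat tA i j l) ?_ ?_
  · simp only [RealExpr.eval, NatExpr.eval, Nat.ceil_natCast]
  · refine List.cons_subset.2 ⟨by simp, List.cons_subset.2 ⟨by simp, List.Subset.trans e1 ?_⟩⟩
    simp
  · exact e2
  · intro ν hν1 hν2
    simp [hν1, hν2]
  · rintro c hc ν ν' ⟨i1, i2⟩ hr hn hc' hag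
    have hk2 : ν'.nat 5 0 0 0 = k := by
      rw [hag.nat 5 (by simp; omega), hk']
    have hag' : Agree [5, 6, 7, 8, 11, tA] [5, tV] μ ν' :=
      h1.trans (hag.mono (by simp) (by simp))
    obtain ⟨r1, r2⟩ := exec_bellman_row hm hV hA' hpN hpR hX Q hQ hk hc hag' hk2 hc'
    have q4 : ν'.real tV k = μ₁.real tV k := by
      funext j l
      rw [hr, i1]
      simp
    rw [q4] at r1 r2
    constructor
    · rw [r1]
      funext i j l
      rw [hr, i1]
      by_cases h : i = k + 1 ∧ l < X₀
      · rcases lt_trichotomy j c with h' | rfl | h'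
        · simp [h, h'.ne, h', h'.trans (Nat.lt_succ_self c)]
        · simp [h]
        · simp [h, h'.ne', h'.not_gt, not_lt.2 (Nat.succ_le_of_lt h')]
      · have : ∀ P : Prop, ¬(i = k + 1 ∧ P ∧ l < X₀) := by tauto
        simp only [this, if_false]
    · rw [r2]
      funext i j l
      rw [hn tA (by omega), i2]
      by_cases h : i = k + 1 ∧ l < X₀
      · rcases lt_trichotomy j c with h' | rfl | h'
        · simp [h, h'.ne, h', h'.trans (Nat.lt_succ_self c)]
        · simp [h]
        · simp [h, h'.ne', h'.not_gt, not_lt.2 (Nat.succ_le_of_lt h')]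
      · have : ∀ P : Prop, ¬(i = k + 1 ∧ P ∧ l < X₀) := by tauto
        simp only [this, if_false]

/-- Stage `k` writes only row `k + 1`. The rows computed earlier are therefore final, and the
recursion can be stated entirely in terms of the final memory. -/
theorem exec_bellman :
    (((bellman tV tA X p).exec v μ).real tV 0 = μ.real tV 0) ∧
    ∀ k < v.horizon, ∀ s < v.numStates, ∀ x < X₀,
      ((bellman tV tA X p).exec v μ).real tV (k + 1) s x =
        Q (((bellman tV tA X p).exec v μ).real tV k) k s x
          (((bellman tV tA X p).exec v μ).nat tA (k + 1) s x) ∧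
      ((bellman tV tA X p).exec v μ).nat tA (k + 1) s x =
        bestArg (Q (((bellman tV tA X p).exec v μ).real tV k) k s x) v.numActions := by
  have hA' := hA
  simp only [List.mem_cons, List.not_mem_nil, or_false, not_or] at hA
  have e1 := natTargets_argmax_subset (tV := tV) (tA := tA) hpN (.add (.var 5) (.const 1))
    (.var 6) (.var 11)
  have e2 := realTargets_argmax_subset (tV := tV) (tA := tA) hpR (.add (.var 5) (.const 1))
    (.var 6) (.var 11)
  unfold bellman
  refine exec_loop (A := [5, 6, 7, 8, 11, tA]) (R := [5, tV]) (K := v.horizon)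
    ?_ ?_ ?_
    (fun c ν => (ν.real tV 0 = μ.real tV 0) ∧
      ∀ k < c, ∀ s < v.numStates, ∀ x < X₀,
        ν.real tV (k + 1) s x = Q (ν.real tV k) k s x (ν.nat tA (k + 1) s x) ∧
        ν.nat tA (k + 1) s x = bestArg (Q (ν.real tV k) k s x) v.numActions) ?_ ?_
  · simp only [RealExpr.eval, NatExpr.eval, Nat.ceil_natCast]
  · refine List.cons_subset.2 ⟨by simp, List.cons_subset.2 ⟨by simp, List.cons_subset.2
      ⟨by simp, List.Subset.trans e1 ?_⟩⟩⟩
    simp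
  · exact e2
  · intro ν hν1 hν2
    simp [hν2]
  · rintro c hc ν ν' ⟨i1, i2⟩ hr hn hc' hag
    obtain ⟨r1, r2⟩ := exec_bellman_stage hm hV hA' hpN hpR hX Q hQ hc hag hc'
    generalize (loop 6 _ _).exec v ν' = ξ at *
    have hlow : ∀ k ≤ c, ξ.real tV k = ν.real tV k := by
      intro k hk
      rw [r1, hr]
      funext j l
      simp only [show k ≠ c + 1 by omega, false_and, if_false]
    refine ⟨by rw [hlow 0 (by omega), i1], fun k hk s hs x hx => ?_⟩
    rw [hlow k (by omega)]
    rcases Nat.lt_succ_iff_lt_or_eq.1 hk with h | rfl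
    · have e : ξ.nat tA (k + 1) = ν.nat tA (k + 1) := by
        rw [r2, hn tA (by omega)]
        funext j l
        simp only [show k + 1 ≠ c + 1 by omega, false_and, if_false]
      rw [e, hlow (k + 1) (by omega)]
      exact i2 k h s hs x hx
    · rw [r1, r2, hr]
      simp [hs, hx]

end

end Prog

/-! ### Loops that fill tables -/

namespace Prog

open Classical in
-- The value `F` does not depend on the iteration, so it is harmless if several iterations fill the
-- same entry. Nesting the rule yields tables indexed by several loop variables.
theorem exec_loop_fill_nat {v : View} {a : ℕ} {x : RealExpr} {p : Prog} {μ : Memory} {K tA : ℕ}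
    {A R : List ℕ} (hK : ⌈x.eval v μ⌉₊ = K) (hA : a :: p.natTargets ⊆ A)
    (hR : p.realTargets ⊆ R) (S : ℕ → ℕ → ℕ → ℕ → Prop) (F : ℕ → ℕ → ℕ → ℕ) (ha : tA ≠ a)
    (hp : ∀ c < K, ∀ ν, Agree A R μ ν → ν.nat a 0 0 0 = c →
      (p.exec v ν).nat tA = fun i j l => if S c i j l then F i j l else ν.nat tA i j l) :
    ((loop a x p).exec v μ).nat tA =
      fun i j l => if ∃ c < K, S c i j l then F i j l else μ.nat tA i j l := by
  refine exec_loop hK hA hR (fun K (ν : Memory) => ν.nat tA =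
      fun i j l => if ∃ c < K, S c i j l then F i j l else μ.nat tA i j l) ?_ ?_
  · intro ν h _
    simp [h]
  · intro c hc ν ν' h1 _ h3 h4 h5
    rw [hp c hc ν' h5 h4, h3 tA ha, h1]
    funext i j l
    by_cases h : S c i j l
    · rw [if_pos h, if_pos ⟨c, Nat.lt_succ_self c, h⟩]
    · rw [if_neg h]
      have : (∃ c' < c + 1, S c' i j l) ↔ ∃ c' < c, S c' i j l := by
        constructor
        · rintro ⟨c', h1, h2⟩
          rcases Nat.lt_succ_iff_lt_or_eq.1 h1 with h1 | rfl
          · exact ⟨c', h1, h2⟩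
          · exact absurd h2 h
        · rintro ⟨c', h1, h2⟩
          exact ⟨c', h1.trans (Nat.lt_succ_self c), h2⟩
      simp only [this]

open Classical in
-- In contrast to the version for naturals, the body may rely on the entries outside the region to
-- be filled being unchanged. This is needed when one row of an array is copied to another one.
theorem exec_loop_fill_real {v : View} {a : ℕ} {x : RealExpr} {p : Prog} {μ : Memory} {K tV : ℕ}
    {A R : List ℕ} (hK : ⌈x.eval v μ⌉₊ = K) (hA : a :: p.natTargets ⊆ A)
    (hR : p.realTargets ⊆ R) (S : ℕ → ℕ → ℕ → ℕ → Prop) (F : ℕ → ℕ → ℕ → ℝ)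
    (hp : ∀ c < K, ∀ ν, Agree A R μ ν → ν.nat a 0 0 0 = c →
      (∀ i j l, (¬∃ c < K, S c i j l) → ν.real tV i j l = μ.real tV i j l) →
      (p.exec v ν).real tV = fun i j l => if S c i j l then F i j l else ν.real tV i j l) :
    ((loop a x p).exec v μ).real tV =
      fun i j l => if ∃ c < K, S c i j l then F i j l else μ.real tV i j l := by
  refine exec_loop hK hA hR (fun K (ν : Memory) => ν.real tV =
      fun i j l => if ∃ c < K, S c i j l then F i j l else μ.real tV i j l) ?_ ?_
  · intro ν _ h
    simp [h]
  · intro c hc ν ν' h1 h2 h3 h4 h5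
    rw [hp c hc ν' h5 h4 (fun i j l h => by
      rw [h2, h1]
      exact if_neg fun ⟨c', h6, h7⟩ => h ⟨c', h6.trans hc, h7⟩), h2, h1]
    funext i j l
    by_cases h : S c i j l
    · rw [if_pos h, if_pos ⟨c, Nat.lt_succ_self c, h⟩]
    · rw [if_neg h]
      have : (∃ c' < c + 1, S c' i j l) ↔ ∃ c' < c, S c' i j l := by
        constructor
        · rintro ⟨c', h1, h2⟩
          rcases Nat.lt_succ_iff_lt_or_eq.1 h1 with h1 | rfl
          · exact ⟨c', h1, h2⟩
          · exact absurd h2 h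
        · rintro ⟨c', h1, h2⟩
          exact ⟨c', h1.trans (Nat.lt_succ_self c), h2⟩
      simp only [this]

end Prog

/-! ### The parameters of the learner -/

namespace Problem

variable {n m d : ℕ} (I : Problem n m d)

/-- A bound for the oscillation of the welfare function. -/
noncomputable def osc : ℝ := d * I.T / I.ω 1 + 1

/-- Exploration stops in states from which its value is below this threshold. -/
noncomputable def threshold : ℝ := I.ε / (32 * I.osc)

/-- The expected progress of a step of exploration. -/
noncomputable def drift : ℝ := I.threshold / (4 * I.T)

/-- The accuracy of the estimates of transition probabilities. -/
noncomputable def tol : ℝ := I.drift / n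

/-- The number of samples after which a state-action pair counts as known. -/
noncomputable def quota : ℝ := 4 * n * m / (I.tol * I.tol * I.β) + 1

/-- The number of actions after which the learner gives up. -/
noncomputable def cap : ℝ := 2 * (n * m * (I.quota + 1) + 1) / (I.drift * I.β)

/-- The factor by which the value of exploration is discounted. -/
noncomputable def lam : ℝ := 1 - 1 / (2 * I.T)

/-- The mesh of the grid of accumulated rewards. -/
noncomputable def mesh : ℝ := I.ω (I.ε / 4) / (d * I.T)

variable (s : Fin n) (r : Fin d → ℝ)

@[simp] theorem view_numStates : (I.view s r).numStates = n := rfl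
@[simp] theorem view_numActions : (I.view s r).numActions = m := rfl
@[simp] theorem view_dim : (I.view s r).dim = d := rfl
@[simp] theorem view_horizon : (I.view s r).horizon = I.T := rfl
@[simp] theorem view_discount : (I.view s r).discount = I.γ := rfl
@[simp] theorem view_accuracy : (I.view s r).accuracy = I.ε := rfl
@[simp] theorem view_failure : (I.view s r).failure = I.β := rfl
@[simp] theorem view_modulus : (I.view s r).modulus = I.ω := rfl
@[simp] theorem view_state : (I.view s r).state = s := rfl

end Problem

namespace RealExpr

def nat (c : ℕ) : RealExpr := ofNat (.const c)
def osc : RealExpr :=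
  add (div (mul (ofNat .dim) (ofNat .horizon)) (modulus (nat 1))) (nat 1)
def threshold : RealExpr := div accuracy (mul (nat 32) osc)
def drift : RealExpr := div threshold (mul (nat 4) (ofNat .horizon))
def tol : RealExpr := div drift (ofNat .numStates)
def quota : RealExpr :=
  add (div (mul (mul (nat 4) (ofNat .numStates)) (ofNat .numActions))
    (mul (mul tol tol) failure)) (nat 1)
def cap : RealExpr :=
  div (mul (nat 2) (add (mul (mul (ofNat .numStates) (ofNat .numActions)) (add quota (nat 1)))
    (nat 1))) (mul drift failure)
def lam : RealExpr := sub (nat 1) (div (nat 1) (mul (nat 2) (ofNat .horizon)))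
def mesh : RealExpr :=
  div (modulus (div accuracy (nat 4))) (mul (ofNat .dim) (ofNat .horizon))

variable {n m d : ℕ} (I : Problem n m d) (s : Fin n) (r : Fin d → ℝ) (μ : Memory)

@[simp] theorem eval_nat (v : View) (c : ℕ) : (nat c).eval v μ = c := rfl

@[simp] theorem eval_osc : osc.eval (I.view s r) μ = I.osc := by
  simp [osc, Problem.osc, eval, NatExpr.eval]

@[simp] theorem eval_threshold : threshold.eval (I.view s r) μ = I.threshold := by
  simp [threshold, Problem.threshold, eval]

@[simp] theorem eval_drift : drift.eval (I.view s r) μ = I.drift := by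
  simp [drift, Problem.drift, eval, NatExpr.eval]

@[simp] theorem eval_tol : tol.eval (I.view s r) μ = I.tol := by
  simp [tol, Problem.tol, eval, NatExpr.eval]

@[simp] theorem eval_quota : quota.eval (I.view s r) μ = I.quota := by
  simp [quota, Problem.quota, eval, NatExpr.eval]

@[simp] theorem eval_cap : cap.eval (I.view s r) μ = I.cap := by
  simp [cap, Problem.cap, eval, NatExpr.eval]

@[simp] theorem eval_lam : lam.eval (I.view s r) μ = I.lam := by
  simp [lam, Problem.lam, eval, NatExpr.eval]

@[simp] theorem eval_mesh : mesh.eval (I.view s r) μ = I.mesh := by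
  simp [mesh, Problem.mesh, eval, NatExpr.eval]

end RealExpr

/-! ### What the learner knows -/

/-- The observations of the transition process: numbers of samples of state-action pairs, numbers
of observed transitions, and observed rewards. -/
structure Know where
  num : ℕ → ℕ → ℝ
  cnt : ℕ → ℕ → ℕ → ℝ
  rew : ℕ → ℕ → ℕ → ℝ

namespace Know

/-- The empirical transition probabilities. -/
noncomputable def freq (K : Know) (s a z : ℕ) : ℝ := K.cnt s a z / K.num s a

open Classical in
/-- The knowledge after a transition from `s` to `z` by the action `a` with the reward `r`, which
is disregarded if the quota `q` is reached. -/
noncomputable def observe (K : Know) (q : ℝ) (s a z : ℕ) {d : ℕ} (r : Fin d → ℝ) : Know :=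
  if q ≤ K.num s a then K else
    { num := fun s' a' => if s' = s ∧ a' = a then K.num s a + 1 else K.num s' a'
      cnt := fun s' a' z' => if s' = s ∧ a' = a ∧ z' = z then K.cnt s a z + 1 else K.cnt s' a' z'
      rew := fun s' a' i => if h : s' = s ∧ a' = a ∧ i < d then r ⟨i, h.2.2⟩ else K.rew s' a' i }

variable {n m d : ℕ}

open Classical in
/-- The value of the action `a` in the state `s` for exploration, if `f` is the value one step
later. -/
noncomputable def exploreQ (K : Know) (I : Problem n m d) (f : ℕ → ℝ) (s a : ℕ) : ℝ :=
  if I.quota ≤ K.num s a then I.lam * ∑ z ∈ Finset.range n, K.freq s a z * f z else I.lam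

/-- The value of exploration for `k` steps. -/
noncomputable def explore (K : Know) (I : Problem n m d) : ℕ → ℕ → ℝ
  | 0, _ => 0
  | k + 1, s => K.exploreQ I (K.explore I k) s (bestArg (K.exploreQ I (K.explore I k) s) m)

/-- The action that the learner takes in the state `s` for exploration. -/
noncomputable def exploreAction (K : Know) (I : Problem n m d) (s : ℕ) : ℕ :=
  bestArg (K.exploreQ I (K.explore I (I.T - 1)) s) m

end Know

/-- The other arrays of reals: 3 counts the actions, 4 and 6 hold the values of exploration and of
the discretized problem, 5 is an accumulator, 7 holds decoded grid points and 8 powers of the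
discount factor. Arrays of naturals: 0 is the halting flag, 1 the action, 2 to 4 the transition to
be recorded, 5 to 12 loop counters, 13 and 17 maximizers, 14 and 15 powers of the grid size, 16
encoded rewards, 18 and 19 the grid point and the time of the output policy. -/
def Memory.know (μ : Memory) : Know := ⟨fun s a => μ.real 0 s a 0, μ.real 1, μ.real 2⟩

theorem Memory.know_congr {μ ν : Memory} (h0 : ν.real 0 = μ.real 0) (h1 : ν.real 1 = μ.real 1)
    (h2 : ν.real 2 = μ.real 2) : ν.know = μ.know := by
  simp only [Memory.know, h0, h1, h2]

/-! ### Recording samples and planning the exploration -/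

namespace Prog

/-- Records the last transition. -/
def book : Prog :=
  ite (.nat 1) (.ofNat (.var 2))
    (ite .quota (.get 0 (.var 3) (.var 4) (.const 0)) skip
      (seq (setReal 1 (.var 3) (.var 4) .state
        (.add (.get 1 (.var 3) (.var 4) .state) (.nat 1)))
      (seq (setReal 0 (.var 3) (.var 4) (.const 0)
        (.add (.get 0 (.var 3) (.var 4) (.const 0)) (.nat 1)))
        (loop 9 (.ofNat .dim) (setReal 2 (.var 3) (.var 4) (.var 9) (.reward (.var 9)))))))
    skip

/-- A transition is recorded one round late, when its outcome is visible: the arrays 3 and 4 hold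
the previous state and action, while `s` and `r` are the current observation. Array 2 is still 0 in
the first round, when there is nothing to record. -/
theorem know_book {n m d : ℕ} (I : Problem n m d) (s : Fin n) (r : Fin d → ℝ) (μ : Memory) :
    (book.exec (I.view s r) μ).know = if 1 ≤ μ.nat 2 0 0 0 then
      μ.know.observe I.quota (μ.nat 3 0 0 0) (μ.nat 4 0 0 0) s r else μ.know := by
  classical
  unfold book
  rw [exec]
  have e1 : ((RealExpr.nat 1).eval (I.view s r) μ ≤
      (RealExpr.ofNat (.var 2)).eval (I.view s r) μ) ↔ 1 ≤ μ.nat 2 0 0 0 := by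
    simp [RealExpr.eval]
  by_cases h : 1 ≤ μ.nat 2 0 0 0
  · rw [if_pos (e1.2 h), if_pos h, exec]
    by_cases h' : I.quota ≤ μ.know.num (μ.nat 3 0 0 0) (μ.nat 4 0 0 0)
    · rw [if_pos (by simpa [RealExpr.eval, NatExpr.eval, Memory.know] using h')]
      rw [Know.observe, if_pos h']
      rfl
    · rw [if_neg (by simpa [RealExpr.eval, NatExpr.eval, Memory.know] using h')]
      rw [Know.observe, if_neg h']
      simp only [exec_seq]
      generalize hξ : exec _ (setReal 0 _ _ _ _) _ = ξ
      have n3 : ξ.nat = μ.nat := by rw [← hξ]; rfl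
      have r0 : ξ.real 0 = fun i j l => if i = μ.nat 3 0 0 0 ∧ j = μ.nat 4 0 0 0 ∧ l = 0 then
          μ.real 0 (μ.nat 3 0 0 0) (μ.nat 4 0 0 0) 0 + 1 else μ.real 0 i j l := by
        rw [← hξ]
        simp [exec, Memory.setReal, RealExpr.eval, NatExpr.eval]
      have r1 : ξ.real 1 = fun i j (l : ℕ) => if i = μ.nat 3 0 0 0 ∧ j = μ.nat 4 0 0 0 ∧ l = (s : ℕ) then
          μ.real 1 (μ.nat 3 0 0 0) (μ.nat 4 0 0 0) s + 1 else μ.real 1 i j l := by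
        rw [← hξ]
        simp [exec, Memory.setReal, RealExpr.eval, NatExpr.eval]
      have r2 : ξ.real 2 = μ.real 2 := by
        rw [← hξ]
        simp [exec, Memory.setReal]
      clear hξ
      have ag := agree_exec (A := [9]) (R := [2]) (I.view s r) (loop 9 (.ofNat .dim)
        (setReal 2 (.var 3) (.var 4) (.var 9) (.reward (.var 9)))) (by decide) (by decide) ξ
      have fill := exec_loop_fill_real (v := I.view s r) (a := 9) (x := .ofNat .dim)
        (p := setReal 2 (.var 3) (.var 4) (.var 9) (.reward (.var 9))) (μ := ξ) (K := d) (tV := 2)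
        (A := [9]) (R := [2]) (by simp [RealExpr.eval, NatExpr.eval]) (by decide) (by decide)
        (fun c i j l => i = μ.nat 3 0 0 0 ∧ j = μ.nat 4 0 0 0 ∧ l = c)
        (fun i j l => if h : l < d then r ⟨l, h⟩ else 0) (by
          intro c hc ν hν hc' _
          simp only [exec, Memory.tick_real, Memory.setReal_real_self, NatExpr.eval_var, hc',
            hν.nat 3 (by decide), hν.nat 4 (by decide), n3, RealExpr.eval]
          funext i j l
          by_cases h9 : i = μ.nat 3 0 0 0 ∧ j = μ.nat 4 0 0 0 ∧ l = c
          · rw [if_pos h9, if_pos h9, h9.2.2]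
            rfl
          · rw [if_neg h9, if_neg h9])
      simp only [Memory.know, ag.real 0 (by decide), ag.real 1 (by decide), r0, r1]
      congr 1
      · funext i j
        simp
      · rw [fill, r2]
        funext i j l
        by_cases h9 : i = μ.nat 3 0 0 0 ∧ j = μ.nat 4 0 0 0 ∧ l < d
        · rw [if_pos ⟨l, h9.2.2, h9.1, h9.2.1, rfl⟩, dif_pos h9, dif_pos h9.2.2]
        · rw [dif_neg h9, if_neg]
          rintro ⟨c, hc, h1, h2, rfl⟩
          exact h9 ⟨h1, h2, hc⟩
  · rw [if_neg (fun h' => h (e1.1 h')), if_neg h]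
    rfl

/-- Computes the values of exploration into the array 4 of reals. -/
def plan : Prog :=
  seq (loop 6 (.ofNat .numStates) (setReal 4 (.const 0) (.var 6) (.const 0) (.nat 0)))
    (bellman 4 13 (.nat 1)
      (seq (sumStates (.mul (.div (.get 1 (.var 6) (.var 7) (.var 8))
          (.get 0 (.var 6) (.var 7) (.const 0))) (.get 4 (.var 5) (.var 8) (.const 0))))
        (ite .quota (.get 0 (.var 6) (.var 7) (.const 0))
          (setReal 5 (.const 0) (.const 0) (.const 0) (.mul .lam (.var 5)))
          (setReal 5 (.const 0) (.const 0) (.const 0) .lam))))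

theorem exec_plan {n m d : ℕ} (hm : 0 < m) (I : Problem n m d) (s₀ : Fin n) (r : Fin d → ℝ)
    (μ : Memory) :
    (∀ k ≤ I.T, ∀ s < n,
      (plan.exec (I.view s₀ r) μ).real 4 k s 0 = μ.know.explore I k s) ∧
    (1 ≤ I.T → ∀ s < n,
      (plan.exec (I.view s₀ r) μ).nat 13 I.T s 0 = μ.know.exploreAction I s) := by
  classical
  unfold plan
  rw [exec_seq]
  have fill := exec_loop_fill_real (v := I.view s₀ r) (a := 6) (x := .ofNat .numStates)
    (p := setReal 4 (.const 0) (.var 6) (.const 0) (.nat 0)) (μ := μ) (K := n) (tV := 4)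
    (A := [6]) (R := [4]) (by simp [RealExpr.eval, NatExpr.eval]) (by decide) (by decide)
    (fun c i j l => i = 0 ∧ j = c ∧ l = 0) (fun _ _ _ => 0) (by
      intro c _ ν _ hc' _
      simp only [exec, Memory.tick_real, Memory.setReal_real_self, NatExpr.eval_var, hc',
        NatExpr.eval, RealExpr.eval_nat, Nat.cast_zero]
      funext i j l
      split_ifs <;> rfl)
  have ag := agree_exec (A := [6]) (R := [4]) (I.view s₀ r) (loop 6 (.ofNat .numStates)
    (setReal 4 (.const 0) (.var 6) (.const 0) (.nat 0))) (by decide) (by decide) μ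
  generalize (loop 6 _ _).exec _ μ = ξ at *
  obtain ⟨h0, hk⟩ := exec_bellman (v := I.view s₀ r) (tV := 4) (tA := 13) (X := .nat 1)
    (p := (seq (sumStates (.mul (.div (.get 1 (.var 6) (.var 7) (.var 8))
          (.get 0 (.var 6) (.var 7) (.const 0))) (.get 4 (.var 5) (.var 8) (.const 0))))
        (ite .quota (.get 0 (.var 6) (.var 7) (.const 0))
          (setReal 5 (.const 0) (.const 0) (.const 0) (.mul .lam (.var 5)))
          (setReal 5 (.const 0) (.const 0) (.const 0) .lam)))) (μ := ξ) (X₀ := 1)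
    hm (by decide) (by decide) (by decide) (by decide) (by simp)
    (fun f _ s _ a => μ.know.exploreQ I (fun z => f z 0) s a) (by
      intro ν hν _ _ _ _
      rw [exec_seq]
      have hs := exec_sumStates (v := I.view s₀ r) (e := (.mul (.div (.get 1 (.var 6) (.var 7)
          (.var 8)) (.get 0 (.var 6) (.var 7) (.const 0))) (.get 4 (.var 5) (.var 8) (.const 0))))
        (μ := ν) (fun z => μ.know.freq (ν.nat 6 0 0 0) (ν.nat 7 0 0 0) z *
          ν.real 4 (ν.nat 5 0 0 0) z 0) (by
          intro c _ ζ hζ h8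
          simp only [RealExpr.eval, NatExpr.eval_var, NatExpr.eval, hζ.nat 6 (by decide),
            hζ.nat 7 (by decide), hζ.nat 5 (by decide), h8, hζ.real 4 (by decide),
            hζ.real 1 (by decide), hζ.real 0 (by decide), hν.real 1 (by decide),
            hν.real 0 (by decide), ag.real 1 (by decide), ag.real 0 (by decide), Know.freq,
            Memory.know])
      have ag2 := agree_exec (A := [8]) (R := [5]) (I.view s₀ r) (sumStates (.mul (.div
        (.get 1 (.var 6) (.var 7) (.var 8)) (.get 0 (.var 6) (.var 7) (.const 0)))
        (.get 4 (.var 5) (.var 8) (.const 0)))) (by decide) (by decide) ν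
      generalize (sumStates _).exec _ ν = ζ at *
      have e0 : ζ.real 0 = μ.real 0 := by
        rw [ag2.real 0 (by decide), hν.real 0 (by decide), ag.real 0 (by decide)]
      rw [exec]
      simp only [RealExpr.eval_quota, RealExpr.eval, NatExpr.eval_var, NatExpr.eval, e0,
        ag2.nat 6 (by decide), ag2.nat 7 (by decide), Know.exploreQ]
      have hq : ∀ s a, μ.know.num s a = μ.real 0 s a 0 := fun _ _ => rfl
      simp only [hq]
      split_ifs
      · simp [exec, Memory.setReal, RealExpr.eval, NatExpr.eval, hs]
      · simp [exec, Memory.setReal, NatExpr.eval])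
  generalize (bellman _ _ _ _).exec _ ξ = ζ at *
  simp only [Problem.view_horizon, Problem.view_numStates, Problem.view_numActions] at hk
  have hz : ∀ k ≤ I.T, ∀ s < n, ζ.real 4 k s 0 = μ.know.explore I k s := by
    intro k
    induction k with
    | zero =>
      intro _ s hs
      rw [h0, fill]
      exact if_pos ⟨s, hs, rfl, rfl, rfl⟩
    | succ k ih =>
      intro hkT s hs
      have e : (fun a => μ.know.exploreQ I (fun z => ζ.real 4 k z 0) s a) =
          μ.know.exploreQ I (μ.know.explore I k) s := by
        funext a
        simp only [Know.exploreQ]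
        rw [eval_congr_range fun z hz => by rw [ih (by omega) z hz]]
      obtain ⟨q1, q2⟩ := hk k (by omega) s hs 0 (by omega)
      rw [q1, q2, Know.explore, e]
      exact congrFun e _
  refine ⟨hz, fun hT s hs => ?_⟩
  have q2 := (hk (I.T - 1) (by omega) s hs 0 (by omega)).2
  rw [Nat.sub_add_cancel hT] at q2
  -- The action for `T` remaining steps maximizes the values computed with the row for `T - 1`
  -- steps.
  rw [q2, Know.exploreAction]
  congr 1
  funext a
  simp only [Know.exploreQ]
  rw [eval_congr_range fun z h => by rw [hz (I.T - 1) (by omega) z h]]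

end Prog

/-! ### The discretized decision problem and its solution -/

section

open Finset

namespace Problem

variable {n m d : ℕ} (I : Problem n m d)

/-- The number of grid points per coordinate. -/
noncomputable def grid : ℕ := ⌈(I.T : ℝ) / I.mesh + 1⌉₊

end Problem

/-- The number with the digits `v 0, ..., v (d - 1)` in base `G`. -/
def encode (G d : ℕ) (v : ℕ → ℕ) : ℕ := ∑ i ∈ range d, v i * G ^ i

theorem encode_lt {G : ℕ} (d : ℕ) (v : ℕ → ℕ) (hv : ∀ i < d, v i < G) : encode G d v < G ^ d := by
  induction d with
  | zero => simp [encode]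
  | succ d ih =>
    have h1 := ih fun i hi => hv i (by omega)
    have h2 : v d + 1 ≤ G := hv d (by omega)
    unfold encode at *
    rw [sum_range_succ, pow_succ]
    calc _ < G ^ d + v d * G ^ d := by omega
      _ = (v d + 1) * G ^ d := by ring
      _ ≤ G * G ^ d := Nat.mul_le_mul_right _ h2
      _ = G ^ d * G := by ring

namespace Know

variable {n m d : ℕ}

/-- The number of mesh sizes, rounded down, in coordinate `i` of the reward at time `t`. -/
noncomputable def gridReward (K : Know) (I : Problem n m d) (t s a i : ℕ) : ℕ :=
  ⌊I.γ ^ t * K.rew s a i / I.mesh⌋₊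

/-- The value of the action `a` in the state `s` at the grid point number `x`, at time `t`, if the
values one step later are given by `f`. -/
noncomputable def exploitQ (K : Know) (I : Problem n m d) (t : ℕ) (f : ℕ → ℕ → ℝ) (s x a : ℕ) :
    ℝ :=
  ∑ z ∈ range n, K.freq s a z * f z (x + encode I.grid d (K.gridReward I t s a))

/-- The memory contains a solution of the discretized decision problem. -/
structure Solved (K : Know) (I : Problem n m d) (μ : Memory) : Prop where
  offset : ∀ t < I.T, ∀ s < n, ∀ a < m,
    μ.nat 16 t s a = encode I.grid d (K.gridReward I t s a)
  terminal : ∀ v : ℕ → ℕ, (∀ i, v i < I.grid) → ∀ s < n,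
    μ.real 6 0 s (encode I.grid d v) = I.W (fun i => I.mesh * v i) - I.W 0
  step : ∀ k < I.T, ∀ s < n, ∀ x < I.grid ^ d,
    μ.real 6 (k + 1) s x =
      K.exploitQ I (I.T - (k + 1)) (μ.real 6 k) s x (μ.nat 17 (k + 1) s x) ∧
    μ.nat 17 (k + 1) s x = bestArg (K.exploitQ I (I.T - (k + 1)) (μ.real 6 k) s x) m

/-- The observed rewards are in the unit interval. -/
def RewardsMem (K : Know) (n m d : ℕ) : Prop :=
  ∀ s < n, ∀ a < m, ∀ i < d, K.rew s a i ∈ Set.Icc (0 : ℝ) 1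

end Know

namespace Prog

/-- Computes the powers of the number of grid points per coordinate. -/
def powers : Prog :=
  seq (setNat 14 (.const 0) (.const 0) (.const 0) (.const 1))
    (loop 9 (.ofNat .dim)
      (seq (setNat 14 (.add (.var 9) (.const 1)) (.const 0) (.const 0) (.const 0))
        (loop 10 (.add (.div (.ofNat .horizon) .mesh) (.nat 1))
          (setNat 14 (.add (.var 9) (.const 1)) (.const 0) (.const 0)
            (.add (.get 14 (.add (.var 9) (.const 1)) (.const 0) (.const 0))
              (.get 14 (.var 9) (.const 0) (.const 0)))))))

/-- Computes the powers of the discount factor. -/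
def discounts : Prog :=
  seq (setReal 8 (.const 0) (.const 0) (.const 0) (.nat 1))
    (loop 5 (.ofNat .horizon)
      (setReal 8 (.add (.var 5) (.const 1)) (.const 0) (.const 0)
        (.mul (.get 8 (.var 5) (.const 0) (.const 0)) .discount)))

/-- Adds up the encoded, rounded reward of the current time, state and action. -/
def offset : Prog :=
  seq (setNat 16 (.var 5) (.var 6) (.var 7) (.const 0))
    (loop 9 (.ofNat .dim) (loop 10 (.div (.nat 1) .mesh)
      (ite (.ofNat (.add (.var 10) (.const 1)))
        (.div (.mul (.get 8 (.var 5) (.const 0) (.const 0)) (.get 2 (.var 6) (.var 7) (.var 9)))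
          .mesh)
        (setNat 16 (.var 5) (.var 6) (.var 7)
          (.add (.get 16 (.var 5) (.var 6) (.var 7)) (.get 14 (.var 9) (.const 0) (.const 0))))
        skip)))

/-- Computes all encoded, rounded rewards. -/
def offsets : Prog :=
  loop 5 (.ofNat .horizon) (loop 6 (.ofNat .numStates) (loop 7 (.ofNat .numActions) offset))

/-- Computes the vectors encoded by all numbers. -/
def decode : Prog :=
  seq (loop 12 (.ofNat .dim) (setReal 7 (.const 0) (.const 0) (.var 12) (.nat 0)))
    (loop 9 (.ofNat .dim) (loop 11 (.ofNat (.var 15))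
      (seq (loop 12 (.ofNat .dim)
          (setReal 7 (.add (.var 11) (.get 14 (.var 9) (.const 0) (.const 0))) (.const 0) (.var 12)
            (.get 7 (.var 11) (.const 0) (.var 12))))
        (setReal 7 (.add (.var 11) (.get 14 (.var 9) (.const 0) (.const 0))) (.const 0) (.var 9)
          (.add (.get 7 (.var 11) (.const 0) (.var 9)) .mesh)))))

/-- Computes the values at the horizon. -/
def terminal : Prog :=
  loop 6 (.ofNat .numStates) (loop 11 (.ofNat (.var 15))
    (setReal 6 (.const 0) (.var 6) (.var 11)
      (.sub (.welfare 7 (.var 11) (.const 0)) (.welfare 7 (.const 0) (.const 0)))))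

/-- The expected value one step later. -/
def successor : RealExpr :=
  .mul (.div (.get 1 (.var 6) (.var 7) (.var 8)) (.get 0 (.var 6) (.var 7) (.const 0)))
    (.get 6 (.var 5) (.var 8) (.add (.var 11)
      (.get 16 (.sub .horizon (.add (.var 5) (.const 1))) (.var 6) (.var 7))))

/-- Solves the discretized decision problem, after the number of grid points is computed. -/
def solve : Prog :=
  seq discounts (seq offsets (seq decode (seq terminal
    (bellman 6 17 (.ofNat (.var 15)) (sumStates successor)))))

/-- Solves the discretized decision problem. -/
def exploit : Prog :=
  seq powers (seq (setNat 15 (.const 0) (.const 0) (.const 0)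
    (.get 14 .dim (.const 0) (.const 0))) solve)

variable {n m d : ℕ} (I : Problem n m d) (s₀ : Fin n) (r : Fin d → ℝ)

/-- Neither rounding nor multiplication of naturals is available. A loop with the real bound T/mesh
+ 1 runs exactly `grid` times, and each time it adds the previous power. -/
theorem exec_powers (μ : Memory) :
    ∀ i ≤ d, (powers.exec (I.view s₀ r) μ).nat 14 i 0 0 = I.grid ^ i := by
  unfold powers
  rw [exec_seq]
  have h0 : (exec (I.view s₀ r) (setNat 14 (.const 0) (.const 0) (.const 0) (.const 1)) μ).nat 14
      0 0 0 = 1 := by simp [exec, Memory.setNat, NatExpr.eval]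
  generalize exec _ (setNat 14 (.const 0) (.const 0) (.const 0) (.const 1)) μ = ξ at *
  refine exec_loop (A := [9, 10, 14]) (R := []) (K := d)
    (by simp [RealExpr.eval, NatExpr.eval]) (by decide) (by decide)
    (fun c (ν : Memory) => ∀ i ≤ c, ν.nat 14 i 0 0 = I.grid ^ i) ?_ ?_
  · intro ν h1 _ i hi
    obtain rfl : i = 0 := by omega
    rw [h1, h0, pow_zero]
  · intro c _ ν ν' h1 h2 h3 h4 h5
    rw [exec_seq]
    have e1 : (exec (I.view s₀ r) (setNat 14 (.add (.var 9) (.const 1)) (.const 0) (.const 0)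
        (.const 0)) ν').nat 14 = fun i j l => if i = c + 1 ∧ j = 0 ∧ l = 0 then 0
          else ν.nat 14 i j l := by
      simp only [exec, Memory.tick_nat, Memory.setNat_nat_self, NatExpr.eval, NatExpr.eval_var,
        h4, h3 14 (by decide)]
    have e2 : (exec (I.view s₀ r) (setNat 14 (.add (.var 9) (.const 1)) (.const 0) (.const 0)
        (.const 0)) ν').nat 9 = ν'.nat 9 := exec_nat _ (by decide) _
    generalize exec _ (setNat 14 (.add (.var 9) (.const 1)) (.const 0) (.const 0)
        (.const 0)) ν' = ζ at *
    have key := exec_loop (v := I.view s₀ r) (a := 10)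
      (x := .add (.div (.ofNat .horizon) .mesh) (.nat 1)) (p := setNat 14
        (.add (.var 9) (.const 1)) (.const 0) (.const 0)
            (.add (.get 14 (.add (.var 9) (.const 1)) (.const 0) (.const 0))
              (.get 14 (.var 9) (.const 0) (.const 0)))) (μ := ζ)
      (A := [10, 14]) (R := []) (K := I.grid)
      (by simp [RealExpr.eval, NatExpr.eval, Problem.grid]) (by decide) (by decide)
      (fun c' (η : Memory) => η.nat 14 (c + 1) 0 0 = c' * I.grid ^ c ∧
        ∀ i ≤ c, η.nat 14 i 0 0 = I.grid ^ i) (by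
        intro η q1 _
        rw [q1, e1]
        refine ⟨by simp, fun i hi => ?_⟩
        exact (if_neg (by omega)).trans (h1 i hi)) (by
        intro c' _ η η' q1 q2 q3 q4 q5
        have e9 : η'.nat 9 0 0 0 = c := by rw [q5.nat 9 (by decide), e2, h4]
        rw [← q3 14 (by decide)] at q1
        simp only [exec, Memory.tick_nat, Memory.setNat_nat_self, NatExpr.eval, NatExpr.eval_var,
          e9, and_self, if_true, q1.1, q1.2 c le_rfl]
        refine ⟨by ring, fun i hi => ?_⟩
        rw [if_neg (by omega)]
        exact q1.2 i hi)
    intro i hi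
    rcases Nat.le_succ_iff.1 hi with hi | rfl
    · exact key.2 i hi
    · rw [key.1, pow_succ, mul_comm]

theorem exec_discounts (μ : Memory) :
    ∀ t ≤ I.T, (discounts.exec (I.view s₀ r) μ).real 8 t 0 0 = I.γ ^ t := by
  unfold discounts
  rw [exec_seq]
  refine exec_loop (A := [5]) (R := [8]) (K := I.T)
    (by simp [RealExpr.eval, NatExpr.eval]) (by decide) (by decide)
    (fun c (ν : Memory) => ∀ i ≤ c, ν.real 8 i 0 0 = I.γ ^ i) ?_ ?_
  · intro ν _ h1 i hi
    obtain rfl : i = 0 := by omega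
    rw [h1]
    simp [exec, Memory.setReal, NatExpr.eval]
  · intro c _ ν ν' h1 h2 h3 h4 h5
    rw [← h2] at h1
    simp only [exec, Memory.tick_real, Memory.setReal_real_self, NatExpr.eval, NatExpr.eval_var,
      h4, RealExpr.eval, h1 c le_rfl]
    intro i hi
    rcases Nat.le_succ_iff.1 hi with hi | rfl
    · rw [if_neg (by omega)]
      exact h1 i hi
    · simp [pow_succ]

/-- The floor of x is the number of integers c' ≥ 0 with c' + 1 ≤ x. So the digit is found by
counting, and each success adds the corresponding power of the base to the code. -/
theorem exec_offset {K : Know} (hmesh : 0 < I.mesh) (hγ : I.γ ∈ Set.Icc (0 : ℝ) 1)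
    (hK : K.RewardsMem n m d) {t s a : ℕ} (hs : s < n) (ha : a < m)
    (μ : Memory) (h5 : μ.nat 5 0 0 0 = t) (h6 : μ.nat 6 0 0 0 = s) (h7 : μ.nat 7 0 0 0 = a)
    (h8 : μ.real 8 t 0 0 = I.γ ^ t) (h2 : μ.real 2 = K.rew)
    (h14 : ∀ i ≤ d, μ.nat 14 i 0 0 = I.grid ^ i) :
    (offset.exec (I.view s₀ r) μ).nat 16 = fun i j l => if i = t ∧ j = s ∧ l = a then
      encode I.grid d (K.gridReward I t s a) else μ.nat 16 i j l := by
  unfold offset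
  rw [exec_seq]
  have e1 : (exec (I.view s₀ r) (setNat 16 (.var 5) (.var 6) (.var 7) (.const 0)) μ).nat 16 =
      fun i j l => if i = t ∧ j = s ∧ l = a then 0 else μ.nat 16 i j l := by
    simp only [exec, Memory.tick_nat, Memory.setNat_nat_self, NatExpr.eval, NatExpr.eval_var,
      h5, h6, h7]
  have ag := agree_exec (A := [16]) (R := []) (I.view s₀ r)
    (setNat 16 (.var 5) (.var 6) (.var 7) (.const 0)) (by decide) (by decide) μ
  generalize exec _ (setNat 16 (.var 5) (.var 6) (.var 7) (.const 0)) μ = ξ at *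
  refine exec_loop (A := [9, 10, 16]) (R := []) (K := d)
    (by simp [RealExpr.eval, NatExpr.eval]) (by decide) (by decide)
    (fun c (ν : Memory) => ν.nat 16 = fun i j l => if i = t ∧ j = s ∧ l = a then
      encode I.grid c (K.gridReward I t s a) else μ.nat 16 i j l) ?_ ?_
  · intro ν h1 _
    rw [h1, e1]
    simp [encode]
  · intro c hc ν ν' q1 q2 q3 q4 q5
    set f := K.gridReward I t s a c with hf
    have hx0 : 0 ≤ I.γ ^ t * K.rew s a c / I.mesh :=
      div_nonneg (mul_nonneg (pow_nonneg hγ.1 _) (hK s hs a ha c hc).1) hmesh.le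
    -- Discounted rewards are at most 1, so counting up to 1/mesh does not miss anything.
    have hf1 : f ≤ ⌈1 / I.mesh⌉₊ := by
      rw [hf, Know.gridReward]
      refine (Nat.floor_le_floor ?_).trans (Nat.floor_le_ceil _)
      refine div_le_div_of_nonneg_right ?_ hmesh.le
      exact mul_le_one₀ (pow_le_one₀ hγ.1 hγ.2) (hK s hs a ha c hc).1 (hK s hs a ha c hc).2
    have key := exec_loop (v := I.view s₀ r) (a := 10)
      (x := .div (.nat 1) .mesh) (p := ite (.ofNat (.add (.var 10) (.const 1)))
        (.div (.mul (.get 8 (.var 5) (.const 0) (.const 0)) (.get 2 (.var 6) (.var 7) (.var 9)))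
          .mesh)
        (setNat 16 (.var 5) (.var 6) (.var 7)
          (.add (.get 16 (.var 5) (.var 6) (.var 7)) (.get 14 (.var 9) (.const 0) (.const 0))))
        skip) (μ := ν')
      (A := [10, 16]) (R := []) (K := ⌈1 / I.mesh⌉₊)
      (by simp [RealExpr.eval]) (by decide) (by decide)
      -- After c' rounds of counting, min(c', f) successes have been registered, where f is the
      -- floor.
      (fun c' (η : Memory) => η.nat 16 = fun i j l => if i = t ∧ j = s ∧ l = a then
        encode I.grid c (K.gridReward I t s a) + min c' f * I.grid ^ c else μ.nat 16 i j l) (by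
        intro η p1 _
        rw [p1, q3 16 (by decide), q1]
        simp) (by
        intro c' _ η η' p1 p2 p3 p4 p5
        have p6 := ((ag.mono (by decide : [16] ⊆ [9, 10, 16]) (List.Subset.refl _)).trans q5).trans
          (p5.mono (by decide : [10, 16] ⊆ [9, 10, 16]) (List.Subset.refl _))
        have g9 : η'.nat 9 0 0 0 = c := by rw [p5.nat 9 (by decide), q4]
        have g5 : η'.nat 5 0 0 0 = t := by rw [p6.nat 5 (by decide), h5]
        have g6 : η'.nat 6 0 0 0 = s := by rw [p6.nat 6 (by decide), h6]
        have g7 : η'.nat 7 0 0 0 = a := by rw [p6.nat 7 (by decide), h7]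
        have g8 : η'.real 8 t 0 0 = I.γ ^ t := by rw [p6.real 8 (by decide), h8]
        have g2 : η'.real 2 = K.rew := by rw [p6.real 2 (by decide), h2]
        have g14 : η'.nat 14 c 0 0 = I.grid ^ c := by rw [p6.nat 14 (by decide), h14 c hc.le]
        have g16 := (p3 16 (by decide)).trans p1
        have hiff : ((RealExpr.ofNat (.add (.var 10) (.const 1))).eval (I.view s₀ r) η' ≤
            (RealExpr.div (.mul (.get 8 (.var 5) (.const 0) (.const 0))
              (.get 2 (.var 6) (.var 7) (.var 9))) .mesh).eval (I.view s₀ r) η') ↔ c' + 1 ≤ f := by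
          rw [hf, Know.gridReward, Nat.le_floor_iff hx0]
          simp [RealExpr.eval, NatExpr.eval, g5, g6, g7, g9, g8, g2, p4]
        rw [exec]
        split_ifs with hle
        · rw [hiff] at hle
          simp only [exec, Memory.tick_nat, Memory.setNat_nat_self, NatExpr.eval,
            NatExpr.eval_var, g5, g6, g7, g9, g14, g16, and_self, if_true]
          rw [min_eq_left hle, min_eq_left (by omega)]
          funext i j l
          split_ifs
          · ring
          · rfl
        · rw [hiff] at hle
          simp only [exec, Memory.tick_nat, g16]
          rw [min_eq_right (by omega), min_eq_right (by omega)])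
    have hmin : min ⌈1 / I.mesh⌉₊ f = f := min_eq_right hf1
    rw [hmin] at key
    rw [key]
    simp only [encode, sum_range_succ, hf]

theorem exec_offsets {K : Know} (hmesh : 0 < I.mesh) (hγ : I.γ ∈ Set.Icc (0 : ℝ) 1)
    (hK : K.RewardsMem n m d) (μ : Memory) (h8 : ∀ t ≤ I.T, μ.real 8 t 0 0 = I.γ ^ t)
    (h2 : μ.real 2 = K.rew) (h14 : ∀ i ≤ d, μ.nat 14 i 0 0 = I.grid ^ i) :
    ∀ t < I.T, ∀ s < n, ∀ a < m, (offsets.exec (I.view s₀ r) μ).nat 16 t s a =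
      encode I.grid d (K.gridReward I t s a) := by
  classical
  unfold offsets
  have fill := exec_loop_fill_nat (v := I.view s₀ r) (a := 5) (x := .ofNat .horizon)
    (p := loop 6 (.ofNat .numStates) (loop 7 (.ofNat .numActions) offset)) (μ := μ) (K := I.T)
    (tA := 16) (A := [5, 6, 7, 9, 10, 16]) (R := []) (by simp [RealExpr.eval, NatExpr.eval])
    (by decide) (by decide) (fun t i j l => ∃ s < n, ∃ a < m, i = t ∧ j = s ∧ l = a)
    (fun i j l => encode I.grid d (K.gridReward I i j l)) (by decide) (by
      intro t ht μ₁ hμ₁ h5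
      refine Eq.trans (exec_loop_fill_nat (v := I.view s₀ r) (a := 6) (x := .ofNat .numStates)
        (p := loop 7 (.ofNat .numActions) offset) (μ := μ₁) (K := n)
        (tA := 16) (A := [6, 7, 9, 10, 16]) (R := []) (by simp [RealExpr.eval, NatExpr.eval])
        (by decide) (by decide) (fun s i j l => ∃ a < m, i = t ∧ j = s ∧ l = a)
        (fun i j l => encode I.grid d (K.gridReward I i j l)) (by decide) ?_)
        (by funext i j l; congr)
      intro s hs μ₂ hμ₂ h6
      refine Eq.trans (exec_loop_fill_nat (v := I.view s₀ r) (a := 7) (x := .ofNat .numActions)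
        (p := offset) (μ := μ₂) (K := m)
        (tA := 16) (A := [7, 9, 10, 16]) (R := []) (by simp [RealExpr.eval, NatExpr.eval])
        (by decide) (by decide) (fun a i j l => i = t ∧ j = s ∧ l = a)
        (fun i j l => encode I.grid d (K.gridReward I i j l)) (by decide) ?_)
        (by funext i j l; congr)
      intro a ha μ₃ hμ₃ h7
      have g := (hμ₁.trans (hμ₂.mono (by decide : [6, 7, 9, 10, 16] ⊆ [5, 6, 7, 9, 10, 16])
        (List.Subset.refl _))).trans (hμ₃.mono
          (by decide : [7, 9, 10, 16] ⊆ [5, 6, 7, 9, 10, 16]) (List.Subset.refl _))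
      rw [exec_offset I s₀ r hmesh hγ hK hs ha μ₃ (t := t)
        (by rw [hμ₃.nat 5 (by decide), hμ₂.nat 5 (by decide), h5])
        (by rw [hμ₃.nat 6 (by decide), h6]) h7 (by rw [g.real 8 (by decide), h8 t ht.le])
        (by rw [g.real 2 (by decide), h2]) (fun i hi => by rw [g.nat 14 (by decide), h14 i hi])]
      funext i j l
      by_cases h : i = t ∧ j = s ∧ l = a
      · rw [if_pos h, if_pos h, h.1, h.2.1, h.2.2]
      · rw [if_neg h, if_neg h])
  intro t ht s hs a ha
  rw [fill]
  exact if_pos ⟨t, ht, s, hs, a, ha, rfl, rfl, rfl⟩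

/-- Decoding avoids division. Pass c runs through all x in increasing order and defines the vector
of x + G^c as the vector of x plus one mesh in coordinate c, with G the grid size. After pass c the
codes with at most c + 1 digits are correct. -/
theorem exec_decode (μ : Memory) (h15 : μ.nat 15 0 0 0 = I.grid ^ d)
    (h14 : ∀ i ≤ d, μ.nat 14 i 0 0 = I.grid ^ i) (v : ℕ → ℕ) (hv : ∀ i, v i < I.grid) :
    ∀ l < d, (decode.exec (I.view s₀ r) μ).real 7 (encode I.grid d v) 0 l = I.mesh * v l := by
  classical
  have hG : 0 < I.grid := (Nat.zero_le _).trans_lt (hv 0)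
  unfold decode
  rw [exec_seq]
  have fill := exec_loop_fill_real (v := I.view s₀ r) (a := 12) (x := .ofNat .dim)
    (p := setReal 7 (.const 0) (.const 0) (.var 12) (.nat 0)) (μ := μ) (K := d) (tV := 7)
    (A := [12]) (R := [7]) (by simp [RealExpr.eval, NatExpr.eval]) (by decide) (by decide)
    (fun c i j l => i = 0 ∧ j = 0 ∧ l = c) (fun _ _ _ => 0) (by
      intro c _ ν _ hc' _
      simp only [exec, Memory.tick_real, Memory.setReal_real_self, NatExpr.eval_var, hc',
        NatExpr.eval, RealExpr.eval_nat, Nat.cast_zero]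
      funext i j l
      split_ifs <;> rfl)
  have ag := agree_exec (A := [12]) (R := [7]) (I.view s₀ r) (loop 12 (.ofNat .dim)
    (setReal 7 (.const 0) (.const 0) (.var 12) (.nat 0))) (by decide) (by decide) μ
  generalize (loop 12 _ _).exec _ μ = ξ at *
  have key := exec_loop (v := I.view s₀ r) (a := 9) (x := .ofNat .dim) (p := (loop 11
      (.ofNat (.var 15))
      (seq (loop 12 (.ofNat .dim)
          (setReal 7 (.add (.var 11) (.get 14 (.var 9) (.const 0) (.const 0))) (.const 0) (.var 12)
            (.get 7 (.var 11) (.const 0) (.var 12))))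
        (setReal 7 (.add (.var 11) (.get 14 (.var 9) (.const 0) (.const 0))) (.const 0) (.var 9)
          (.add (.get 7 (.var 11) (.const 0) (.var 9)) .mesh))))) (μ := ξ)
    (A := [9, 11, 12]) (R := [7]) (K := d)
    (by simp [RealExpr.eval, NatExpr.eval]) (by decide) (by decide)
    (fun c (ν : Memory) => ∀ w : ℕ → ℕ, (∀ i, w i < I.grid) →
      ∀ l < d, ν.real 7 (encode I.grid c w) 0 l = if l < c then I.mesh * w l else 0)
    (by
      intro ν _ h1 w _ l hl
      rw [h1, fill]
      simp [encode, hl]) (by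
      intro c hc ν ν' h1 h2 h3 h4 h5
      have pass := exec_loop (v := I.view s₀ r) (a := 11) (x := .ofNat (.var 15)) (p := (seq
        (loop 12 (.ofNat .dim)
          (setReal 7 (.add (.var 11) (.get 14 (.var 9) (.const 0) (.const 0))) (.const 0) (.var 12)
            (.get 7 (.var 11) (.const 0) (.var 12))))
        (setReal 7 (.add (.var 11) (.get 14 (.var 9) (.const 0) (.const 0))) (.const 0) (.var 9)
          (.add (.get 7 (.var 11) (.const 0) (.var 9)) .mesh)))) (μ := ν')
        (A := [11, 12]) (R := [7]) (K := I.grid ^ d)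
        (by simp only [RealExpr.eval, NatExpr.eval_var, h5.nat 15 (by decide),
          ag.nat 15 (by decide), h15, Nat.ceil_natCast])
        (by decide) (by decide)
        -- Entries below G^c are never written in pass c. A larger entry is written only when its
        -- predecessor x is processed, and x is already final then.
        (fun y (η : Memory) => (∀ x < I.grid ^ c, η.real 7 x 0 = ν.real 7 x 0) ∧
          ∀ x < y, ∀ l < d, η.real 7 (x + I.grid ^ c) 0 l =
            η.real 7 x 0 l + if l = c then I.mesh else 0) (by
          intro η _ p1
          rw [p1, h2]
          exact ⟨fun _ _ => rfl, fun x hx => absurd hx (Nat.not_lt_zero x)⟩) (by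
          intro y _ η η' p1 p2 p3 p4 p5
          rw [← p2] at p1
          have hpow : 0 < I.grid ^ c := pow_pos hG c
          have g9 : η'.nat 9 0 0 0 = c := by rw [p5.nat 9 (by decide), h4]
          have g14 : η'.nat 14 c 0 0 = I.grid ^ c := by
            rw [p5.nat 14 (by decide), h5.nat 14 (by decide), ag.nat 14 (by decide), h14 c hc.le]
          rw [exec_seq]
          have copy := exec_loop_fill_real (v := I.view s₀ r) (a := 12) (x := .ofNat .dim)
            (p := setReal 7 (.add (.var 11) (.get 14 (.var 9) (.const 0) (.const 0))) (.const 0)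
              (.var 12) (.get 7 (.var 11) (.const 0) (.var 12))) (μ := η') (K := d) (tV := 7)
            (A := [12]) (R := [7]) (by simp [RealExpr.eval, NatExpr.eval]) (by decide) (by decide)
            (fun c' i j l => i = y + I.grid ^ c ∧ j = 0 ∧ l = c')
            (fun i j l => η'.real 7 y 0 l) (by
              intro c' _ ζ hζ hc' hun
              simp only [exec, Memory.tick_real, Memory.setReal_real_self, NatExpr.eval_var, hc',
                NatExpr.eval, RealExpr.eval, hζ.nat 9 (by decide), g9, hζ.nat 14 (by decide), g14,
                hζ.nat 11 (by decide), p4]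
              funext i j l
              -- The row being read differs from the row being written because G^c is positive.
              rw [hun y 0 c' (by rintro ⟨_, _, h, _⟩; omega)]
              by_cases h : i = y + I.grid ^ c ∧ j = 0 ∧ l = c'
              · rw [if_pos h, if_pos h, h.2.2]
              · rw [if_neg h, if_neg h])
          have agc := agree_exec (A := [12]) (R := [7]) (I.view s₀ r) (loop 12 (.ofNat .dim)
            (setReal 7 (.add (.var 11) (.get 14 (.var 9) (.const 0) (.const 0))) (.const 0)
              (.var 12) (.get 7 (.var 11) (.const 0) (.var 12)))) (by decide) (by decide) η'
          generalize (loop 12 _ _).exec _ η' = ζ at *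
          have hcopy : ∀ l < d, ζ.real 7 (y + I.grid ^ c) 0 l = η'.real 7 y 0 l := by
            intro l hl
            rw [copy]
            exact if_pos ⟨l, hl, rfl, rfl, rfl⟩
          have hun : ∀ x, x ≠ y + I.grid ^ c → ζ.real 7 x 0 = η'.real 7 x 0 := by
            intro x hx
            rw [copy]
            funext l
            exact if_neg fun ⟨_, _, h, _⟩ => hx h
          have fin : ∀ x l, (exec (I.view s₀ r) (setReal 7 (.add (.var 11) (.get 14 (.var 9)
              (.const 0) (.const 0))) (.const 0) (.var 9)
              (.add (.get 7 (.var 11) (.const 0) (.var 9)) .mesh)) ζ).real 7 x 0 l =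
              if x = y + I.grid ^ c ∧ l = c then η'.real 7 y 0 c + I.mesh else ζ.real 7 x 0 l := by
            intro x l
            simp only [exec, Memory.tick_real, Memory.setReal_real_self, NatExpr.eval_var,
              NatExpr.eval, RealExpr.eval, agc.nat 9 (by decide), g9, agc.nat 14 (by decide), g14,
              agc.nat 11 (by decide), p4, RealExpr.eval_mesh, hun y (by omega), true_and]
          have fin' : ∀ x, x ≠ y + I.grid ^ c → ∀ l, (exec (I.view s₀ r) (setReal 7 (.add (.var 11)
              (.get 14 (.var 9) (.const 0) (.const 0))) (.const 0) (.var 9)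
              (.add (.get 7 (.var 11) (.const 0) (.var 9)) .mesh)) ζ).real 7 x 0 l =
              η'.real 7 x 0 l := by
            intro x hx l
            rw [fin, if_neg fun h => hx h.1, hun x hx]
          refine ⟨fun x hx => ?_, fun x hx l hl => ?_⟩
          · funext l
            rw [fin' x (by omega), p1.1 x hx]
          · rcases Nat.lt_succ_iff_lt_or_eq.1 hx with h | rfl
            · rw [fin' _ (by omega), fin' _ (by omega), p1.2 x h l hl]
            · rw [fin' x (by omega), fin]
              by_cases hlc : l = c
              · simp [hlc]
              · simp [hlc, hcopy l hl])
      generalize (loop 11 _ _).exec _ ν' = ζ at *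
      intro w hw l hl
      -- Digit c is raised from 0 to `w c` in unit steps. Every intermediate code is below G^d, so
      -- the pass does reach it.
      have hsum : ∀ t ≤ w c, ζ.real 7 (encode I.grid c w + t * I.grid ^ c) 0 l =
          (if l < c then I.mesh * w l else 0) + if l = c then I.mesh * t else 0 := by
        intro t
        induction t with
        | zero =>
          intro _
          rw [Nat.zero_mul, Nat.add_zero, pass.1 _ (encode_lt c w fun i _ => hw i),
            h1 w hw l hl]
          simp
        | succ t ih =>
          intro ht
          have hlt : encode I.grid c w + t * I.grid ^ c < I.grid ^ d := by
            have e1 := encode_lt c w fun i _ => hw i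
            calc encode I.grid c w + t * I.grid ^ c < (t + 1) * I.grid ^ c := by linarith
              _ ≤ I.grid * I.grid ^ c :=
                Nat.mul_le_mul_right _ (ht.trans (hw c).le)
              _ = I.grid ^ (c + 1) := by ring
              _ ≤ I.grid ^ d := Nat.pow_le_pow_right hG hc
          have e2 := pass.2 _ hlt l hl
          rw [ih (by omega)] at e2
          rw [show encode I.grid c w + (t + 1) * I.grid ^ c =
            encode I.grid c w + t * I.grid ^ c + I.grid ^ c by ring, e2]
          split_ifs <;> push_cast <;> ring
      have e3 := hsum (w c) le_rfl
      have e4 : encode I.grid (c + 1) w = encode I.grid c w + w c * I.grid ^ c := by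
        simp [encode, sum_range_succ]
      rw [e4, e3]
      rcases lt_trichotomy l c with h | rfl | h
      · simp [h, h.ne, h.trans (Nat.lt_succ_self c)]
      · simp
      · simp [h.not_gt, h.ne', not_lt.2 (Nat.succ_le_of_lt h)])
  intro l hl
  rw [key v hv l hl, if_pos hl]

theorem exec_terminal (μ : Memory) (h15 : μ.nat 15 0 0 0 = I.grid ^ d) :
    ∀ s < n, ∀ x < I.grid ^ d, (terminal.exec (I.view s₀ r) μ).real 6 0 s x =
      I.W (fun i => μ.real 7 x 0 i) - I.W (fun i => μ.real 7 0 0 i) := by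
  classical
  unfold terminal
  have fill := exec_loop_fill_real (v := I.view s₀ r) (a := 6) (x := .ofNat .numStates)
    (p := loop 11 (.ofNat (.var 15)) (setReal 6 (.const 0) (.var 6) (.var 11)
      (.sub (.welfare 7 (.var 11) (.const 0)) (.welfare 7 (.const 0) (.const 0))))) (μ := μ)
    (K := n) (tV := 6) (A := [6, 11]) (R := [6]) (by simp [RealExpr.eval, NatExpr.eval])
    (by decide) (by decide) (fun s i j l => ∃ x < I.grid ^ d, i = 0 ∧ j = s ∧ l = x)
    (fun i j l => I.W (fun i => μ.real 7 l 0 i) - I.W (fun i => μ.real 7 0 0 i)) (by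
      intro s _ μ₁ h1 h6 _
      refine Eq.trans (exec_loop_fill_real (v := I.view s₀ r) (a := 11) (x := .ofNat (.var 15))
        (p := setReal 6 (.const 0) (.var 6) (.var 11)
          (.sub (.welfare 7 (.var 11) (.const 0)) (.welfare 7 (.const 0) (.const 0)))) (μ := μ₁)
        (K := I.grid ^ d) (tV := 6) (A := [11]) (R := [6])
        (by simp only [RealExpr.eval, NatExpr.eval_var, h1.nat 15 (by decide), h15,
          Nat.ceil_natCast])
        (by decide) (by decide) (fun x i j l => i = 0 ∧ j = s ∧ l = x)
        (fun i j l => I.W (fun i => μ.real 7 l 0 i) - I.W (fun i => μ.real 7 0 0 i)) ?_)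
        (by funext i j l; congr)
      intro x _ μ₂ h2 h11 _
      have g7 : μ₂.real 7 = μ.real 7 := by rw [h2.real 7 (by decide), h1.real 7 (by decide)]
      have g6 : μ₂.nat 6 0 0 0 = s := by rw [h2.nat 6 (by decide), h6]
      simp only [exec, Memory.tick_real, Memory.setReal_real_self, NatExpr.eval_var,
        NatExpr.eval, RealExpr.eval, g6, g7, h11]
      funext i j l
      by_cases h : i = 0 ∧ j = s ∧ l = x
      · rw [if_pos h, if_pos h, h.2.2]
        rfl
      · rw [if_neg h, if_neg h])
  intro s hs x hx
  rw [fill]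
  exact if_pos ⟨s, hs, x, hx, rfl, rfl, rfl⟩

/-- The frame rule passes the tables of each stage on to the later ones. Backward induction then
reads the sample counts, the offsets and its own previous row. -/
theorem exec_exploit {K : Know} (hm : 0 < m) (hmesh : 0 < I.mesh) (hγ : I.γ ∈ Set.Icc (0 : ℝ) 1)
    (hK : K.RewardsMem n m d) (μ : Memory) (h : μ.know = K) :
    K.Solved I (exploit.exec (I.view s₀ r) μ) := by
  have hG : 0 < I.grid := by
    rw [Problem.grid, Nat.ceil_pos]
    positivity
  unfold exploit solve
  simp only [exec_seq]
  have pow := exec_powers I s₀ r μ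
  have ag1 := agree_exec (A := [9, 10, 14]) (R := []) (I.view s₀ r) powers (by decide) (by decide)
    μ
  generalize powers.exec _ μ = μ₁ at *
  have e15 : (exec (I.view s₀ r) (setNat 15 (.const 0) (.const 0) (.const 0)
      (.get 14 .dim (.const 0) (.const 0))) μ₁).nat 15 0 0 0 = I.grid ^ d := by
    simp [exec, Memory.setNat, NatExpr.eval, pow]
  have ag2 := agree_exec (A := [15]) (R := []) (I.view s₀ r) (setNat 15 (.const 0) (.const 0)
      (.const 0) (.get 14 .dim (.const 0) (.const 0))) (by decide) (by decide) μ₁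
  generalize exec _ (setNat 15 _ _ _ _) μ₁ = μ₂ at *
  have dis := exec_discounts I s₀ r μ₂
  have ag3 := agree_exec (A := [5]) (R := [8]) (I.view s₀ r) discounts (by decide) (by decide) μ₂
  generalize discounts.exec _ μ₂ = μ₃ at *
  have r2 : ∀ b, b < 3 → μ₃.real b = μ.real b := fun b hb => by
    rw [ag3.real b (by simp; omega), ag2.real b (by simp), ag1.real b (by simp)]
  have p14 : ∀ i ≤ d, μ₃.nat 14 i 0 0 = I.grid ^ i := fun i hi => by
    rw [ag3.nat 14 (by decide), ag2.nat 14 (by decide), pow i hi]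
  have off := exec_offsets I s₀ r hmesh hγ hK μ₃ dis (by rw [r2 2 (by omega), ← h]; rfl) p14
  have ag4 := agree_exec (A := [5, 6, 7, 9, 10, 16]) (R := []) (I.view s₀ r) offsets (by decide)
    (by decide) μ₃
  generalize offsets.exec _ μ₃ = μ₄ at *
  have p15 : μ₄.nat 15 0 0 0 = I.grid ^ d := by
    rw [ag4.nat 15 (by decide), ag3.nat 15 (by decide), e15]
  have dec := exec_decode I s₀ r μ₄ p15 (fun i hi => by rw [ag4.nat 14 (by decide), p14 i hi])
  have ag5 := agree_exec (A := [9, 11, 12]) (R := [7]) (I.view s₀ r) decode (by decide)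
    (by decide) μ₄
  generalize decode.exec _ μ₄ = μ₅ at *
  have q15 : μ₅.nat 15 0 0 0 = I.grid ^ d := by rw [ag5.nat 15 (by decide), p15]
  have ter := exec_terminal I s₀ r μ₅ q15
  have ag6 := agree_exec (A := [6, 11]) (R := [6]) (I.view s₀ r) terminal (by decide)
    (by decide) μ₅
  generalize terminal.exec _ μ₅ = μ₆ at *
  have s2 : ∀ b, b < 3 → μ₆.real b = μ.real b := fun b hb => by
    rw [ag6.real b (by simp; omega), ag5.real b (by simp; omega), ag4.real b (by simp), r2 b hb]
  have o16 : ∀ t < I.T, ∀ s < n, ∀ a < m,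
      μ₆.nat 16 t s a = encode I.grid d (K.gridReward I t s a) := fun t ht s hs a ha => by
    rw [ag6.nat 16 (by decide), ag5.nat 16 (by decide), off t ht s hs a ha]
  obtain ⟨b0, b1⟩ := exec_bellman (v := I.view s₀ r) (tV := 6) (tA := 17) (X := .ofNat (.var 15))
    (p := sumStates successor) (μ := μ₆) (X₀ := I.grid ^ d) hm (by decide) (by decide)
    (by decide) (by decide)
    (fun ν hν => by
      simp only [RealExpr.eval, NatExpr.eval_var, hν.nat 15 (by decide), ag6.nat 15 (by decide),
        q15, Nat.ceil_natCast])
    (fun f k s x a => K.exploitQ I (I.T - (k + 1)) f s x a) (by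
      intro ν hν k5 k6 _ k7
      refine exec_sumStates _ fun z _ ζ hζ h8 => ?_
      have hT : I.T - (ν.nat 5 0 0 0 + 1) < I.T := by
        simp only [Problem.view_horizon] at k5
        omega
      simp only [successor, RealExpr.eval, NatExpr.eval_var, NatExpr.eval, hζ.nat 5 (by decide),
        hζ.nat 6 (by decide), hζ.nat 7 (by decide), hζ.nat 11 (by decide),
        hζ.nat 16 (by decide), hν.nat 16 (by decide), h8, hζ.real 1 (by decide),
        hζ.real 0 (by decide), hζ.real 6 (by decide), hν.real 1 (by decide), hν.real 0 (by decide),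
        s2 0 (by omega), s2 1 (by omega), Problem.view_horizon, o16 _ hT _ k6 _ k7]
      rw [← h]
      rfl)
  have ag7 := agree_exec (A := [5, 6, 7, 8, 11, 17]) (R := [5, 6]) (I.view s₀ r)
    (bellman 6 17 (.ofNat (.var 15)) (sumStates successor)) (by decide) (by decide) μ₆
  generalize exec _ (bellman 6 17 _ _) μ₆ = μ₇ at *
  refine ⟨fun t ht s hs a ha => by rw [ag7.nat 16 (by decide), o16 t ht s hs a ha], ?_, b1⟩
  intro v hv s hs
  -- The code 0 decodes to the zero vector, so the welfare that the program subtracts is W(0).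
  have e0 : ∀ l < d, μ₅.real 7 0 0 l = 0 := by
    intro l hl
    have := dec (fun _ => 0) (fun _ => hG) l hl
    simpa [encode] using this
  rw [b0, ter s hs _ (encode_lt d v fun i _ => hv i)]
  congr 2
  · funext i
    exact dec v hv i i.2
  · funext i
    exact e0 i i.2

end Prog

end

/-! ### The program of the learner -/

section

open Finset

namespace Prog

/-- Ends the exploration. -/
def halt : Prog := setNat 0 (.const 0) (.const 0) (.const 0) (.const 1)

/-- Takes an action for exploration. -/
def act : Prog :=
  seq (setNat 1 (.const 0) (.const 0) (.const 0) (.get 13 .horizon .state (.const 0)))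
    (seq (setNat 4 (.const 0) (.const 0) (.const 0) (.var 1))
      (seq (setNat 3 (.const 0) (.const 0) (.const 0) .state)
        (seq (setNat 2 (.const 0) (.const 0) (.const 0) (.const 1))
          (setReal 3 (.const 0) (.const 0) (.const 0) (.add (.var 3) (.nat 1))))))

/-- Prepares the execution of the policy. -/
def reset : Prog :=
  seq (setNat 18 (.const 0) (.const 0) (.const 0) (.const 0))
    (setNat 19 (.const 0) (.const 0) (.const 0) (.const 0))

/-- Explores as long as this is worthwhile, and computes the output policy otherwise. -/
def learn : Prog :=
  seq book (seq plan (ite .threshold (.get 4 .horizon .state (.const 0))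
    (ite .cap (.var 3) halt act) (seq exploit (seq reset halt))))

/-- Takes the action that is optimal for the discretized decision problem. -/
def policy : Prog :=
  seq (setNat 1 (.const 0) (.const 0) (.const 0)
      (.get 17 (.sub .horizon (.var 19)) .state (.var 18)))
    (seq (setNat 18 (.const 0) (.const 0) (.const 0)
        (.add (.var 18) (.get 16 (.var 19) .state (.var 1))))
      (setNat 19 (.const 0) (.const 0) (.const 0) (.add (.var 19) (.const 1))))

end Prog

/-! ### Computation times -/

namespace NatExpr

theorem cost_get (a : ℕ) (i j k : NatExpr) :
    (get a i j k).cost = 1 + i.cost + j.cost + k.cost := rfl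
theorem cost_add (e f : NatExpr) : (add e f).cost = 1 + e.cost + f.cost := rfl
theorem cost_sub (e f : NatExpr) : (sub e f).cost = 1 + e.cost + f.cost := rfl
theorem cost_const (c : ℕ) : (const c).cost = 1 := rfl
theorem cost_numStates : numStates.cost = 1 := rfl
theorem cost_numActions : numActions.cost = 1 := rfl
theorem cost_dim : dim.cost = 1 := rfl
theorem cost_horizon : horizon.cost = 1 := rfl
theorem cost_state : state.cost = 1 := rfl

end NatExpr

namespace RealExpr

variable (d : ℕ)

theorem cost_get (a : ℕ) (i j k : NatExpr) :
    (get a i j k).cost d = 1 + i.cost + j.cost + k.cost := rfl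
theorem cost_welfare (a : ℕ) (i j : NatExpr) :
    (welfare a i j).cost d = 1 + d + i.cost + j.cost := rfl
theorem cost_ofNat (e : NatExpr) : (ofNat e).cost d = 1 + e.cost := rfl
theorem cost_reward (e : NatExpr) : (reward e).cost d = 1 + e.cost := rfl
theorem cost_add (x y : RealExpr) : (add x y).cost d = 1 + x.cost d + y.cost d := rfl
theorem cost_sub (x y : RealExpr) : (sub x y).cost d = 1 + x.cost d + y.cost d := rfl
theorem cost_mul (x y : RealExpr) : (mul x y).cost d = 1 + x.cost d + y.cost d := rfl
theorem cost_div (x y : RealExpr) : (div x y).cost d = 1 + x.cost d + y.cost d := rfl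
theorem cost_discount : discount.cost d = 1 := rfl
theorem cost_nat (c : ℕ) : (nat c).cost d = 2 := rfl
theorem cost_failure : failure.cost d = 1 := rfl
theorem cost_drift : drift.cost d = 23 := rfl
theorem cost_quota : quota.cost d = 67 := rfl
theorem cost_lam : lam.cost d = 11 := rfl
theorem cost_cap : cap.cost d = 108 := by
  simp only [cap, cost_div, cost_mul, cost_nat, cost_add, cost_ofNat, cost_quota, cost_drift,
    NatExpr.cost_numStates, NatExpr.cost_numActions, cost_failure]
theorem cost_threshold : threshold.cost d = 17 := rfl
theorem cost_mesh : mesh.cost d = 11 := rfl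

end RealExpr

/-- The learning algorithm. -/
def learner : Learner := ⟨Prog.learn, Prog.policy⟩

open Prog

variable {n m d : ℕ} (I : Problem n m d) (s : Fin n) (r : Fin d → ℝ)

/-- The three outcomes of a round: giving up at the cap, exploring, and halting with a solved
discretized problem. Together with the update of the knowledge this is all that the probabilistic
analysis uses about the result of the program. -/
theorem exec_learn (hm : 0 < m) (hT : 1 ≤ I.T) (hmesh : 0 < I.mesh)
    (hγ : I.γ ∈ Set.Icc (0 : ℝ) 1) (μ : Memory) {K : Know}
    (h : (book.exec (I.view s r) μ).know = K) (hK : K.RewardsMem n m d) :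
    let μ' := learn.exec (I.view s r) μ
    μ'.know = K ∧
      (I.threshold ≤ K.explore I I.T s ∧ I.cap ≤ μ.real 3 0 0 0 ∧ μ'.nat 0 0 0 0 = 1 ∧
          μ'.real 3 0 0 0 = μ.real 3 0 0 0 ∨
        I.threshold ≤ K.explore I I.T s ∧ μ.real 3 0 0 0 < I.cap ∧
          μ'.nat 0 0 0 0 = μ.nat 0 0 0 0 ∧ μ'.nat 1 0 0 0 = K.exploreAction I s ∧
          μ'.nat 2 0 0 0 = 1 ∧ μ'.nat 3 0 0 0 = s ∧ μ'.nat 4 0 0 0 = K.exploreAction I s ∧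
          μ'.real 3 0 0 0 = μ.real 3 0 0 0 + 1 ∨
        K.explore I I.T s < I.threshold ∧ μ'.nat 0 0 0 0 = 1 ∧
          μ'.real 3 0 0 0 = μ.real 3 0 0 0 ∧ K.Solved I μ' ∧ μ'.nat 18 0 0 0 = 0 ∧
          μ'.nat 19 0 0 0 = 0) := by
  intro μ'
  simp only [μ', learn, exec_seq]
  have ag1 := agree_exec (A := [9]) (R := [0, 1, 2]) (I.view s r) book (by decide) (by decide) μ
  generalize book.exec _ μ = μ₁ at *
  obtain ⟨pl1, pl2⟩ := exec_plan hm I s r μ₁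
  have ag2 := agree_exec (A := [5, 6, 7, 8, 11, 13]) (R := [4, 5]) (I.view s r) plan (by decide)
    (by decide) μ₁
  rw [h] at pl1 pl2
  generalize plan.exec _ μ₁ = μ₂ at *
  have hK2 : μ₂.know = K := by
    rw [← h]
    exact Memory.know_congr (ag2.real 0 (by decide)) (ag2.real 1 (by decide))
      (ag2.real 2 (by decide))
  have e3 : μ₂.real 3 = μ.real 3 := by rw [ag2.real 3 (by decide), ag1.real 3 (by decide)]
  have e0 : μ₂.nat 0 = μ.nat 0 := by rw [ag2.nat 0 (by decide), ag1.nat 0 (by decide)]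
  have v1 := pl1 I.T le_rfl s s.2
  have v2 := pl2 hT s s.2
  rw [exec]
  have c1 : (RealExpr.threshold.eval (I.view s r) μ₂ ≤
      (RealExpr.get 4 .horizon .state (.const 0)).eval (I.view s r) μ₂) ↔
      I.threshold ≤ K.explore I I.T s := by
    simp [RealExpr.eval, NatExpr.eval, v1]
  by_cases hc : I.threshold ≤ K.explore I I.T s
  · rw [if_pos (c1.2 hc), exec]
    generalize hz : μ₂.tick _ = μ₃
    have z1 : μ₃.nat = μ₂.nat := by rw [← hz]; rfl
    have z2 : μ₃.real = μ₂.real := by rw [← hz]; rfl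
    have c2 : (RealExpr.cap.eval (I.view s r) μ₃ ≤ (RealExpr.var 3).eval (I.view s r) μ₃) ↔
        I.cap ≤ μ.real 3 0 0 0 := by
      simp [z2, e3]
    by_cases hc' : I.cap ≤ μ.real 3 0 0 0
    · rw [if_pos (c2.2 hc')]
      generalize hy : μ₃.tick _ = μ₄
      have y1 : μ₄.nat = μ₂.nat := by rw [← hy]; exact z1
      have y2 : μ₄.real = μ₂.real := by rw [← hy]; exact z2
      refine ⟨?_, Or.inl ⟨hc, hc', ?_, ?_⟩⟩
      · rw [← hK2]
        simp [halt, exec, Memory.know, y2]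
      · simp [halt, exec, Memory.setNat, NatExpr.eval]
      · simp [halt, exec, y2, e3]
    · rw [if_neg (fun h => hc' (c2.1 h))]
      generalize hy : μ₃.tick _ = μ₄
      have y1 : μ₄.nat = μ₂.nat := by rw [← hy]; exact z1
      have y2 : μ₄.real = μ₂.real := by rw [← hy]; exact z2
      refine ⟨?_, Or.inr (Or.inl ⟨hc, not_le.1 hc', ?_, ?_, ?_, ?_, ?_, ?_⟩)⟩
      · rw [← hK2]
        simp [act, exec, Memory.know, y2, Memory.setReal_real_of_ne]
      all_goals simp [act, exec, Memory.setNat, Memory.setReal, NatExpr.eval, RealExpr.eval, y1, y2,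
        e0, e3, v2]
  · rw [if_neg (fun h => hc (c1.1 h))]
    generalize hz : μ₂.tick _ = μ₃
    have z2 : μ₃.real = μ₂.real := by rw [← hz]; rfl
    have hK3 : μ₃.know = K := by rw [← hK2]; simp only [Memory.know, z2]
    have ex := exec_exploit I s r hm hmesh hγ hK μ₃ hK3
    simp only [exec_seq]
    have ag3 := agree_exec (A := [5, 6, 7, 8, 9, 10, 11, 12, 14, 15, 16, 17]) (R := [5, 6, 7, 8])
      (I.view s r) exploit (by decide) (by decide) μ₃
    generalize exploit.exec _ μ₃ = μ₄ at *
    have ag4 := (agree_exec (A := [0, 18, 19]) (R := []) (I.view s r) reset (by decide)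
      (by decide) μ₄).trans (agree_exec (A := [0, 18, 19]) (R := []) (I.view s r) halt (by decide)
      (by decide) _)
    refine ⟨?_, Or.inr (Or.inr ⟨not_le.1 hc, ?_, ?_, ?_, ?_, ?_⟩)⟩
    · rw [← hK3]
      exact (Memory.know_congr (ag4.real 0 (by decide)) (ag4.real 1 (by decide))
        (ag4.real 2 (by decide))).trans (Memory.know_congr (ag3.real 0 (by decide))
          (ag3.real 1 (by decide)) (ag3.real 2 (by decide)))
    · simp [halt, exec, Memory.setNat, NatExpr.eval]
    · rw [ag4.real 3 (by decide), ag3.real 3 (by decide), z2, e3]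
    · refine ⟨?_, ?_, ?_⟩
      · rw [ag4.nat 16 (by decide)]
        exact ex.offset
      · rw [ag4.real 6 (by decide)]
        exact ex.terminal
      · rw [ag4.real 6 (by decide), ag4.nat 17 (by decide)]
        exact ex.step
    · simp [halt, reset, exec, Memory.setNat, NatExpr.eval]
    · simp [halt, reset, exec, Memory.setNat, NatExpr.eval]

set_option linter.unusedSimpArgs false

/-- The output policy does not recompute anything: it looks up the maximizer for the remaining
number of steps and adds the offset of the step to its code. -/
theorem exec_policy (μ : Memory) :
    let μ' := policy.exec (I.view s r) μ
    μ'.nat 1 0 0 0 = μ.nat 17 (I.T - μ.nat 19 0 0 0) s (μ.nat 18 0 0 0) ∧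
    μ'.nat 18 0 0 0 = μ.nat 18 0 0 0 + μ.nat 16 (μ.nat 19 0 0 0) s (μ'.nat 1 0 0 0) ∧
    μ'.nat 19 0 0 0 = μ.nat 19 0 0 0 + 1 ∧ μ'.nat 16 = μ.nat 16 ∧ μ'.nat 17 = μ.nat 17 ∧
    μ'.real = μ.real ∧ μ'.time = μ.time + 45 := by
  simp [policy, exec, Memory.setNat, NatExpr.eval, NatExpr.cost_var,
    NatExpr.cost_get, NatExpr.cost_const, NatExpr.cost_add, NatExpr.cost_sub, NatExpr.cost_dim,
    NatExpr.cost_state, NatExpr.cost_horizon, NatExpr.cost_numStates, NatExpr.cost_numActions]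

/-- The sum of the numbers of states, of actions and of objectives and the horizon. -/
def Problem.dims (J : Problem n m d) : ℕ := n + m + d + J.T

section

variable {I} (hT : 1 ≤ I.T)

theorem le_dims_pow : n ≤ I.dims ∧ m ≤ I.dims ∧ d ≤ I.dims ∧ I.T ≤ I.dims := by
  unfold Problem.dims; omega

include hT

theorem one_le_dims : 1 ≤ I.dims := by unfold Problem.dims; omega

/-- The loop nests have at most four factors among the sizes, apart from the grid. With all these
monomials below one fourth power, every cost estimate becomes linear arithmetic. -/
theorem monomials_le_dims_pow :
    1 ≤ I.dims ^ 4 ∧ n ≤ I.dims ^ 4 ∧ d ≤ I.dims ^ 4 ∧ I.T ≤ I.dims ^ 4 ∧ I.T * n ≤ I.dims ^ 4 ∧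
      n * d ≤ I.dims ^ 4 ∧ d * d ≤ I.dims ^ 4 ∧ I.T * n * m ≤ I.dims ^ 4 ∧
      I.T * n * m * n ≤ I.dims ^ 4 ∧ I.T * n * m * d ≤ I.dims ^ 4 := by
  obtain ⟨h1, h2, h3, h4⟩ := le_dims_pow (I := I)
  have h5 := one_le_dims hT
  generalize I.dims = S at *
  have e1 : S ≤ S ^ 4 := Nat.le_self_pow (by norm_num) S
  have e2 : S * S ≤ S ^ 4 := by rw [← pow_two]; exact Nat.pow_le_pow_right h5 (by norm_num)
  have e3 : S * S * S ≤ S ^ 4 := by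
    rw [← pow_two, ← pow_succ]; exact Nat.pow_le_pow_right h5 (by norm_num)
  have e4 : S * S * S * S ≤ S ^ 4 := (by ring : S * S * S * S = S ^ 4).le
  exact ⟨h5.trans e1, h1.trans e1, h3.trans e1, h4.trans e1, (Nat.mul_le_mul h4 h1).trans e2,
    (Nat.mul_le_mul h1 h3).trans e2, (Nat.mul_le_mul h3 h3).trans e2,
    (Nat.mul_le_mul (Nat.mul_le_mul h4 h1) h2).trans e3,
    (Nat.mul_le_mul (Nat.mul_le_mul (Nat.mul_le_mul h4 h1) h2) h1).trans e4,
    (Nat.mul_le_mul (Nat.mul_le_mul (Nat.mul_le_mul h4 h1) h2) h3).trans e4⟩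

theorem costBound_plan (ν : Memory) :
    (seq book plan).costBound (I.view s r) ν ≤ 500 * I.dims ^ 4 := by
  simp only [costBound, book, plan, bellman, argmax, sumStates, RealExpr.eval, NatExpr.eval,
    Nat.ceil_natCast, Problem.view_dim, Problem.view_numStates, Problem.view_numActions,
    Problem.view_horizon, RealExpr.eval_nat, Nat.cast_one, Nat.ceil_one,
    NatExpr.cost_var, RealExpr.cost_var,
    NatExpr.cost_get, NatExpr.cost_const, NatExpr.cost_add, NatExpr.cost_sub, NatExpr.cost_dim,
    NatExpr.cost_state, NatExpr.cost_horizon, NatExpr.cost_numStates, NatExpr.cost_numActions,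
    RealExpr.cost_get, RealExpr.cost_nat, RealExpr.cost_add, RealExpr.cost_sub, RealExpr.cost_mul,
    RealExpr.cost_div, RealExpr.cost_ofNat, RealExpr.cost_welfare, RealExpr.cost_reward,
    RealExpr.cost_quota, RealExpr.cost_lam, RealExpr.cost_mesh, RealExpr.cost_discount,
    RealExpr.cost_threshold, RealExpr.cost_cap]
  obtain ⟨h0, h1, h2, h3, h4, h5, h6, h7, h8, h9⟩ := monomials_le_dims_pow hT
  nlinarith only [h0, h1, h2, h3, h4, h7, h8]

variable (hmesh : 0 < I.mesh)

include hmesh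

theorem one_le_grid : 1 ≤ I.grid := by
  rw [Problem.grid, Nat.one_le_ceil_iff]
  positivity

theorem ceil_le_grid : ⌈1 / I.mesh⌉₊ ≤ I.grid := by
  have : (1 : ℝ) ≤ I.T := by exact_mod_cast hT
  refine Nat.ceil_le_ceil (le_trans ?_ (le_add_of_nonneg_right zero_le_one))
  gcongr

theorem costBound_powers (ν : Memory) :
    powers.costBound (I.view s r) ν ≤ 100 * I.dims ^ 4 * I.grid := by
  simp only [costBound, powers, bellman, argmax, sumStates, RealExpr.eval, NatExpr.eval,
    Nat.ceil_natCast, Problem.view_dim, Problem.view_numStates, Problem.view_numActions,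
    Problem.view_horizon, RealExpr.eval_nat, Nat.cast_one, Nat.ceil_one, RealExpr.eval_mesh,
    NatExpr.cost_var, RealExpr.cost_var,
    NatExpr.cost_get, NatExpr.cost_const, NatExpr.cost_add, NatExpr.cost_sub, NatExpr.cost_dim,
    NatExpr.cost_state, NatExpr.cost_horizon, NatExpr.cost_numStates, NatExpr.cost_numActions,
    RealExpr.cost_get, RealExpr.cost_nat, RealExpr.cost_add, RealExpr.cost_sub, RealExpr.cost_mul,
    RealExpr.cost_div, RealExpr.cost_ofNat, RealExpr.cost_welfare, RealExpr.cost_reward,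
    RealExpr.cost_quota, RealExpr.cost_lam, RealExpr.cost_mesh, RealExpr.cost_discount,
    RealExpr.cost_threshold, RealExpr.cost_cap]

  obtain ⟨h0, h1, h2, h3, h4, h5, h6, h7, h8, h9⟩ := monomials_le_dims_pow hT
  have hG := one_le_grid hT hmesh
  have e : ⌈(I.T : ℝ) / I.mesh + 1⌉₊ = I.grid := rfl
  rw [e]
  have f0 := Nat.mul_le_mul h0 hG
  have f1 := Nat.mul_le_mul h2 hG
  have f2 := Nat.mul_le_mul_right I.grid h2
  linarith only [f0, f1, f2]

/-- Separate from the computation of the powers because G^d, the bound of the loops over codes, is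
an entry of array 15 and has to be present before the cost can be evaluated. -/
theorem costBound_solve (ν : Memory) (h15 : ν.nat 15 0 0 0 = I.grid ^ d) (hd : 1 ≤ d) :
    solve.costBound (I.view s r) ν ≤ 1500 * I.dims ^ 4 * I.grid ^ d := by
  simp only [costBound, solve, discounts, offsets, offset, decode, terminal,
    successor, bellman, argmax, sumStates, RealExpr.eval, NatExpr.eval, NatExpr.eval_var,
    Nat.ceil_natCast, Problem.view_dim, Problem.view_numStates, Problem.view_numActions,
    Problem.view_horizon, RealExpr.eval_nat, Nat.cast_one, Nat.ceil_one, RealExpr.eval_mesh,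
    NatExpr.cost_var, RealExpr.cost_var,
    NatExpr.cost_get, NatExpr.cost_const, NatExpr.cost_add, NatExpr.cost_sub, NatExpr.cost_dim,
    NatExpr.cost_state, NatExpr.cost_horizon, NatExpr.cost_numStates, NatExpr.cost_numActions,
    RealExpr.cost_get, RealExpr.cost_nat, RealExpr.cost_add, RealExpr.cost_sub, RealExpr.cost_mul,
    RealExpr.cost_div, RealExpr.cost_ofNat, RealExpr.cost_welfare, RealExpr.cost_reward,
    RealExpr.cost_quota, RealExpr.cost_lam, RealExpr.cost_mesh, RealExpr.cost_discount,
    RealExpr.cost_threshold, RealExpr.cost_cap]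

  obtain ⟨h0, h1, h2, h3, h4, h5, h6, h7, h8, h9⟩ := monomials_le_dims_pow hT
  have hG := one_le_grid hT hmesh
  have hQ : I.grid ≤ I.grid ^ d := Nat.le_self_pow (by omega) _
  have hR := (ceil_le_grid hT hmesh).trans hQ
  rw [h15]
  have hQ1 : 1 ≤ I.grid ^ d := hG.trans hQ
  generalize I.grid ^ d = Q at *
  generalize ⌈1 / I.mesh⌉₊ = R at *
  have g0 := Nat.mul_le_mul h0 hQ1
  have g1 := Nat.mul_le_mul h1 hQ1
  have g2 := Nat.mul_le_mul h2 hQ1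
  have g3 := Nat.mul_le_mul h3 hQ1
  have g4 := Nat.mul_le_mul h4 hQ1
  have g7 := Nat.mul_le_mul h7 hQ1
  have g9 := Nat.mul_le_mul h9 hQ1
  have k1 := Nat.mul_le_mul_right Q h1
  have k2 := Nat.mul_le_mul_right Q h2
  have k4 := Nat.mul_le_mul_right Q h4
  have k5 := Nat.mul_le_mul_right Q h5
  have k6 := Nat.mul_le_mul_right Q h6
  have k7 := Nat.mul_le_mul_right Q h7
  have k8 := Nat.mul_le_mul_right Q h8
  have k9 := Nat.mul_le_mul h9 hR
  linarith only [g0, g1, g2, g3, g4, g7, g9, k1, k2, k4, k5, k6, k7, k8, k9]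

theorem time_exploit (hd : 1 ≤ d) (μ : Memory) : (exploit.exec (I.view s r) μ).time ≤
    μ.time + 2000 * I.dims ^ 4 * I.grid ^ d := by
  unfold exploit
  simp only [exec_seq]
  have pow := exec_powers I s r μ d le_rfl
  have t1 := time_exec_le (v := I.view s r) (b := 15) powers (by decide) (by decide) μ rfl
  have c1 := costBound_powers s r hT hmesh μ
  generalize powers.exec _ μ = μ₁ at *
  have e15 : (exec (I.view s r) (setNat 15 (.const 0) (.const 0) (.const 0)
      (.get 14 .dim (.const 0) (.const 0))) μ₁).nat 15 0 0 0 = I.grid ^ d := by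
    simp [exec, Memory.setNat, NatExpr.eval, pow]
  have t2 : (exec (I.view s r) (setNat 15 (.const 0) (.const 0) (.const 0)
      (.get 14 .dim (.const 0) (.const 0))) μ₁).time = μ₁.time + 8 := rfl
  generalize exec _ (setNat 15 _ _ _ _) μ₁ = μ₂ at *
  have t3 := time_exec_le (v := I.view s r) (b := 15) solve (by decide) (by decide) μ₂ rfl
  have c3 := costBound_solve s r hT hmesh μ₂ e15 hd
  have hG := one_le_grid hT hmesh
  have hQ : I.grid ≤ I.grid ^ d := Nat.le_self_pow (by omega) _
  have h0 : 1 ≤ I.dims ^ 4 := (monomials_le_dims_pow hT).1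
  have g0 := Nat.mul_le_mul h0 (hG.trans hQ)
  have g1 := Nat.mul_le_mul_left (I.dims ^ 4) hQ
  linarith only [t1, c1, t2, t3, c3, g0, g1]

/-- The costly planning happens only in a round that halts, so the power of the grid size is paid
once and not once per action. -/
theorem time_learn (hd : 1 ≤ d) (μ : Memory) :
    (learn.exec (I.view s r) μ).time ≤ μ.time + 3000 * I.dims ^ 4 * I.grid ^ d ∧
    ((learn.exec (I.view s r) μ).nat 0 0 0 0 = 0 →
      (learn.exec (I.view s r) μ).time ≤ μ.time + 1000 * I.dims ^ 4) := by
  have e : learn.exec (I.view s r) μ = exec (I.view s r) (ite .threshold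
    (.get 4 .horizon .state (.const 0)) (ite .cap (.var 3) halt act)
      (seq exploit (seq reset halt))) ((seq book plan).exec (I.view s r) μ) := rfl
  have t1 := time_exec_le (v := I.view s r) (b := 15) (seq book plan) (by decide) (by decide) μ rfl
  have c1 := costBound_plan s r hT μ
  rw [e]
  generalize (seq book plan).exec _ μ = μ₁ at *
  have hG := one_le_grid hT hmesh
  have hQ : 1 ≤ I.grid ^ d := Nat.one_le_pow _ _ hG
  have p0 : 1 ≤ I.dims ^ 4 := (monomials_le_dims_pow hT).1
  have g0 := Nat.mul_le_mul_left (I.dims ^ 4) hQ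
  rw [exec]
  have cc : ∀ d', RealExpr.cost d' (.get 4 .horizon .state (.const 0)) = 4 := fun _ => rfl
  split_ifs
  · generalize hz : μ₁.tick _ = μ₂
    have z1 : μ₂.time = μ₁.time + (1 + 17 + 4) := by
      rw [← hz, Memory.tick_time, RealExpr.cost_threshold, cc]
    have t2 := time_exec_le (v := I.view s r) (b := 15) (ite .cap (.var 3) halt act) (by decide)
      (by decide) μ₂ rfl
    have c2 : (ite .cap (.var 3) halt act).costBound (I.view s r) μ₂ ≤ 300 := by
      simp only [costBound, halt, act, RealExpr.eval, NatExpr.eval,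
    Nat.ceil_natCast, Problem.view_dim, Problem.view_numStates, Problem.view_numActions,
    Problem.view_horizon, RealExpr.eval_nat, Nat.cast_one, Nat.ceil_one,
    NatExpr.cost_var, RealExpr.cost_var,
    NatExpr.cost_get, NatExpr.cost_const, NatExpr.cost_add, NatExpr.cost_sub, NatExpr.cost_dim,
    NatExpr.cost_state, NatExpr.cost_horizon, NatExpr.cost_numStates, NatExpr.cost_numActions,
    RealExpr.cost_get, RealExpr.cost_nat, RealExpr.cost_add, RealExpr.cost_sub, RealExpr.cost_mul,
    RealExpr.cost_div, RealExpr.cost_ofNat, RealExpr.cost_welfare, RealExpr.cost_reward,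
    RealExpr.cost_quota, RealExpr.cost_lam, RealExpr.cost_mesh, RealExpr.cost_discount,
    RealExpr.cost_threshold, RealExpr.cost_cap]
      norm_num
    exact ⟨by linarith, fun _ => by linarith⟩
  · simp only [exec_seq]
    generalize hz : μ₁.tick _ = μ₂
    have z1 : μ₂.time = μ₁.time + (1 + 17 + 4) := by
      rw [← hz, Memory.tick_time, RealExpr.cost_threshold, cc]
    have t2 := time_exploit s r hT hmesh hd μ₂
    generalize exploit.exec _ μ₂ = μ₃ at *
    have t3 : (halt.exec (I.view s r) (reset.exec (I.view s r) μ₃)).time = μ₃.time + 15 := rfl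
    refine ⟨by linarith, fun h => ?_⟩
    -- This branch sets the halting flag to 1, contrary to `h`.
    simp [halt, exec, Memory.setNat, NatExpr.eval] at h

end

end

/-! ### The recursion for the value of a policy -/

theorem PMF.sum_toReal {α : Type*} [Fintype α] (p : PMF α) : ∑ a, (p a).toReal = 1 := by
  have h := p.tsum_coe
  rw [tsum_fintype] at h
  rw [← ENNReal.toReal_sum fun a _ => p.apply_ne_top a, h, ENNReal.toReal_one]

theorem PMF.sum_mul_le {α : Type*} [Fintype α] (p : PMF α) (f : α → ℝ) (B : ℝ)
    (h : ∀ a, f a ≤ B) : ∑ a, (p a).toReal * f a ≤ B :=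
  calc ∑ a, (p a).toReal * f a ≤ ∑ a, (p a).toReal * B :=
        Finset.sum_le_sum fun a _ => mul_le_mul_of_nonneg_left (h a) ENNReal.toReal_nonneg
    _ = B := by rw [← Finset.sum_mul, p.sum_toReal, one_mul]

theorem PMF.abs_sum_mul_le {α : Type*} [Fintype α] (p : PMF α) (f : α → ℝ) (B : ℝ)
    (h : ∀ a, |f a| ≤ B) : |∑ a, (p a).toReal * f a| ≤ B := by
  refine abs_le.2 ⟨?_, p.sum_mul_le f B fun a => (abs_le.1 (h a)).2⟩
  have := p.sum_mul_le (fun a => -f a) B fun a => by linarith [(abs_le.1 (h a)).1]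
  simp only [mul_neg, Finset.sum_neg_distrib] at this
  linarith

namespace MOMDP

variable {n m d : ℕ} (M : MOMDP n m d)

/-- Splits off the first step. The starting-state indicator of the remaining trajectory selects the
one successor z that contributes to the sum. -/
theorem trajProb_cons (π : Policy n m) (s : Fin n) {T : ℕ} (x : Fin n × Fin m)
    (τ : Fin T → Fin n × Fin m) :
    M.trajProb π s (Fin.cons x τ : Fin (T + 1) → Fin n × Fin m) =
      if x.1 = s then (π [] s x.2).toReal * ∑ z, (M.trans s x.2 z).toReal *
        M.trajProb (fun h => π (x :: h)) z τ else 0 := by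
  classical
  have e1 : ∑ z, (M.trans x.1 x.2 z).toReal * M.trajProb (fun h => π (x :: h)) z τ =
      (if h : 0 < T then (M.trans x.1 x.2 (τ ⟨0, h⟩).1).toReal else 1) *
        ∏ t : Fin T, (π (x :: (List.ofFn τ).take t) (τ t).1 (τ t).2).toReal *
          (if h : (t : ℕ) + 1 < T then
            (M.trans (τ t).1 (τ t).2 (τ ⟨(t : ℕ) + 1, h⟩).1).toReal else 1) := by
    simp only [trajProb, ← mul_assoc]
    rw [← Finset.sum_mul]
    congr 1
    -- If nothing remains of the trajectory, the transition probabilities sum to 1, which matches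
    -- the default factor of the last step.
    by_cases hT : 0 < T
    · simp [hT]
    · simp [hT, PMF.sum_toReal]
  by_cases hx : x.1 = s
  · rw [if_pos hx]
    subst hx
    rw [e1, trajProb, Fin.prod_univ_succ]
    simp only [Nat.zero_lt_succ, Fin.zero_eta, Fin.cons_zero, forall_const, if_true, one_mul,
      Fin.val_zero, List.take_zero, zero_add, Fin.val_succ, Fin.cons_succ]
    rw [mul_assoc]
    congr 2
    · by_cases hT : 0 < T
      · rw [dif_pos (by omega), dif_pos hT]
        rfl
      · rw [dif_neg (by omega), dif_neg hT]
    · refine Finset.prod_congr rfl fun t _ => ?_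
      rw [List.ofFn_cons, List.take_succ_cons]
      congr 1
      by_cases ht : (t : ℕ) + 1 < T
      · rw [dif_pos (by omega), dif_pos ht]
        rfl
      · rw [dif_neg (by omega), dif_neg ht]
  · rw [if_neg hx, trajProb, if_neg, zero_mul]
    intro h
    exact hx (h (Nat.succ_pos T))

theorem totalReward_cons (γ : ℝ) {T : ℕ} (x : Fin n × Fin m) (τ : Fin T → Fin n × Fin m) :
    M.totalReward γ (Fin.cons x τ : Fin (T + 1) → Fin n × Fin m) =
      M.reward x.1 x.2 + γ • M.totalReward γ τ := by
  funext i
  simp only [totalReward, Pi.add_apply, Pi.smul_apply, smul_eq_mul, Fin.sum_univ_succ,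
    Fin.cons_zero, Fin.val_zero, pow_zero, one_mul, Fin.cons_succ, Fin.val_succ, Finset.mul_sum]
  congr 1
  exact Finset.sum_congr rfl fun t _ => by ring

theorem value_zero (W : (Fin d → ℝ) → ℝ) (γ : ℝ) (π : Policy n m) (s : Fin n) :
    M.value W γ 0 π s = W 0 := by
  simp only [value, trajProb, Finset.univ_unique, Finset.sum_singleton, Finset.univ_eq_empty,
    Finset.prod_empty]
  simp
  rfl

/-- A Bellman equation for a welfare that is not additive: the reward of the first step is absorbed
into the welfare function, and the first state-action pair into the policy. -/
theorem value_succ (W : (Fin d → ℝ) → ℝ) (γ : ℝ) (T : ℕ) (π : Policy n m) (s : Fin n) :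
    M.value W γ (T + 1) π s = ∑ a, (π [] s a).toReal * ∑ z, (M.trans s a z).toReal *
      M.value (fun y => W (M.reward s a + γ • y)) γ T (fun h => π ((s, a) :: h)) z := by
  classical
  have e : M.value W γ (T + 1) π s = ∑ x : Fin n × Fin m, ∑ τ : Fin T → Fin n × Fin m,
      M.trajProb π s (Fin.cons x τ : Fin (T + 1) → Fin n × Fin m) *
        W (M.totalReward γ (Fin.cons x τ : Fin (T + 1) → Fin n × Fin m)) := by
    unfold value
    rw [← Fintype.sum_prod_type', ← (Fin.consEquiv fun _ => Fin n × Fin m).sum_comp]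
    rfl
  rw [e, Fintype.sum_prod_type, Finset.sum_eq_single s]
  · refine Finset.sum_congr rfl fun a _ => ?_
    simp only [trajProb_cons, totalReward_cons, if_true, value, Finset.mul_sum, Finset.sum_mul]
    rw [Finset.sum_comm]
    refine Finset.sum_congr rfl fun z _ => Finset.sum_congr rfl fun τ _ => ?_
    ring
  · intro s' _ hs'
    refine Finset.sum_eq_zero fun a _ => Finset.sum_eq_zero fun τ _ => ?_
    rw [trajProb_cons, if_neg hs', zero_mul]
  · simp

theorem value_sub_const (W : (Fin d → ℝ) → ℝ) (c γ : ℝ) (T : ℕ) (π : Policy n m) (s : Fin n) :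
    M.value (fun y => W y - c) γ T π s = M.value W γ T π s - c := by
  induction T generalizing W π s with
  | zero => simp only [value_zero]
  | succ T ih =>
    simp only [value_succ, ih, mul_sub, Finset.sum_sub_distrib, ← Finset.sum_mul,
      PMF.sum_toReal, one_mul]

end MOMDP

/-! ### Properties of the parameters -/

namespace Problem.Valid

variable {n m d : ℕ} {I : Problem n m d} (hI : I.Valid)

include hI

theorem one_le_T : (1 : ℝ) ≤ I.T := by exact_mod_cast hI.horizon_pos

theorem modulus_pos {η : ℝ} (h : 0 < η) : 0 < I.ω η := (hI.isModulus η h).1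

theorem one_le_osc : 1 ≤ I.osc := by
  have := (hI.modulus_pos one_pos).le
  unfold Problem.osc
  have : 0 ≤ (d : ℝ) * I.T / I.ω 1 := by positivity
  linarith

theorem threshold_pos : 0 < I.threshold :=
  div_pos hI.accuracy_pos (by linarith [hI.one_le_osc])

theorem drift_pos : 0 < I.drift :=
  div_pos hI.threshold_pos (by linarith [hI.one_le_T])

theorem tol_pos (s : Fin n) : 0 < I.tol :=
  div_pos hI.drift_pos (Nat.cast_pos.2 s.pos)

theorem one_le_quota (s : Fin n) : 1 ≤ I.quota := by
  have := hI.tol_pos s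
  have := hI.failure_mem.1
  unfold Problem.quota
  have : 0 ≤ 4 * n * m / (I.tol * I.tol * I.β) := by positivity
  linarith

theorem cap_pos (s : Fin n) : 0 < I.cap := by
  have := hI.drift_pos
  have := hI.failure_mem.1
  have := hI.one_le_quota s
  unfold Problem.cap
  positivity

theorem half_le_lam : 1 / 2 ≤ I.lam := by
  have h := hI.one_le_T
  unfold Problem.lam
  have : 1 / (2 * (I.T : ℝ)) ≤ 1 / 2 := by
    apply one_div_le_one_div_of_le <;> linarith
  linarith

theorem lam_lt_one : I.lam < 1 := by
  have h := hI.one_le_T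
  unfold Problem.lam
  have : 0 < 1 / (2 * (I.T : ℝ)) := by positivity
  linarith

theorem lam_pos : 0 < I.lam := by linarith [hI.half_le_lam]

/-- Bernoulli's inequality for (1 - 1/(2T))^T. -/
theorem half_le_lam_pow : 1 / 2 ≤ I.lam ^ I.T := by
  have h := hI.one_le_T
  have e := one_add_mul_le_pow (a := -(1 / (2 * (I.T : ℝ)))) (by
    have : 1 / (2 * (I.T : ℝ)) ≤ 1 / 2 := by
      apply one_div_le_one_div_of_le <;> linarith
    linarith) I.T
  have e2 : (I.T : ℝ) * -(1 / (2 * (I.T : ℝ))) = -(1 / 2) := by field_simp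
  rw [e2] at e
  have e3 : (1 : ℝ) + -(1 / (2 * (I.T : ℝ))) = I.lam := by unfold Problem.lam; ring
  rw [e3] at e
  linarith

theorem mesh_pos (hd : 1 ≤ d) : 0 < I.mesh :=
  div_pos (hI.modulus_pos (by linarith [hI.accuracy_pos]))
    (mul_pos (by exact_mod_cast hd) (by linarith [hI.one_le_T]))

theorem discount_mem_Icc : I.γ ∈ Set.Icc (0 : ℝ) 1 :=
  ⟨hI.discount_mem.1, hI.discount_mem.2.le⟩

/-- The segment from 0 to y has ℓ1 length at most dT. Cut into k > dT/ω(1) equal pieces, it consists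
of steps shorter than ω(1), each of which changes the welfare by less than 1. -/
theorem abs_sub_le_osc (y : Fin d → ℝ) (hy : ∀ i, y i ∈ Set.Icc (0 : ℝ) I.T) :
    |I.W y - I.W 0| ≤ I.osc := by
  have hω := hI.modulus_pos one_pos
  set k : ℕ := ⌊(d : ℝ) * I.T / I.ω 1⌋₊ + 1 with hk
  have hk0 : (0 : ℝ) < k := by positivity
  have hk1 : (d : ℝ) * I.T / I.ω 1 < k := by
    rw [hk]; push_cast; exact Nat.lt_floor_add_one _
  have key : ∀ j : ℕ, |I.W (fun i => (j / k : ℝ) * y i) - I.W 0| ≤ j := by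
    intro j
    induction j with
    | zero =>
      have : (fun i => ((0 : ℕ) / k : ℝ) * y i) = 0 := by funext i; simp
      rw [this]
      simp
    | succ j ih =>
      have h1 := (hI.isModulus 1 one_pos).2 (fun i => ((j + 1 : ℕ) / k : ℝ) * y i)
        (fun i => (j / k : ℝ) * y i) (fun i => mul_nonneg (by positivity) (hy i).1)
        (fun i => mul_nonneg (by positivity) (hy i).1) (by
          calc ∑ i, |((j + 1 : ℕ) / k : ℝ) * y i - (j / k : ℝ) * y i|
              = ∑ i, y i / k := by
                refine Finset.sum_congr rfl fun i _ => ?_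
                rw [show ((j + 1 : ℕ) / k : ℝ) * y i - (j / k : ℝ) * y i = y i / k by
                  push_cast; ring]
                exact abs_of_nonneg (div_nonneg (hy i).1 hk0.le)
            _ ≤ ∑ _i : Fin d, (I.T : ℝ) / k :=
                Finset.sum_le_sum fun i _ => div_le_div_of_nonneg_right (hy i).2 hk0.le
            _ = (d : ℝ) * I.T / k := by
                rw [Finset.sum_const, Finset.card_univ, Fintype.card_fin, nsmul_eq_mul]; ring
            _ < I.ω 1 := by
                rw [div_lt_iff₀ hω] at hk1
                rw [div_lt_iff₀ hk0]
                linarith)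
      have h2 := abs_sub_le (I.W fun i => ((j + 1 : ℕ) / k : ℝ) * y i)
        (I.W fun i => (j / k : ℝ) * y i) (I.W 0)
      push_cast at *
      linarith
  have := key k
  have e : (fun i => (k / k : ℝ) * y i) = y := by
    funext i
    rw [div_self hk0.ne', one_mul]
  rw [e] at this
  refine this.trans ?_
  rw [hk, Problem.osc]
  push_cast
  have := Nat.floor_le (a := (d : ℝ) * I.T / I.ω 1) (by positivity)
  linarith

end Problem.Valid

/-! ### Sound knowledge -/

namespace Know

variable {n m d : ℕ}

/-- The knowledge stems from observations of the process `M`. -/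
structure Sound (K : Know) (I : Problem n m d) (M : MOMDP n m d) : Prop where
  num_le : ∀ (s : Fin n) (a : Fin m), K.num s a ≤ I.quota + 1
  cnt_nonneg : ∀ (s : Fin n) (a : Fin m) (z : Fin n), 0 ≤ K.cnt s a z
  sum_cnt : ∀ (s : Fin n) (a : Fin m), ∑ z : Fin n, K.cnt s a z = K.num s a
  rew_mem : K.RewardsMem n m d
  rew_eq : ∀ (s : Fin n) (a : Fin m) (i : Fin d), 0 < K.num s a → K.rew s a i = M.reward s a i

/-- The estimates of the transition probabilities of known state-action pairs are accurate. -/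
def Accurate (K : Know) (I : Problem n m d) (M : MOMDP n m d) : Prop :=
  ∀ (s : Fin n) (a : Fin m), I.quota ≤ K.num s a → ∀ z : Fin n,
    |K.cnt s a z - K.num s a * (M.trans s a z).toReal| ≤ I.tol * K.num s a

variable {K : Know} {I : Problem n m d} {M : MOMDP n m d} (hK : K.Sound I M)

include hK

theorem Sound.num_nonneg (s : Fin n) (a : Fin m) : 0 ≤ K.num s a := by
  rw [← hK.sum_cnt]
  exact Finset.sum_nonneg fun z _ => hK.cnt_nonneg s a z

theorem Sound.freq_nonneg (s : Fin n) (a : Fin m) (z : Fin n) : 0 ≤ K.freq s a z :=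
  div_nonneg (hK.cnt_nonneg s a z) (hK.num_nonneg s a)

theorem Sound.sum_freq (s : Fin n) (a : Fin m) :
    ∑ z : Fin n, K.freq s a z = K.num s a / K.num s a := by
  simp only [freq]
  rw [← Finset.sum_div, hK.sum_cnt]

/-- For a pair without samples the frequencies are 0/0 = 0 and sum to 0, so the empirical model is
only substochastic. -/
theorem Sound.sum_freq_le_one (s : Fin n) (a : Fin m) : ∑ z : Fin n, K.freq s a z ≤ 1 := by
  rw [hK.sum_freq]
  exact div_self_le_one _

theorem Sound.abs_sum_freq_mul_le (s : Fin n) (a : Fin m) (f : Fin n → ℝ) {B : ℝ} (hB : 0 ≤ B)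
    (h : ∀ z, |f z| ≤ B) : |∑ z : Fin n, K.freq s a z * f z| ≤ B := by
  calc |∑ z : Fin n, K.freq s a z * f z| ≤ ∑ z : Fin n, |K.freq s a z * f z| :=
        Finset.abs_sum_le_sum_abs _ _
    _ ≤ ∑ z : Fin n, K.freq s a z * B := Finset.sum_le_sum fun z _ => by
        rw [abs_mul, abs_of_nonneg (hK.freq_nonneg s a z)]
        exact mul_le_mul_of_nonneg_left (h z) (hK.freq_nonneg s a z)
    _ ≤ 1 * B := by
        rw [← Finset.sum_mul]
        exact mul_le_mul_of_nonneg_right (hK.sum_freq_le_one s a) hB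
    _ = B := one_mul B

variable (hI : I.Valid)

include hI

theorem Sound.sum_freq_of_known {s : Fin n} {a : Fin m} (h : I.quota ≤ K.num s a) :
    ∑ z : Fin n, K.freq s a z = 1 := by
  rw [hK.sum_freq, div_self]
  linarith [hI.one_le_quota s]

omit hK in
-- Each of the n probabilities is off by at most `tol`, and `tol` is `drift` divided by n.
theorem Accurate.abs_sub_sum_le (hA : K.Accurate I M) {s : Fin n} {a : Fin m}
    (h : I.quota ≤ K.num s a) (f : Fin n → ℝ) {B : ℝ} (hf : ∀ z, |f z| ≤ B) :
    |∑ z, (M.trans s a z).toReal * f z - ∑ z : Fin n, K.freq s a z * f z| ≤ I.drift * B := by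
  have hpos : 0 < K.num s a := by linarith [hI.one_le_quota s]
  have h1 : ∀ z : Fin n, |(M.trans s a z).toReal - K.freq s a z| ≤ I.tol := by
    intro z
    have := hA s a h z
    have e : (M.trans s a z).toReal - K.freq s a z =
        -(K.cnt s a z - K.num s a * (M.trans s a z).toReal) / K.num s a := by
      rw [freq]
      field_simp
      ring
    rw [e, abs_div, abs_neg, abs_of_pos hpos, div_le_iff₀ hpos]
    exact this
  rw [← Finset.sum_sub_distrib]
  calc _ ≤ ∑ z : Fin n, |(M.trans s a z).toReal * f z - K.freq s a z * f z| :=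
        Finset.abs_sum_le_sum_abs _ _
    _ ≤ ∑ z : Fin n, I.tol * B := Finset.sum_le_sum fun z _ => by
        rw [← sub_mul, abs_mul]
        exact mul_le_mul (h1 z) (hf z) (abs_nonneg _) (hI.tol_pos s).le
    _ = I.drift * B := by
        have : (n : ℝ) ≠ 0 := Nat.cast_ne_zero.2 s.pos.ne'
        rw [Finset.sum_const, Finset.card_univ, Fintype.card_fin, nsmul_eq_mul, Problem.tol]
        field_simp

theorem Sound.explore_mem (hm : 0 < m) (k : ℕ) (s : Fin n) :
    K.explore I k s ∈ Set.Icc (0 : ℝ) I.lam := by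
  induction k generalizing s with
  | zero => exact ⟨le_rfl, hI.lam_pos.le⟩
  | succ k ih =>
    rw [explore, exploreQ]
    have ha := bestArg_lt (K.exploreQ I (K.explore I k) s) hm
    split_ifs
    · rw [Finset.sum_range]
      refine ⟨mul_nonneg hI.lam_pos.le (Finset.sum_nonneg fun z _ =>
        mul_nonneg (hK.freq_nonneg s ⟨_, ha⟩ z) (ih z).1), ?_⟩
      have := hK.abs_sum_freq_mul_le s ⟨_, ha⟩ (fun z => K.explore I k z) zero_le_one
        (fun z => abs_le.2 ⟨by linarith [(ih z).1], (ih z).2.trans hI.lam_lt_one.le⟩)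
      exact mul_le_of_le_one_right hI.lam_pos.le (abs_le.1 this).2
    · exact ⟨hI.lam_pos.le, le_rfl⟩

omit hK hI in
theorem exploreQ_le_explore (K : Know) (I : Problem n m d) (k s : ℕ) {a : ℕ} (ha : a < m) :
    K.exploreQ I (K.explore I k) s a ≤ K.explore I (k + 1) s :=
  le_bestArg _ ha

/-- More time can only help to reach an unknown pair. Formally, the maximizing action for k + 1
steps is a candidate for k + 2 steps, with larger continuation values. -/
theorem Sound.explore_le_succ (hm : 0 < m) (k : ℕ) (s : Fin n) :
    K.explore I k s ≤ K.explore I (k + 1) s := by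
  induction k generalizing s with
  | zero => exact (hK.explore_mem hI hm 1 s).1
  | succ k ih =>
    have ha := bestArg_lt (K.exploreQ I (K.explore I k) s) hm
    rw [explore]
    refine le_trans ?_ (K.exploreQ_le_explore I (k + 1) s ha)
    simp only [exploreQ]
    split_ifs
    · rw [Finset.sum_range, Finset.sum_range]
      exact mul_le_mul_of_nonneg_left (Finset.sum_le_sum fun z _ =>
        mul_le_mul_of_nonneg_left (ih z) (hK.freq_nonneg s ⟨_, ha⟩ z)) hI.lam_pos.le
    · exact le_rfl

/-- The error of the value for `h` remaining steps. -/
noncomputable def _root_.Know.error (K : Know) (I : Problem n m d) (h : ℕ) (s : ℕ) : ℝ :=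
  2 * I.osc / I.lam ^ h * K.explore I h s + I.ε / 4 + h * (I.drift * I.osc)

/-- One step of the comparison between the true process and the empirical model. At a known pair the
errors of the successors are averaged, and the model error `drift * osc` is added. At an unknown
pair the trivial bound 2 `osc` suffices, because `explore` is at least λ there. The functions are
arbitrary, so the lemma serves both inequalities. -/
theorem Sound.error_step (hA : K.Accurate I M) (h : ℕ) (s : Fin n) (a : Fin m)
    (f g : Fin n → ℝ) (hf : ∀ z, |f z| ≤ I.osc) (hg : ∀ z, |g z| ≤ I.osc)
    (hfg : I.quota ≤ K.num s a → ∀ z, f z - g z ≤ K.error I h z) :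
    ∑ z, (M.trans s a z).toReal * f z - ∑ z : Fin n, K.freq s a z * g z ≤
      K.error I (h + 1) s := by
  have hosc := hI.one_le_osc
  have hl := hI.lam_pos
  have hq := K.exploreQ_le_explore I h s a.2
  by_cases hn : I.quota ≤ K.num s a
  · rw [exploreQ, if_pos hn, Finset.sum_range] at hq
    have h1 := (abs_le.1 (hA.abs_sub_sum_le hI hn f hf)).2
    have h2 : ∑ z : Fin n, K.freq s a z * f z - ∑ z : Fin n, K.freq s a z * g z ≤
        2 * I.osc / I.lam ^ h * ∑ z : Fin n, K.freq s a z * K.explore I h z +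
          (I.ε / 4 + h * (I.drift * I.osc)) := by
      rw [← Finset.sum_sub_distrib]
      calc _ ≤ ∑ z : Fin n, K.freq s a z * K.error I h z := Finset.sum_le_sum fun z _ => by
            rw [← mul_sub]
            exact mul_le_mul_of_nonneg_left (hfg hn z) (hK.freq_nonneg s a z)
        _ = _ := by
            simp only [error, mul_add, Finset.sum_add_distrib, ← Finset.sum_mul,
              hK.sum_freq_of_known hI hn, Finset.mul_sum]
            rw [one_mul, one_mul, add_assoc]
            congr 1
            exact Finset.sum_congr rfl fun z _ => by ring
    have h3 : 2 * I.osc / I.lam ^ h * ∑ z : Fin n, K.freq s a z * K.explore I h z ≤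
        2 * I.osc / I.lam ^ (h + 1) * K.explore I (h + 1) s := by
      calc _ = 2 * I.osc / I.lam ^ (h + 1) *
            (I.lam * ∑ z : Fin n, K.freq s a z * K.explore I h z) := by
            rw [pow_succ]
            field_simp
        _ ≤ _ := mul_le_mul_of_nonneg_left hq (by positivity)
    unfold error
    push_cast
    linarith
  · rw [exploreQ, if_neg hn] at hq
    have h1 := (M.trans s a).sum_mul_le f I.osc fun z => (abs_le.1 (hf z)).2
    have h2 := (abs_le.1 (hK.abs_sum_freq_mul_le s a g (by linarith) hg)).1
    -- The division by λ^(h+1) in the error undoes the discounting of `explore`.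
    have h3 : 2 * I.osc ≤ 2 * I.osc / I.lam ^ (h + 1) * K.explore I (h + 1) s := by
      calc 2 * I.osc ≤ 2 * I.osc / I.lam ^ h := by
            rw [le_div_iff₀ (by positivity)]
            exact mul_le_of_le_one_right (by linarith) (pow_le_one₀ hl.le hI.lam_lt_one.le)
        _ = 2 * I.osc / I.lam ^ (h + 1) * I.lam := by
            rw [pow_succ]
            field_simp
        _ ≤ _ := mul_le_mul_of_nonneg_left hq (by positivity)
    have h4 := hI.accuracy_pos
    have h5 : 0 ≤ ((h + 1 : ℕ) : ℝ) * (I.drift * I.osc) := by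
      have := hI.drift_pos
      positivity
    unfold error
    linarith

/-- If exploration is not worthwhile, the values of the discretized problem are accurate. -/
theorem Sound.error_le (hm : 0 < m) {s : Fin n} (h : K.explore I I.T s < I.threshold) :
    2 * K.error I I.T s ≤ I.ε := by
  have hosc := hI.one_le_osc
  have hT := hI.one_le_T
  have hε := hI.accuracy_pos
  -- The error splits into at most ε/8 for unknown pairs, ε/4 for rounding and ε/128 for the
  -- estimates, less than ε/2 in total.
  have e1 : 2 * I.osc / I.lam ^ I.T ≤ 4 * I.osc := by
    have := hI.half_le_lam_pow
    rw [div_le_iff₀ (by linarith)]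
    nlinarith
  have e2 : 4 * I.osc * I.threshold = I.ε / 8 := by
    rw [Problem.threshold]
    field_simp
    norm_num
  have e3 : I.T * (I.drift * I.osc) = I.ε / 128 := by
    rw [Problem.drift, Problem.threshold]
    field_simp
    norm_num
  have e4 : 2 * I.osc / I.lam ^ I.T * K.explore I I.T s ≤ 4 * I.osc * I.threshold :=
    mul_le_mul e1 h.le (hK.explore_mem hI hm _ s).1 (by linarith)
  unfold error
  linarith

end Know

/-! ### The value of the output policy -/

namespace Problem

variable {n m d : ℕ} (I : Problem n m d) (M : MOMDP n m d)

/-- The welfare, relative to the one of no reward, if the reward `y` has been accumulated up to the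
time `t`. -/
noncomputable def shifted (t : ℕ) (y : Fin d → ℝ) : (Fin d → ℝ) → ℝ :=
  fun w => I.W (y + I.γ ^ t • w) - I.W 0

/-- The reward collected so far becomes part of the state. The discounted reward of step t is added
to y, so the welfare is only evaluated at the end. -/
theorem value_shifted_succ (t h : ℕ) (y : Fin d → ℝ) (π : Policy n m) (s : Fin n) :
    M.value (I.shifted t y) I.γ (h + 1) π s = ∑ a, (π [] s a).toReal *
      ∑ z, (M.trans s a z).toReal *
        M.value (I.shifted (t + 1) (y + I.γ ^ t • M.reward s a)) I.γ h
          (fun l => π ((s, a) :: l)) z := by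
  have e : ∀ a, (fun w => I.shifted t y (M.reward s a + I.γ • w)) =
      I.shifted (t + 1) (y + I.γ ^ t • M.reward s a) := by
    intro a
    funext w
    simp only [shifted, smul_add, smul_smul, pow_succ, add_assoc]
  simp only [M.value_succ, e]

variable {I}

theorem Valid.add_reward_mem (hI : I.Valid) {t : ℕ} {y : Fin d → ℝ}
    (hy : ∀ i, y i ∈ Set.Icc (0 : ℝ) t) (s : Fin n) (a : Fin m) (i : Fin d) :
    (y + I.γ ^ t • M.reward s a) i ∈ Set.Icc (0 : ℝ) (t + 1 : ℕ) := by
  have h1 := pow_nonneg hI.discount_mem_Icc.1 t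
  have h2 := pow_le_one₀ hI.discount_mem_Icc.1 hI.discount_mem_Icc.2 (n := t)
  have h3 := M.reward_mem s a i
  simp only [Pi.add_apply, Pi.smul_apply, smul_eq_mul]
  push_cast
  exact ⟨add_nonneg (hy i).1 (mul_nonneg h1 h3.1), add_le_add (hy i).2 (mul_le_one₀ h2 h3.1 h3.2)⟩

theorem Valid.abs_value_shifted_le (hI : I.Valid) {h t : ℕ} (ht : t + h = I.T) {y : Fin d → ℝ}
    (hy : ∀ i, y i ∈ Set.Icc (0 : ℝ) t) (π : Policy n m) (s : Fin n) :
    |M.value (I.shifted t y) I.γ h π s| ≤ I.osc := by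
  induction h generalizing t y π s with
  | zero =>
    rw [M.value_zero, shifted, smul_zero, add_zero]
    exact hI.abs_sub_le_osc y (by simpa [← ht] using hy)
  | succ h ih =>
    rw [value_shifted_succ]
    exact (π [] s).abs_sum_mul_le _ _ fun a => (M.trans s a).abs_sum_mul_le _ _ fun z =>
      ih (by omega) (hI.add_reward_mem M hy s a) _ _

/-- No digit overflows: grid points below accumulated rewards of at most T have digits at most
T/mesh. -/
theorem Valid.lt_grid (hI : I.Valid) (hd : 1 ≤ d) {t v : ℕ} (ht : t ≤ I.T) (h : I.mesh * v ≤ t) :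
    v < I.grid := by
  have h1 := hI.mesh_pos hd
  have h2 : (v : ℝ) ≤ I.T / I.mesh := by
    rw [le_div_iff₀ h1, mul_comm]
    exact h.trans (Nat.cast_le.2 ht)
  have h3 := Nat.le_ceil ((I.T : ℝ) / I.mesh + 1)
  exact Nat.cast_lt.1 (lt_of_lt_of_le (by linarith) h3)

end Problem

namespace Know

variable {n m d : ℕ} {K : Know} {I : Problem n m d} {M : MOMDP n m d} {μ : Memory}

/-- The accumulated grid point after the action `a` in the state `s` at time `t`. -/
noncomputable def nextGrid (K : Know) (I : Problem n m d) (t s a : ℕ) (v : ℕ → ℕ) : ℕ → ℕ :=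
  fun i => if i < d then v i + K.gridReward I t s a i else v i

/-- The code is linear in the digit vector, so moving on the grid means adding the precomputed
offset. -/
theorem encode_nextGrid (t s a : ℕ) (v : ℕ → ℕ) :
    encode I.grid d (K.nextGrid I t s a v) =
      encode I.grid d v + encode I.grid d (K.gridReward I t s a) := by
  unfold encode
  rw [← Finset.sum_add_distrib]
  refine Finset.sum_congr rfl fun i hi => ?_
  rw [nextGrid, if_pos (Finset.mem_range.1 hi), add_mul]

theorem RewardsMem.discounted_mem (hK : K.RewardsMem n m d) (hI : I.Valid) (t : ℕ) (s : Fin n)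
    (a : Fin m) {i : ℕ} (hi : i < d) : I.γ ^ t * K.rew s a i ∈ Set.Icc (0 : ℝ) 1 := by
  have h := hK s s.2 a a.2 i hi
  have h1 := pow_nonneg hI.discount_mem_Icc.1 t
  have h2 := pow_le_one₀ hI.discount_mem_Icc.1 hI.discount_mem_Icc.2 (n := t)
  exact ⟨mul_nonneg h1 h.1, mul_le_one₀ h2 h.1 h.2⟩

theorem RewardsMem.mesh_mul_gridReward (hK : K.RewardsMem n m d) (hI : I.Valid) (hd : 1 ≤ d)
    (t : ℕ) (s : Fin n) (a : Fin m) {i : ℕ} (hi : i < d) :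
    I.mesh * K.gridReward I t s a i ≤ I.γ ^ t * K.rew s a i ∧
      I.γ ^ t * K.rew s a i < I.mesh * K.gridReward I t s a i + I.mesh := by
  have h1 := hI.mesh_pos hd
  have h2 := (hK.discounted_mem hI t s a hi).1
  constructor
  · have := Nat.floor_le (div_nonneg h2 h1.le)
    rwa [le_div_iff₀ h1, mul_comm] at this
  · have := Nat.lt_floor_add_one (I.γ ^ t * K.rew s a i / I.mesh)
    rw [div_lt_iff₀ h1] at this
    unfold gridReward
    linarith

theorem RewardsMem.mesh_mul_nextGrid_le (hK : K.RewardsMem n m d) (hI : I.Valid) (hd : 1 ≤ d)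
    {t : ℕ} (s : Fin n) (a : Fin m) {v : ℕ → ℕ} (hv : ∀ i, I.mesh * v i ≤ t) (i : ℕ) :
    I.mesh * K.nextGrid I t s a v i ≤ (t + 1 : ℕ) := by
  have := hv i
  unfold nextGrid
  push_cast
  split_ifs with hi
  · have h1 := (hK.mesh_mul_gridReward hI hd t s a hi).1
    have h2 := (hK.discounted_mem hI t s a hi).2
    linarith
  · linarith

/-- The grid point `v` is obtained from `y` by rounding down at most `t` times. -/
def Close (I : Problem n m d) (t : ℕ) (v : ℕ → ℕ) (y : Fin d → ℝ) : Prop :=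
  ∀ i : Fin d, I.mesh * v i ≤ y i ∧ (y i < I.mesh * (v i + t) ∨ y i = I.mesh * v i)

/-- One more rounding loses less than one mesh in each coordinate. The pair has to be known, because
the stored reward of a pair without samples is meaningless. -/
theorem Sound.close_next (hK : K.Sound I M) (hI : I.Valid) (hd : 1 ≤ d) {t : ℕ} {v : ℕ → ℕ}
    {y : Fin d → ℝ} (h : Close I t v y) (s : Fin n) (a : Fin m) (hq : I.quota ≤ K.num s a) :
    Close I (t + 1) (K.nextGrid I t s a v) (y + I.γ ^ t • M.reward s a) := by
  intro i
  have h1 := hK.rew_mem.mesh_mul_gridReward hI hd t s a i.2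
  have h2 := hI.mesh_pos hd
  rw [hK.rew_eq s a i (by linarith [hI.one_le_quota s])] at h1
  have h3 : y i ≤ I.mesh * (v i + t) := by
    rcases (h i).2 with h3 | h3
    · exact h3.le
    · rw [h3]
      exact mul_le_mul_of_nonneg_left (by simp) h2.le
  have h4 := (h i).1
  simp only [nextGrid, i.2, if_true, Pi.add_apply, Pi.smul_apply, smul_eq_mul]
  push_cast
  exact ⟨by linarith, Or.inl (by linarith)⟩

/-- Each of the d coordinates is off by less than T meshes, and d T meshes make up ω(ε/4). -/
theorem Close.abs_sub_lt {v : ℕ → ℕ} {y : Fin d → ℝ} (h : Close I I.T v y) (hI : I.Valid)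
    (hd : 1 ≤ d) : |I.W y - I.W fun i => I.mesh * v i| < I.ε / 4 := by
  have h2 := hI.mesh_pos hd
  have hT := hI.one_le_T
  have hd' : (1 : ℝ) ≤ d := by exact_mod_cast hd
  have h0 : ∀ i : Fin d, 0 ≤ I.mesh * v i := fun i => by positivity
  refine (hI.isModulus (I.ε / 4) (by linarith [hI.accuracy_pos])).2 _ _
    (fun i => (h0 i).trans (h i).1) h0 ?_
  calc ∑ i, |y i - I.mesh * v i| < ∑ _i : Fin d, I.mesh * I.T := by
        refine Finset.sum_lt_sum_of_nonempty ⟨⟨0, hd⟩, Finset.mem_univ _⟩ fun i _ => ?_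
        rw [abs_of_nonneg (by linarith [(h i).1])]
        rcases (h i).2 with h3 | h3
        · linarith
        · rw [h3, sub_self]
          positivity
    _ = I.ω (I.ε / 4) := by
        rw [Finset.sum_const, Finset.card_univ, Fintype.card_fin, nsmul_eq_mul, Problem.mesh]
        field_simp

/-- The value of the discretized problem with `h` remaining steps. -/
theorem Solved.step_eq (hμ : K.Solved I μ) (hI : I.Valid) (hd : 1 ≤ d) {h t : ℕ}
    (ht : t + (h + 1) = I.T) {v : ℕ → ℕ} (hv : ∀ i, I.mesh * v i ≤ t) (s : Fin n) :
    (μ.real 6 (h + 1) s (encode I.grid d v) =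
      ∑ z : Fin n, K.freq s (μ.nat 17 (h + 1) s (encode I.grid d v)) z *
        μ.real 6 h z (encode I.grid d
          (K.nextGrid I t s (μ.nat 17 (h + 1) s (encode I.grid d v)) v))) ∧
    ∀ a < m, ∑ z : Fin n, K.freq s a z * μ.real 6 h z (encode I.grid d (K.nextGrid I t s a v)) ≤
      μ.real 6 (h + 1) s (encode I.grid d v) := by
  have hx : encode I.grid d v < I.grid ^ d :=
    encode_lt d v fun i _ => hI.lt_grid hd (by omega) (hv i)
  have h1 := hμ.step h (by omega) s s.2 _ hx
  rw [show I.T - (h + 1) = t by omega] at h1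
  have e : ∀ a, K.exploitQ I t (μ.real 6 h) s (encode I.grid d v) a =
      ∑ z : Fin n, K.freq s a z * μ.real 6 h z (encode I.grid d (K.nextGrid I t s a v)) := by
    intro a
    rw [exploitQ, Finset.sum_range]
    simp only [encode_nextGrid]
  refine ⟨h1.1.trans (e _), fun a ha => ?_⟩
  rw [h1.1, h1.2, ← e]
  exact le_bestArg _ ha

theorem Solved.act_lt (hμ : K.Solved I μ) (hI : I.Valid) (hd : 1 ≤ d) (hm : 0 < m) {h t : ℕ}
    (ht : t + (h + 1) = I.T) {v : ℕ → ℕ} (hv : ∀ i, I.mesh * v i ≤ t) (s : Fin n) :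
    μ.nat 17 (h + 1) s (encode I.grid d v) < m := by
  rw [(hμ.step h (by omega) s s.2 _
    (encode_lt d v fun i _ => hI.lt_grid hd (by omega) (hv i))).2]
  exact bestArg_lt _ hm

theorem Solved.terminal_eq (hμ : K.Solved I μ) (hI : I.Valid) (hd : 1 ≤ d) {t : ℕ}
    (ht : t + 0 = I.T) {v : ℕ → ℕ} (hv : ∀ i, I.mesh * v i ≤ t) (s : Fin n) :
    μ.real 6 0 s (encode I.grid d v) = I.W (fun i => I.mesh * v i) - I.W 0 :=
  hμ.terminal v (fun i => hI.lt_grid hd (by omega) (hv i)) s s.2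

/-- The subtraction of W(0) matters here: values centred at 0 keep their bound under the averages of
the substochastic empirical model. -/
theorem Solved.abs_le_osc (hμ : K.Solved I μ) (hK : K.Sound I M) (hI : I.Valid) (hd : 1 ≤ d)
    (hm : 0 < m) {h t : ℕ} (ht : t + h = I.T) {v : ℕ → ℕ} (hv : ∀ i, I.mesh * v i ≤ t)
    (s : Fin n) : |μ.real 6 h s (encode I.grid d v)| ≤ I.osc := by
  induction h generalizing t v s with
  | zero =>
    rw [hμ.terminal_eq hI hd ht hv]
    have := hI.mesh_pos hd
    exact hI.abs_sub_le_osc _ fun i => ⟨by positivity, by simpa [← ht] using hv i⟩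
  | succ h ih =>
    rw [(hμ.step_eq hI hd ht hv s).1]
    have ha := hμ.act_lt hI hd hm ht hv s
    exact hK.abs_sum_freq_mul_le s ⟨_, ha⟩ _ (by linarith [hI.one_le_osc]) fun z =>
      ih (by omega) (hK.rew_mem.mesh_mul_nextGrid_le hI hd s ⟨_, ha⟩ hv) z

theorem Solved.terminal_error_le (hμ : K.Solved I μ) (hI : I.Valid) (hd : 1 ≤ d)
    {t : ℕ} (ht : t + 0 = I.T) {v : ℕ → ℕ} {y : Fin d → ℝ}
    (hv : ∀ i, I.mesh * v i ≤ t) (hc : Close I t v y) (π : Policy n m) (s : Fin n) :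
    |M.value (I.shifted t y) I.γ 0 π s - μ.real 6 0 s (encode I.grid d v)| ≤ K.error I 0 s := by
  rw [M.value_zero, hμ.terminal_eq hI hd ht hv, Problem.shifted, smul_zero, add_zero,
    sub_sub_sub_cancel_right]
  have ht' : t = I.T := ht
  rw [ht'] at hc
  refine (hc.abs_sub_lt hI hd).le.trans ?_
  simp [error, explore]

/-- Induction on the number of remaining steps. Whatever action the policy draws, `error_step`
compares its true continuation with the empirical one, and the computed value is the maximum over
all actions. -/
theorem Sound.value_le (hK : K.Sound I M) (hI : I.Valid) (hd : 1 ≤ d) (hm : 0 < m)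
    (hA : K.Accurate I M) (hμ : K.Solved I μ) {h t : ℕ} (ht : t + h = I.T) {v : ℕ → ℕ}
    {y : Fin d → ℝ} (hv : ∀ i, I.mesh * v i ≤ t) (hy : ∀ i, y i ∈ Set.Icc (0 : ℝ) t)
    (hc : Close I t v y) (π : Policy n m) (s : Fin n) :
    M.value (I.shifted t y) I.γ h π s ≤
      μ.real 6 h s (encode I.grid d v) + K.error I h s := by
  induction h generalizing t v y π s with
  | zero => linarith [(abs_le.1 (hμ.terminal_error_le (M := M) hI hd ht hv hc π s)).2]
  | succ h ih =>
    rw [I.value_shifted_succ]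
    refine (π [] s).sum_mul_le _ _ fun a => ?_
    have h1 := hK.error_step hI hA h s a
      (fun z => M.value (I.shifted (t + 1) (y + I.γ ^ t • M.reward s a)) I.γ h
          (fun l => π ((s, a) :: l)) z)
      (fun z => μ.real 6 h z (encode I.grid d (K.nextGrid I t s a v)))
      (fun z => hI.abs_value_shifted_le M (by omega) (hI.add_reward_mem M hy s a) _ _)
      (fun z => hμ.abs_le_osc hK hI hd hm (by omega)
        (hK.rew_mem.mesh_mul_nextGrid_le hI hd s a hv) z)
      (fun hq z => by
        have := ih (t := t + 1) (by omega) (hK.rew_mem.mesh_mul_nextGrid_le hI hd s a hv)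
          (hI.add_reward_mem M hy s a) (hK.close_next hI hd hc s a hq)
          (fun l => π ((s, a) :: l)) z
        linarith)
    have h2 := (hμ.step_eq hI hd ht hv s).2 a a.2
    linarith

/-- The reverse comparison for the output policy, which takes the maximizing action. The induction
follows the memory of the policy, whose code and time describe the current grid point. -/
theorem Sound.le_value [NeZero m] (hK : K.Sound I M) (hI : I.Valid) (hd : 1 ≤ d)
    (hA : K.Accurate I M) (hμ : K.Solved I μ) {h t : ℕ} (ht : t + h = I.T) {v : ℕ → ℕ}
    {y : Fin d → ℝ} (hv : ∀ i, I.mesh * v i ≤ t) (hy : ∀ i, y i ∈ Set.Icc (0 : ℝ) t)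
    (hc : Close I t v y) {ν : Memory} (h16 : ν.nat 16 = μ.nat 16) (h17 : ν.nat 17 = μ.nat 17)
    (h18 : ν.nat 18 0 0 0 = encode I.grid d v) (h19 : ν.nat 19 0 0 0 = t) (s : Fin n) :
    μ.real 6 h s (encode I.grid d v) ≤
      M.value (I.shifted t y) I.γ h (learner.output I ν) s + K.error I h s := by
  have hm : 0 < m := NeZero.pos m
  induction h generalizing t v y ν s with
  | zero => linarith [(abs_le.1 (hμ.terminal_error_le (M := M) hI hd ht hv hc (learner.output I ν) s)).1]
  | succ h ih =>
    obtain ⟨p1, p18, p19, p16, p17, -, -⟩ := exec_policy I s (fun _ => 0) ν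
    have ha := hμ.act_lt hI hd hm ht hv s
    have hs := (hμ.step_eq hI hd ht hv s).1
    rw [h17, h18, h19, show I.T - t = h + 1 by omega] at p1
    generalize μ.nat 17 (h + 1) s (encode I.grid d v) = a at *
    rw [p1, h16, h18, h19, hμ.offset t (by omega) s s.2 a ha, ← encode_nextGrid] at p18
    have e1 : learner.output I ν [] s = PMF.pure ⟨a, ha⟩ := by
      change PMF.pure (Fin.ofNat m ((Prog.policy.exec (I.view s fun _ => 0) ν).nat 1 0 0 0)) = _
      rw [p1]
      congr 1
      exact Fin.ext (Nat.mod_eq_of_lt ha)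
    have e2 : (fun l => learner.output I ν ((s, (⟨a, ha⟩ : Fin m)) :: l)) =
        learner.output I (Prog.policy.exec (I.view s fun _ => 0) ν) := rfl
    have e3 := I.value_shifted_succ M t h y (learner.output I ν) s
    rw [Finset.sum_eq_single ⟨a, ha⟩ (fun b _ hb => by
      rw [e1, PMF.pure_apply, if_neg hb, ENNReal.toReal_zero, zero_mul]) (by simp), e1,
      PMF.pure_apply, if_pos rfl, ENNReal.toReal_one, one_mul, e2] at e3
    rw [e3, hs]
    -- Negating both functions turns the upper estimate of `error_step` into the lower one.
    have h1 := hK.error_step hI hA h s ⟨a, ha⟩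
      (fun z => -M.value (I.shifted (t + 1) (y + I.γ ^ t • M.reward s ⟨a, ha⟩)) I.γ h
          (learner.output I (Prog.policy.exec (I.view s fun _ => 0) ν)) z)
      (fun z => -μ.real 6 h z (encode I.grid d (K.nextGrid I t s a v)))
      (fun z => by
        rw [abs_neg]
        exact hI.abs_value_shifted_le M (by omega) (hI.add_reward_mem M hy s _) _ _)
      (fun z => by
        rw [abs_neg]
        exact hμ.abs_le_osc hK hI hd hm (by omega)
          (hK.rew_mem.mesh_mul_nextGrid_le hI hd s ⟨a, ha⟩ hv) z)
      (fun hq z => by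
        have := ih (t := t + 1) (by omega) (hK.rew_mem.mesh_mul_nextGrid_le hI hd s ⟨a, ha⟩ hv)
          (hI.add_reward_mem M hy s ⟨a, ha⟩) (hK.close_next hI hd hc s ⟨a, ha⟩ hq)
          (p16.trans h16) (p17.trans h17) p18 (by rw [p19, h19]) z
        linarith)
    simp only [mul_neg, Finset.sum_neg_distrib] at h1
    linarith

/-- If exploration is not worthwhile, the output policy is nearly optimal. -/
theorem Sound.optValue_sub_le [NeZero m] (hK : K.Sound I M) (hI : I.Valid) (hd : 1 ≤ d)
    (hA : K.Accurate I M) (hμ : K.Solved I μ) (h18 : μ.nat 18 0 0 0 = 0)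
    (h19 : μ.nat 19 0 0 0 = 0) {s : Fin n} (hs : K.explore I I.T s < I.threshold) :
    M.optValue I.W I.γ I.T s - I.ε ≤ M.value I.W I.γ I.T (learner.output I μ) s := by
  have hm : 0 < m := NeZero.pos m
  have hv : ∀ i : ℕ, I.mesh * ((0 : ℕ → ℕ) i : ℕ) ≤ (0 : ℕ) := fun i => by simp
  have hy : ∀ i, (0 : Fin d → ℝ) i ∈ Set.Icc (0 : ℝ) (0 : ℕ) := fun i => by simp
  -- With t = 0 the strict inequality is impossible; the alternative of equality in `Close` covers
  -- this case.
  have hc : Close I 0 0 (0 : Fin d → ℝ) := fun i => by simp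
  have e : ∀ π : Policy n m, M.value (I.shifted 0 0) I.γ I.T π s =
      M.value I.W I.γ I.T π s - I.W 0 := by
    intro π
    rw [← M.value_sub_const]
    congr 1
    funext w
    simp [Problem.shifted]
  have h1 := hK.le_value hI hd hA hμ (zero_add I.T) hv hy hc rfl rfl
    (by simpa [encode] using h18) h19 s
  have h2 := hK.error_le hI hm hs
  have h3 : M.optValue I.W I.γ I.T s ≤
      μ.real 6 I.T s (encode I.grid d 0) + K.error I I.T s + I.W 0 := by
    have : Nonempty (Policy n m) := ⟨learner.output I μ⟩
    refine ciSup_le fun π => ?_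
    have := hK.value_le hI hd hm hA hμ (zero_add I.T) hv hy hc π s
    rw [e] at this
    linarith
  rw [e] at h1
  linarith

end Know

/-! ### The potential of the learner -/

namespace Know

variable {n m d : ℕ}

theorem observe_of_known {K : Know} {q : ℝ} {s a : ℕ} (h : q ≤ K.num s a) (z : ℕ)
    (r : Fin d → ℝ) : K.observe q s a z r = K := if_pos h

theorem observe_num {K : Know} {q : ℝ} {s : Fin n} {a : Fin m} (h : ¬q ≤ K.num s a) (z : ℕ)
    (r : Fin d → ℝ) (s' : Fin n) (a' : Fin m) :
    (K.observe q s a z r).num s' a' =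
      if (s', a') = (s, a) then K.num s a + 1 else K.num s' a' := by
  simp [observe, h, Fin.ext_iff]

theorem observe_cnt {K : Know} {q : ℝ} {s : Fin n} {a : Fin m} (h : ¬q ≤ K.num s a) (z : Fin n)
    (r : Fin d → ℝ) (s' : Fin n) (a' : Fin m) (w : Fin n) :
    (K.observe q s a z r).cnt s' a' w =
      if (s', a') = (s, a) then K.cnt s a w + (if w = z then 1 else 0) else K.cnt s' a' w := by
  by_cases h1 : s' = s <;> by_cases h2 : a' = a <;> by_cases h3 : w = z <;>
    simp [observe, h, h1, h2, h3, Fin.val_inj]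

theorem observe_rew {K : Know} {q : ℝ} {s : Fin n} {a : Fin m} (h : ¬q ≤ K.num s a) (z : ℕ)
    (r : Fin d → ℝ) (s' : Fin n) (a' : Fin m) (i : Fin d) :
    (K.observe q s a z r).rew s' a' i = if (s', a') = (s, a) then r i else K.rew s' a' i := by
  by_cases h1 : s' = s <;> by_cases h2 : a' = a <;>
    simp [observe, h, h1, h2, Fin.val_inj]

variable {K : Know} {I : Problem n m d} {M : MOMDP n m d}

theorem Sound.observe (hK : K.Sound I M) (s : Fin n) (a : Fin m) (z : Fin n) :
    (K.observe I.quota s a z (M.reward s a)).Sound I M := by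
  by_cases h : I.quota ≤ K.num s a
  · rwa [observe_of_known h]
  refine ⟨fun s' a' => ?_, fun s' a' w => ?_, fun s' a' => ?_, fun s' hs a' ha i hi => ?_,
    fun s' a' i h1 => ?_⟩
  · rw [observe_num h]
    split_ifs
    · linarith
    · exact hK.num_le s' a'
  · rw [observe_cnt h]
    split_ifs
    · linarith [hK.cnt_nonneg s a w]
    · linarith [hK.cnt_nonneg s a w]
    · exact hK.cnt_nonneg s' a' w
  · simp only [observe_num h, observe_cnt h]
    split_ifs
    · rw [Finset.sum_add_distrib, hK.sum_cnt]
      simp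
    · exact hK.sum_cnt s' a'
  · have := observe_rew h z (M.reward s a) ⟨s', hs⟩ ⟨a', ha⟩ ⟨i, hi⟩
    simp only at this
    rw [this]
    split_ifs
    · exact M.reward_mem _ _ _
    · exact hK.rew_mem s' hs a' ha i hi
  · rw [observe_rew h]
    rw [observe_num h] at h1
    split_ifs at h1 ⊢ with h2
    · rw [Prod.mk.injEq] at h2
      rw [h2.1, h2.2]
    · exact hK.rew_eq s' a' i h1

/-- Known pairs are frozen, so an inaccurate estimate is never repaired. Thus inaccuracy persists,
and the progress term of the potential may be dropped for good once it occurs. -/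
theorem Accurate.of_observe {s : Fin n} {a : Fin m} {z : Fin n} {r : Fin d → ℝ}
    (h : (K.observe I.quota s a z r).Accurate I M) : K.Accurate I M := by
  by_cases hq : I.quota ≤ K.num s a
  · rwa [observe_of_known hq] at h
  intro s' a' h1 w
  have hne : (s', a') ≠ (s, a) := by
    intro e
    rw [Prod.mk.injEq] at e
    rw [e.1, e.2] at h1
    exact hq h1
  have := h s' a'
  simp only [observe_num hq, observe_cnt hq, if_neg hne] at this
  exact this h1 w

/-- The squared deviation of the numbers of transitions from their expectations, compared to a
bound of its expectation. -/
noncomputable def deviation (K : Know) (M : MOMDP n m d) (x : Fin n × Fin m) : ℝ :=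
  ∑ w : Fin n, (K.cnt x.1 x.2 w - K.num x.1 x.2 * (M.trans x.1 x.2 w).toReal) ^ 2 -
    K.num x.1 x.2

/-- The number of observations that are still missing. -/
noncomputable def missing (K : Know) (I : Problem n m d) : ℝ :=
  ∑ x : Fin n × Fin m, (I.quota + 1 - K.num x.1 x.2)

/-- A sample z adds 1_{w=z} - p_w to the deviation of w. Expanding the squares gives the increment;
the summand 1 from the square of the indicator cancels against the increase of the count. -/
theorem sum_deviation_observe {s : Fin n} {a : Fin m} (h : ¬I.quota ≤ K.num s a) (z : Fin n)
    (r : Fin d → ℝ) :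
    ∑ x, (K.observe I.quota s a z r).deviation M x = ∑ x, K.deviation M x +
      (2 * (K.cnt s a z - K.num s a * (M.trans s a z).toReal - (M.trans s a z).toReal) -
        2 * ∑ w : Fin n, (K.cnt s a w - K.num s a * (M.trans s a w).toReal) *
          (M.trans s a w).toReal + ∑ w, (M.trans s a w).toReal ^ 2) := by
  have e : ∀ x, (K.observe I.quota s a z r).deviation M x = K.deviation M x +
      if x = (s, a) then ∑ w : Fin n, (2 * (K.cnt s a w - K.num s a * (M.trans s a w).toReal) *
        ((if w = z then 1 else 0) - (M.trans s a w).toReal) +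
        ((if w = z then 1 else 0) - (M.trans s a w).toReal) ^ 2) - 1 else 0 := by
    rintro ⟨s', a'⟩
    simp only [deviation, observe_num h, observe_cnt h]
    split_ifs with hx
    · rw [Prod.mk.injEq] at hx
      rw [hx.1, hx.2]
      have : ∀ p q r t : ℝ, p - (q + 1) = r - q + (t - 1) ↔ p = r + t := by
        intro p q r t
        constructor <;> intro h <;> linarith
      rw [this, ← Finset.sum_add_distrib]
      exact Finset.sum_congr rfl fun w _ => by ring
    · rw [add_zero]
  simp only [e, Finset.sum_add_distrib, Finset.sum_ite_eq', Finset.mem_univ, if_true]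
  congr 1
  have e2 : ∀ w : Fin n, 2 * (K.cnt s a w - K.num s a * (M.trans s a w).toReal) *
        ((if w = z then 1 else 0) - (M.trans s a w).toReal) +
        ((if w = z then (1 : ℝ) else 0) - (M.trans s a w).toReal) ^ 2 =
      (if w = z then 2 * (K.cnt s a w - K.num s a * (M.trans s a w).toReal) -
        2 * (M.trans s a w).toReal + 1 else 0) -
      2 * ((K.cnt s a w - K.num s a * (M.trans s a w).toReal) * (M.trans s a w).toReal) +
      (M.trans s a w).toReal ^ 2 := by
    intro w
    split_ifs <;> ring
  rw [← Finset.sum_add_distrib]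
  simp only [e2, Finset.sum_add_distrib, Finset.sum_sub_distrib, Finset.sum_ite_eq',
    Finset.mem_univ, if_true, ← Finset.mul_sum]
  ring

/-- The deviation has mean-zero increments and the variance of one sample, summed over all
coordinates, is 1 - ∑ p² ≤ 1. Subtracting the count therefore gives a supermartingale. -/
theorem sum_mul_deviation_observe_le (s : Fin n) (a : Fin m) (r : Fin d → ℝ) :
    ∑ z : Fin n, (M.trans s a z).toReal * ∑ x, (K.observe I.quota s a z r).deviation M x ≤
      ∑ x, K.deviation M x := by
  by_cases h : I.quota ≤ K.num s a
  · simp only [observe_of_known h, ← Finset.sum_mul, PMF.sum_toReal, one_mul, le_refl]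
  · simp only [sum_deviation_observe h]
    set p := fun w => (M.trans s a w).toReal
    set D := fun w : Fin n => K.cnt s a w - K.num s a * p w
    have h1 : ∑ z, p z = 1 := PMF.sum_toReal _
    have e : ∀ z, p z * (∑ x, K.deviation M x +
        (2 * (D z - p z) - 2 * ∑ w, D w * p w + ∑ w, p w ^ 2)) =
        p z * (∑ x, K.deviation M x - 2 * ∑ w, D w * p w + ∑ w, p w ^ 2) +
          2 * (D z * p z) - 2 * p z ^ 2 := fun z => by ring
    have h2 : 0 ≤ ∑ w, p w ^ 2 := Finset.sum_nonneg fun w _ => sq_nonneg _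
    calc _ = ∑ z, (p z * (∑ x, K.deviation M x - 2 * ∑ w, D w * p w + ∑ w, p w ^ 2) +
          2 * (D z * p z) - 2 * p z ^ 2) := Finset.sum_congr rfl fun z _ => e z
      _ ≤ _ := by
          rw [Finset.sum_sub_distrib, Finset.sum_add_distrib, ← Finset.sum_mul, h1,
            ← Finset.mul_sum, ← Finset.mul_sum]
          linarith

theorem missing_observe {s : Fin n} {a : Fin m} (h : ¬I.quota ≤ K.num s a) (z : Fin n)
    (r : Fin d → ℝ) : (K.observe I.quota s a z r).missing I = K.missing I - 1 := by
  have e : ∀ x : Fin n × Fin m, I.quota + 1 - (K.observe I.quota s a z r).num x.1 x.2 =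
      I.quota + 1 - K.num x.1 x.2 - if x = (s, a) then 1 else 0 := by
    rintro ⟨s', a'⟩
    simp only [observe_num h]
    split_ifs with hx
    · rw [Prod.mk.injEq] at hx
      rw [hx.1, hx.2]
      ring
    · rw [sub_zero]
  unfold missing
  simp only [e, Finset.sum_sub_distrib, Finset.sum_ite_eq', Finset.mem_univ, if_true]

theorem Sound.missing_nonneg (hK : K.Sound I M) : 0 ≤ K.missing I :=
  Finset.sum_nonneg fun x _ => by linarith [hK.num_le x.1 x.2]

theorem exploreAction_lt (hm : 0 < m) (s : Fin n) : K.exploreAction I s < m := bestArg_lt _ hm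

theorem explore_eq (hI : I.Valid) (s : Fin n) :
    K.explore I I.T s = K.exploreQ I (K.explore I (I.T - 1)) s (K.exploreAction I s) := by
  obtain ⟨t, ht⟩ : ∃ t, I.T = t + 1 := ⟨I.T - 1, by have := hI.horizon_pos; omega⟩
  unfold exploreAction
  rw [ht, Nat.add_sub_cancel]
  rfl

/-- At a known pair the mean of `explore` over the successors is 1/λ times the current value or
more, hence larger by at least `threshold`/(2T) = 2 `drift`, of which the estimation error consumes
one `drift`. At an unknown pair one missing sample disappears while `explore`, which equals λ there,
may fall to 0, so the gain is at least 1 - λ. -/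
theorem Sound.progress (hK : K.Sound I M) (hI : I.Valid) (hA : K.Accurate I M) {s : Fin n}
    (hs : I.threshold ≤ K.explore I I.T s) {a : Fin m} (ha : (a : ℕ) = K.exploreAction I s) :
    ∑ z, (M.trans s a z).toReal * ((K.observe I.quota s a z (M.reward s a)).missing I -
        (K.observe I.quota s a z (M.reward s a)).explore I I.T z) ≤
      K.missing I - K.explore I I.T s - I.drift := by
  have hm : 0 < m := a.pos
  have hT := hI.one_le_T
  have hl := hI.lam_lt_one
  have hu := hK.explore_mem hI hm I.T s
  have hd : I.drift * (4 * I.T) = I.threshold := by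
    rw [Problem.drift]
    field_simp
  have hlam : (1 - I.lam) * (2 * I.T) = 1 := by
    rw [Problem.lam]
    field_simp
    ring
  have hex := K.explore_eq (I := I) hI s
  rw [← ha, exploreQ] at hex
  by_cases h : I.quota ≤ K.num s a
  · rw [if_pos h, Finset.sum_range] at hex
    simp only [observe_of_known h, mul_sub, Finset.sum_sub_distrib, ← Finset.sum_mul,
      PMF.sum_toReal, one_mul]
    have h1 := (abs_le.1 (hA.abs_sub_sum_le hI h (fun z => K.explore I I.T z) (B := 1)
      fun z => abs_le.2 ⟨by linarith [(hK.explore_mem hI hm I.T z).1],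
        (hK.explore_mem hI hm I.T z).2.trans hl.le⟩)).1
    -- Returns from T - 1 to T steps, so that the same function of the state is compared before and
    -- after the action.
    have h2 : ∑ z : Fin n, K.freq s a z * K.explore I (I.T - 1) z ≤
        ∑ z : Fin n, K.freq s a z * K.explore I I.T z :=
      Finset.sum_le_sum fun z _ => mul_le_mul_of_nonneg_left (by
        have := hK.explore_le_succ hI hm (I.T - 1) z
        rwa [Nat.sub_add_cancel hI.horizon_pos] at this) (hK.freq_nonneg s a z)
    set S := ∑ z : Fin n, K.freq s a z * K.explore I (I.T - 1) z
    have h3 : K.explore I I.T s + 2 * I.drift ≤ S := by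
      have hS : K.explore I I.T s ≤ S := by
        rw [hex]
        have : 0 ≤ S := by
          by_contra hneg
          have := mul_neg_of_pos_of_neg hI.lam_pos (not_le.1 hneg)
          linarith [hu.1]
        exact mul_le_of_le_one_left this hl.le
      have h4 : (1 - I.lam) * (4 * I.T * I.drift) ≤ (1 - I.lam) * S :=
        mul_le_mul_of_nonneg_left (by linarith) (by linarith)
      have h5 : (1 - I.lam) * (4 * I.T * I.drift) = 2 * I.drift := by
        rw [show (1 - I.lam) * (4 * I.T * I.drift) =
          ((1 - I.lam) * (2 * I.T)) * (2 * I.drift) by ring, hlam, one_mul]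
      have h6 : K.explore I I.T s = I.lam * S := hex
      linarith
    linarith
  · rw [if_neg h] at hex
    simp only [missing_observe h]
    refine (PMF.sum_mul_le _ _ (K.missing I - 1) fun z => ?_).trans ?_
    · linarith [((hK.observe s a z).explore_mem hI hm I.T z).1]
    · have h1 : I.threshold ≤ 1 := by linarith [hu.2]
      have h2 : I.drift ≤ 1 - I.lam := by
        have : I.drift * (4 * I.T) ≤ (1 - I.lam) * (4 * I.T) := by
          rw [hd, show (1 - I.lam) * (4 * I.T) = 2 * ((1 - I.lam) * (2 * I.T)) by ring, hlam]
          linarith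
        exact le_of_mul_le_mul_right this (by linarith)
      linarith

open Classical in
/-- A bound for the probability of failure: the sum of one for inaccurate estimates and one for
too many actions. -/
noncomputable def potential (K : Know) (I : Problem n m d) (M : MOMDP n m d) (s : Fin n)
    (N : ℕ) : ℝ :=
  (∑ x, K.deviation M x + n * m * (I.quota + 1)) / (I.tol * I.quota) ^ 2 +
    if K.Accurate I M then
      (K.missing I - K.explore I I.T s + 1 + I.drift * N) / (I.drift * I.cap) else 0

theorem Sound.sum_num_le (hK : K.Sound I M) :
    ∑ x : Fin n × Fin m, K.num x.1 x.2 ≤ n * m * (I.quota + 1) := by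
  calc _ ≤ ∑ _x : Fin n × Fin m, (I.quota + 1) :=
        Finset.sum_le_sum fun x _ => hK.num_le x.1 x.2
    _ = _ := by simp; ring

theorem Sound.deviation_nonneg (hK : K.Sound I M) :
    0 ≤ ∑ x, K.deviation M x + n * m * (I.quota + 1) := by
  have := hK.sum_num_le
  simp only [deviation, Finset.sum_sub_distrib]
  have h : 0 ≤ ∑ x : Fin n × Fin m, ∑ w : Fin n,
      (K.cnt x.1 x.2 w - K.num x.1 x.2 * (M.trans x.1 x.2 w).toReal) ^ 2 :=
    Finset.sum_nonneg fun x _ => Finset.sum_nonneg fun w _ => sq_nonneg _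
  linarith

/-- The summand 1 in the numerator compensates for `explore`, which is less than 1. -/
theorem Sound.progress_nonneg (hK : K.Sound I M) (hI : I.Valid) (hm : 0 < m) (s : Fin n) (N : ℕ) :
    0 ≤ (K.missing I - K.explore I I.T s + 1 + I.drift * N) / (I.drift * I.cap) := by
  have h1 := hK.missing_nonneg
  have h2 := hK.explore_mem hI hm I.T s
  have h3 := hI.lam_lt_one
  have h4 := hI.drift_pos
  have h5 := hI.cap_pos s
  have h6 : 0 ≤ I.drift * N := by positivity
  exact div_nonneg (by linarith [h2.2]) (by positivity)

theorem Sound.potential_nonneg (hK : K.Sound I M) (hI : I.Valid) (hm : 0 < m) (s : Fin n)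
    (N : ℕ) : 0 ≤ K.potential I M s N := by
  unfold potential
  refine add_nonneg (div_nonneg hK.deviation_nonneg (sq_nonneg _)) ?_
  split_ifs
  · exact hK.progress_nonneg hI hm s N
  · exact le_rfl

open Classical in
-- The supermartingale property. The term `drift * N` grows exactly by the guaranteed progress. If
-- accuracy is lost, the second term drops to 0 from a nonnegative value.
theorem Sound.potential_step (hK : K.Sound I M) (hI : I.Valid) {s : Fin n} (N : ℕ)
    (hs : I.threshold ≤ K.explore I I.T s) {a : Fin m} (ha : (a : ℕ) = K.exploreAction I s) :
    ∑ z, (M.trans s a z).toReal *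
      (K.observe I.quota s a z (M.reward s a)).potential I M z (N + 1) ≤
        K.potential I M s N := by
  have hm : 0 < m := a.pos
  have h1 := sum_mul_deviation_observe_le (K := K) (I := I) (M := M) s a (M.reward s a)
  have h2 : 0 < I.drift * I.cap := mul_pos hI.drift_pos (hI.cap_pos s)
  simp only [potential, mul_add, Finset.sum_add_distrib]
  refine add_le_add ?_ ?_
  · simp only [mul_div_assoc', mul_add, ← Finset.sum_div, Finset.sum_add_distrib, ← Finset.sum_mul,
      PMF.sum_toReal, one_mul]
    exact div_le_div_of_nonneg_right (by linarith) (sq_nonneg _)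
  · by_cases hA : K.Accurate I M
    · rw [if_pos hA]
      have h3 := hK.progress hI hA hs ha
      have h4 : ∀ z : Fin n, (M.trans s a z).toReal *
          (if (K.observe I.quota s a z (M.reward s a)).Accurate I M then
            ((K.observe I.quota s a z (M.reward s a)).missing I -
              (K.observe I.quota s a z (M.reward s a)).explore I I.T z + 1 +
                I.drift * (N + 1 : ℕ)) / (I.drift * I.cap) else 0) ≤
          ((M.trans s a z).toReal * ((K.observe I.quota s a z (M.reward s a)).missing I -
              (K.observe I.quota s a z (M.reward s a)).explore I I.T z) +
            (M.trans s a z).toReal * (1 + I.drift * (N + 1 : ℕ))) / (I.drift * I.cap) := by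
        intro z
        rw [← mul_add, ← mul_div_assoc', ← add_assoc]
        refine mul_le_mul_of_nonneg_left ?_ ENNReal.toReal_nonneg
        split_ifs
        · exact le_rfl
        · exact (hK.observe s a z).progress_nonneg hI hm z (N + 1)
      refine (Finset.sum_le_sum fun z _ => h4 z).trans ?_
      rw [← Finset.sum_div, Finset.sum_add_distrib, ← Finset.sum_mul, PMF.sum_toReal, one_mul]
      refine div_le_div_of_nonneg_right ?_ h2.le
      push_cast
      linarith
    · rw [if_neg hA]
      refine (Finset.sum_eq_zero fun z _ => ?_).le
      rw [if_neg fun h => hA h.of_observe, mul_zero]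

/-- Chebyshev: one bad estimate of a known pair contributes at least (`tol * quota`)² to the squared
deviations, and the subtracted counts are compensated by the constant n m (`quota` + 1). -/
theorem Sound.one_le_potential_of_not_accurate (hK : K.Sound I M) (hI : I.Valid) (s : Fin n)
    (N : ℕ) (hA : ¬K.Accurate I M) : 1 ≤ K.potential I M s N := by
  rw [potential, if_neg hA, add_zero]
  have hA' : ∃ (s' : Fin n) (a : Fin m), I.quota ≤ K.num s' a ∧ ∃ z : Fin n,
      I.tol * K.num s' a < |K.cnt s' a z - K.num s' a * (M.trans s' a z).toReal| := by
    by_contra! h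
    exact hA h
  obtain ⟨s', a, h1, z, h2⟩ := hA'
  have htol := hI.tol_pos s
  have hq := hI.one_le_quota s
  have h3 : I.tol * I.quota ≤ |K.cnt s' a z - K.num s' a * (M.trans s' a z).toReal| :=
    (mul_le_mul_of_nonneg_left h1 htol.le).trans h2.le
  rw [one_le_div (by positivity)]
  have h4 := hK.sum_num_le
  have h5 : (K.cnt s' a z - K.num s' a * (M.trans s' a z).toReal) ^ 2 ≤
      ∑ x : Fin n × Fin m, ∑ w : Fin n,
        (K.cnt x.1 x.2 w - K.num x.1 x.2 * (M.trans x.1 x.2 w).toReal) ^ 2 :=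
    (Finset.single_le_sum (f := fun w : Fin n =>
      (K.cnt s' a w - K.num s' a * (M.trans s' a w).toReal) ^ 2) (fun _ _ => sq_nonneg _)
      (Finset.mem_univ z)).trans
    (Finset.single_le_sum (f := fun x : Fin n × Fin m => ∑ w : Fin n,
      (K.cnt x.1 x.2 w - K.num x.1 x.2 * (M.trans x.1 x.2 w).toReal) ^ 2)
      (fun _ _ => Finset.sum_nonneg fun _ _ => sq_nonneg _) (Finset.mem_univ (s', a)))
  have h6 : (I.tol * I.quota) ^ 2 ≤
      (K.cnt s' a z - K.num s' a * (M.trans s' a z).toReal) ^ 2 := by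
    rw [← sq_abs (K.cnt s' a z - K.num s' a * (M.trans s' a z).toReal)]
    exact pow_le_pow_left₀ (by positivity) h3 2
  simp only [deviation, Finset.sum_sub_distrib]
  linarith

theorem Sound.one_le_potential_of_cap_le (hK : K.Sound I M) (hI : I.Valid) (hm : 0 < m)
    (s : Fin n) {N : ℕ} (hN : I.cap ≤ N) : 1 ≤ K.potential I M s N := by
  by_cases hA : K.Accurate I M
  · have h0 := hI.drift_pos
    have h1 := hI.cap_pos s
    have h2 := (hK.explore_mem hI hm I.T s).2
    have h3 := hI.lam_lt_one
    have h4 := mul_le_mul_of_nonneg_left hN h0.le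
    rw [potential, if_pos hA]
    refine le_add_of_nonneg_of_le (div_nonneg hK.deviation_nonneg (sq_nonneg _)) ?_
    rw [one_le_div (by positivity)]
    linarith [hK.missing_nonneg]
  · exact hK.one_le_potential_of_not_accurate hI s N hA

/-- The knowledge without any observation. -/
def blank : Know := ⟨fun _ _ => 0, fun _ _ _ => 0, fun _ _ _ => 0⟩

theorem sound_blank (hI : I.Valid) (s : Fin n) : blank.Sound I M where
  num_le _ _ := by
    have := hI.one_le_quota s
    simp only [blank]
    linarith
  cnt_nonneg _ _ _ := le_rfl
  sum_cnt _ _ := by simp [blank]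
  rew_mem _ _ _ _ _ _ := ⟨le_rfl, zero_le_one⟩
  rew_eq _ _ _ h := absurd h (lt_irrefl _)

/-- This is where `quota` and `cap` come from: each is chosen so that one of the two terms starts at
no more than β/2. -/
theorem potential_blank_le (hI : I.Valid) (hm : 0 < m) (s : Fin n) :
    blank.potential I M s 0 ≤ I.β := by
  have hq := hI.one_le_quota s
  have ht := hI.tol_pos s
  have hβ := hI.failure_mem.1
  have hd := hI.drift_pos
  have hn : (1 : ℝ) ≤ n := by exact_mod_cast s.pos
  have hm' : (1 : ℝ) ≤ m := by exact_mod_cast hm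
  have h1 : (∑ x, blank.deviation M x + n * m * (I.quota + 1)) / (I.tol * I.quota) ^ 2 ≤
      I.β / 2 := by
    have e : ∑ x, blank.deviation M x = 0 := by simp [deviation, blank]
    rw [e, zero_add, div_le_iff₀ (by positivity)]
    have h2 : 4 * n * m ≤ I.quota * (I.tol * I.tol * I.β) := by
      rw [← div_le_iff₀ (by positivity), Problem.quota]
      linarith
    have h3 : 4 * n * m * I.quota ≤ I.quota * (I.tol * I.tol * I.β) * I.quota :=
      mul_le_mul_of_nonneg_right h2 (by linarith)
    have h4 : (n * m : ℝ) * 1 ≤ n * m * I.quota := mul_le_mul_of_nonneg_left hq (by positivity)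
    nlinarith
  have h2 : (blank.missing I - blank.explore I I.T s + 1 + I.drift * (0 : ℕ)) /
      (I.drift * I.cap) ≤ I.β / 2 := by
    have e : blank.missing I = n * m * (I.quota + 1) := by
      simp [missing, blank]
      ring
    have h3 := ((sound_blank (M := M) hI s).explore_mem hI hm I.T s).1
    have h4 : I.β / 2 * (I.drift * I.cap) = n * m * (I.quota + 1) + 1 := by
      rw [Problem.cap]
      field_simp
    rw [div_le_iff₀ (mul_pos hd (hI.cap_pos s)), h4, e]
    simp only [Nat.cast_zero, mul_zero]
    linarith
  unfold potential
  split_ifs <;> linarith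

end Know

/-! ### Expectations -/

open scoped ENNReal in
/-- The expectation of a function. -/
noncomputable def PMF.expect {α : Type*} (p : PMF α) (G : α → ℝ≥0∞) : ℝ≥0∞ := ∑' x, p x * G x

namespace PMF

open scoped ENNReal

variable {α β : Type*}

theorem expect_pure (a : α) (G : α → ℝ≥0∞) : (PMF.pure a).expect G = G a := by
  rw [expect, tsum_eq_single a fun b hb => by rw [pure_apply_of_ne _ _ hb, zero_mul],
    pure_apply_self, one_mul]

theorem expect_bind (p : PMF α) (f : α → PMF β) (G : β → ℝ≥0∞) :
    (p.bind f).expect G = p.expect fun a => (f a).expect G := by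
  simp only [expect, bind_apply, ← ENNReal.tsum_mul_right, ← ENNReal.tsum_mul_left, mul_assoc]
  exact ENNReal.tsum_comm

theorem expect_map (p : PMF α) (f : α → β) (G : β → ℝ≥0∞) :
    (p.map f).expect G = p.expect (G ∘ f) := by
  rw [← bind_pure_comp, expect_bind]
  simp only [Function.comp_apply, expect_pure]
  rfl

theorem expect_mono (p : PMF α) {G H : α → ℝ≥0∞} (h : ∀ a ∈ p.support, G a ≤ H a) :
    p.expect G ≤ p.expect H := by
  refine ENNReal.tsum_le_tsum fun a => ?_
  by_cases ha : p a = 0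
  · rw [ha, zero_mul, zero_mul]
  · exact mul_le_mul_right (h a ((p.mem_support_iff a).2 ha)) _

theorem expect_ofReal [Fintype α] (p : PMF α) {f : α → ℝ} (hf : ∀ a, 0 ≤ f a) :
    (p.expect fun a => ENNReal.ofReal (f a)) = ENNReal.ofReal (∑ a, (p a).toReal * f a) := by
  rw [expect, tsum_fintype, ENNReal.ofReal_sum_of_nonneg fun a _ =>
    mul_nonneg ENNReal.toReal_nonneg (hf a)]
  refine Finset.sum_congr rfl fun a _ => ?_
  rw [ENNReal.ofReal_mul ENNReal.toReal_nonneg, ENNReal.ofReal_toReal (p.apply_ne_top a)]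

/-- Markov's inequality. -/
theorem one_le_toOuterMeasure_add_expect (p : PMF α) (G : α → ℝ≥0∞) (S : Set α)
    (h : ∀ a ∈ p.support, a ∉ S → 1 ≤ G a) : 1 ≤ p.toOuterMeasure S + p.expect G := by
  rw [← p.tsum_coe, toOuterMeasure_apply, expect, ← ENNReal.tsum_add]
  refine ENNReal.tsum_le_tsum fun a => ?_
  by_cases ha : p a = 0
  · rw [ha]
    exact zero_le
  · by_cases hS : a ∈ S
    · rw [Set.indicator_of_mem hS]
      exact le_self_add
    · rw [Set.indicator_of_notMem hS, zero_add]
      exact le_mul_of_one_le_right zero_le (h a ((p.mem_support_iff a).2 ha) hS)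

end PMF

/-! ### The run of the learner -/

namespace Learner

open scoped ENNReal

variable {n m d : ℕ} [NeZero m]

/-- An invariant and a supermartingale handled together, because the supermartingale inequality is
only available for configurations that satisfy the invariant. -/
theorem run_induction (L : Learner) (I : Problem n m d) (M : MOMDP n m d) (s : Fin n)
    {P : ℕ → Config n d → Prop} {G : Config n d → ℝ≥0∞} (h0 : P 0 (Config.init s))
    (h1 : ∀ N c, P N c → ∀ c' ∈ (L.round I M c).support, P (N + 1) c')
    (h2 : ∀ N c, P N c → (L.round I M c).expect G ≤ G c) (N : ℕ) :
    (∀ c ∈ (L.run I M s N).support, P N c) ∧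
      (L.run I M s N).expect G ≤ G (Config.init s) := by
  induction N with
  | zero =>
    refine ⟨fun c hc => ?_, ?_⟩
    · rw [run, PMF.support_pure, Set.mem_singleton_iff] at hc
      rwa [hc]
    · rw [run, PMF.expect_pure]
  | succ N ih =>
    refine ⟨fun c hc => ?_, ?_⟩
    · rw [run, PMF.mem_support_bind_iff] at hc
      obtain ⟨c', hc', hc⟩ := hc
      exact h1 N c' (ih.1 c' hc') c hc
    · rw [run, PMF.expect_bind]
      exact (PMF.expect_mono _ fun c hc => h2 N c (ih.1 c hc)).trans ih.2

end Learner

namespace Config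

variable {n m d : ℕ}

/-- The knowledge of the learner, the last transition included. -/
noncomputable def know (I : Problem n m d) (c : Config n d) : Know :=
  if c.halted then c.memory.know
  else (Prog.book.exec (I.view c.state c.lastReward) c.memory).know

/-- The invariants of the run of the learner after `N` rounds. -/
structure Reachable (I : Problem n m d) (M : MOMDP n m d) (N : ℕ) (c : Config n d) : Prop where
  sound : (c.know I).Sound I M
  counter : c.memory.real 3 0 0 0 = c.actions
  actions_le : (c.actions : ℝ) ≤ I.cap + 1
  time_le : c.memory.time ≤ c.actions * (1000 * I.dims ^ 4) +
    if c.halted then 3000 * I.dims ^ 4 * I.grid ^ d else 0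
  running : c.halted = false → c.actions = N ∧ c.memory.nat 0 0 0 0 = 0
  outcome : c.halted = true → I.cap ≤ c.actions ∨
    (c.know I).explore I I.T c.state < I.threshold ∧ (c.know I).Solved I c.memory ∧
      c.memory.nat 18 0 0 0 = 0 ∧ c.memory.nat 19 0 0 0 = 0

/-- A bound for the probability of failure. -/
noncomputable def risk (I : Problem n m d) (M : MOMDP n m d) (c : Config n d) : ENNReal :=
  ENNReal.ofReal ((c.know I).potential I M c.state c.actions)

variable {I : Problem n m d} {M : MOMDP n m d}

theorem know_init (I : Problem n m d) (s : Fin n) : (Config.init s).know I = Know.blank := by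
  have : Config.know I (Config.init (d := d) s) =
    (Prog.book.exec (I.view s fun _ => 0) Memory.init).know := rfl
  rw [this, Prog.know_book, if_neg (by simp [Memory.init])]
  rfl

theorem reachable_init (hI : I.Valid) (s : Fin n) : Reachable I M 0 (Config.init s) where
  sound := by
    rw [know_init]
    exact Know.sound_blank hI s
  counter := Nat.cast_zero.symm
  actions_le := by
    have := hI.cap_pos s
    change ((0 : ℕ) : ℝ) ≤ _
    rw [Nat.cast_zero]
    linarith
  time_le := Nat.zero_le _
  running _ := ⟨rfl, rfl⟩
  outcome h := absurd h Bool.false_ne_true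

variable [NeZero m]

/-- The only place where the program meets the probabilistic analysis. The recorded knowledge lags
behind by one transition, so the risk is measured by the knowledge with the pending transition
included; on halting that transition has already been recorded. -/
theorem Reachable.round {N : ℕ} {c : Config n d} (h : Reachable I M N c) (hI : I.Valid)
    (hd : 1 ≤ d) : (∀ c' ∈ (learner.round I M c).support, Reachable I M (N + 1) c') ∧
      (learner.round I M c).expect (risk I M) ≤ risk I M c := by
  have hm : 0 < m := NeZero.pos m
  obtain ⟨μ, s, r, A, b⟩ := c
  cases b with
  | true =>
    have e : learner.round I M ⟨μ, s, r, A, true⟩ = PMF.pure ⟨μ, s, r, A, true⟩ := by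
      simp [Learner.round]
    rw [e, PMF.expect_pure]
    refine ⟨fun c' hc' => ?_, le_rfl⟩
    rw [PMF.support_pure, Set.mem_singleton_iff] at hc'
    subst hc'
    exact ⟨h.sound, h.counter, h.actions_le, h.time_le, fun h => absurd h.symm Bool.false_ne_true,
      h.outcome⟩
  | false =>
    have hk : (Prog.book.exec (I.view s r) μ).know = Config.know I ⟨μ, s, r, A, false⟩ := by
      simp [Config.know]
    have hcount : μ.real 3 0 0 0 = A := h.counter
    have hact : (A : ℝ) ≤ I.cap + 1 := h.actions_le
    have htime : μ.time ≤ A * (1000 * I.dims ^ 4) + 0 := h.time_le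
    obtain ⟨hAN, hrun⟩ : A = N ∧ μ.nat 0 0 0 0 = 0 := h.running rfl
    have hS : (Config.know I ⟨μ, s, r, A, false⟩).Sound I M := h.sound
    have hG : risk I M ⟨μ, s, r, A, false⟩ =
      ENNReal.ofReal ((Config.know I ⟨μ, s, r, A, false⟩).potential I M s A) := rfl
    rw [hG]
    generalize Config.know I ⟨μ, s, r, A, false⟩ = K at *
    obtain ⟨hK, hcases⟩ := exec_learn I s r hm hI.horizon_pos (hI.mesh_pos hd)
      hI.discount_mem_Icc μ hk hS.rew_mem
    obtain ⟨t1, t2⟩ := time_learn s r hI.horizon_pos (hI.mesh_pos hd) hd μ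
    have e : learner.round I M ⟨μ, s, r, A, false⟩ =
        if (Prog.learn.exec (I.view s r) μ).nat 0 0 0 0 ≠ 0 then
          PMF.pure ⟨Prog.learn.exec (I.view s r) μ, s, r, A, true⟩
        else (M.trans s (Learner.action m (Prog.learn.exec (I.view s r) μ))).map fun s' =>
          ⟨Prog.learn.exec (I.view s r) μ, s',
            M.reward s (Learner.action m (Prog.learn.exec (I.view s r) μ)), A + 1, false⟩ := by
      rw [Learner.round, if_neg Bool.false_ne_true]
      rfl
    rw [e]
    clear e
    generalize Prog.learn.exec (I.view s r) μ = μ' at *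
    have hhalt : μ'.nat 0 0 0 0 = 1 → μ'.real 3 0 0 0 = μ.real 3 0 0 0 →
        (I.cap ≤ A ∨ K.explore I I.T s < I.threshold ∧ K.Solved I μ' ∧ μ'.nat 18 0 0 0 = 0 ∧
          μ'.nat 19 0 0 0 = 0) →
        (∀ c' ∈ (PMF.pure (⟨μ', s, r, A, true⟩ : Config n d)).support,
          Reachable I M (N + 1) c') ∧
        (PMF.pure (⟨μ', s, r, A, true⟩ : Config n d)).expect (risk I M) ≤
          ENNReal.ofReal (K.potential I M s A) := by
      intro _ h1 h2
      have hk' : Config.know I ⟨μ', s, r, A, true⟩ = K := by simpa [Config.know] using hK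
      refine ⟨fun c' hc' => ?_, ?_⟩
      · rw [PMF.support_pure, Set.mem_singleton_iff] at hc'
        subst hc'
        refine ⟨by rwa [hk'], h1.trans hcount, hact, ?_, fun h => absurd h.symm Bool.false_ne_true,
          fun _ => by rwa [hk']⟩
        simp only [if_true]
        omega
      · rw [PMF.expect_pure, risk, hk']
    rcases hcases with ⟨-, h1, h2, h3⟩ | ⟨h1, h2, h3, h4, h5, h6, h7, h8⟩ | ⟨h1, h2, h3, h4⟩
    · rw [if_pos (by omega)]
      exact hhalt h2 h3 (Or.inl (by rwa [← hcount]))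
    · rw [if_neg (by omega)]
      have hlt := Know.exploreAction_lt (K := K) (I := I) hm s
      have ha : Learner.action m μ' = ⟨K.exploreAction I s, hlt⟩ := by
        rw [Learner.action, h4]
        exact Fin.ext (Nat.mod_eq_of_lt hlt)
      rw [ha]
      generalize haa : (⟨K.exploreAction I s, hlt⟩ : Fin m) = a at *
      have hav : (a : ℕ) = K.exploreAction I s := by rw [← haa]
      have hk' : ∀ z, Config.know I ⟨μ', z, M.reward s a, A + 1, false⟩ =
          K.observe I.quota s a z (M.reward s a) := by
        intro z
        have : Config.know I ⟨μ', z, M.reward s a, A + 1, false⟩ =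
          (Prog.book.exec (I.view z (M.reward s a)) μ').know := by simp [Config.know]
        rw [this, Prog.know_book, if_pos (by omega), hK, h6, h7, hav]
      refine ⟨fun c' hc' => ?_, ?_⟩
      · rw [PMF.mem_support_map_iff] at hc'
        obtain ⟨z, -, rfl⟩ := hc'
        refine ⟨?_, ?_, ?_, ?_, fun _ => ⟨by simp only [hAN], by simp only; omega⟩,
          fun h => absurd h Bool.false_ne_true⟩
        · rw [hk']
          exact hS.observe s a z
        · simp only [h8, hcount]
          push_cast
          rfl
        · rw [hcount] at h2
          push_cast
          linarith
        · have := t2 (by omega)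
          simp only [Bool.false_eq_true, if_false, add_mul, one_mul]
          omega
      · rw [PMF.expect_map]
        have e : (risk I M ∘ fun z => (⟨μ', z, M.reward s a, A + 1, false⟩ : Config n d)) =
            fun z : Fin n => ENNReal.ofReal
              ((K.observe I.quota s a z (M.reward s a)).potential I M z (A + 1)) := by
          funext z
          simp only [Function.comp_apply, risk, hk']
        rw [e, PMF.expect_ofReal _ fun z => (hS.observe s a z).potential_nonneg hI hm z _]
        exact ENNReal.ofReal_le_ofReal (hS.potential_step hI A h1 hav)
    · rw [if_pos (by omega)]
      exact hhalt h2 h3 (Or.inr ⟨h1, h4⟩)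

end Config

theorem learner_reachable {n m d : ℕ} [NeZero m] {I : Problem n m d} (hI : I.Valid) (hd : 1 ≤ d)
    (M : MOMDP n m d) (s : Fin n) (N : ℕ) :
    (∀ c ∈ (learner.run I M s N).support, c.Reachable I M N) ∧
      (learner.run I M s N).expect (Config.risk I M) ≤ ENNReal.ofReal I.β := by
  have h := learner.run_induction I M s (G := Config.risk I M) (Config.reachable_init hI s)
    (fun _ _ h => (h.round hI hd).1) (fun _ _ h => (h.round hI hd).2) N
  refine ⟨h.1, h.2.trans (ENNReal.ofReal_le_ofReal ?_)⟩
  rw [Config.know_init]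
  exact Know.potential_blank_le hI (NeZero.pos m) s

/-- After more than `cap + 1` rounds the learner must have halted, since a running learner acts in
every round. A halt at the cap, or an unsatisfactory policy, forces the risk to be at least 1: a
sound and accurate knowledge would make the policy good. -/
theorem learner_succeeds {n m d : ℕ} [NeZero m] {I : Problem n m d} (hI : I.Valid) (hd : 1 ≤ d)
    (M : MOMDP n m d) (s : Fin n) {N : ℕ} (hN : I.cap + 1 < N) :
    ENNReal.ofReal (1 - I.β) ≤ (learner.run I M s N).toOuterMeasure
      {c | c.halted = true ∧ M.value I.W I.γ I.T (learner.output I c.memory) c.state ≥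
        M.optValue I.W I.γ I.T c.state - I.ε} := by
  obtain ⟨h1, h2⟩ := learner_reachable hI hd M s N
  rw [ENNReal.ofReal_sub _ hI.failure_mem.1.le, ENNReal.ofReal_one]
  refine tsub_le_iff_right.2 (le_trans ?_ (add_le_add_right h2 _))
  refine PMF.one_le_toOuterMeasure_add_expect _ _ _ fun c hc hfail => ?_
  have hc := h1 c hc
  have hh : c.halted = true := by
    by_contra hne
    -- A configuration that is still running would have taken N actions, more than the cap permits.
    have := (hc.running (Bool.eq_false_of_not_eq_true hne)).1
    have := hc.actions_le
    subst N
    linarith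
  rw [Config.risk, ← ENNReal.ofReal_one]
  refine ENNReal.ofReal_le_ofReal ?_
  rcases hc.outcome hh with h3 | ⟨h3, h4, h5, h6⟩
  · exact hc.sound.one_le_potential_of_cap_le hI (NeZero.pos m) _ h3
  · refine hc.sound.one_le_potential_of_not_accurate hI _ _ fun hA => hfail ⟨hh, ?_⟩
    exact hc.sound.optValue_sub_le hI hd hA h4 h5 h6 h3

/-! ### Polynomial bounds -/

namespace Problem.Valid

variable {n m d : ℕ} {I : Problem n m d} (hI : I.Valid)

include hI

theorem parameters_le_size : 1 / I.ε ≤ I.size ∧ 1 / I.β ≤ I.size ∧ (n : ℝ) ≤ I.size ∧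
    (m : ℝ) ≤ I.size ∧ (I.T : ℝ) ≤ I.size ∧ (d : ℝ) ≤ I.size ∧ 1 / I.ω 1 ≤ I.size ∧
    (I.dims : ℝ) ≤ I.size ∧ 1 ≤ I.size := by
  have h1 : 0 < 1 / I.ε := one_div_pos.2 hI.accuracy_pos
  have h2 : 0 < 1 / I.β := one_div_pos.2 hI.failure_mem.1
  have h3 : 0 < 1 / I.ω 1 := one_div_pos.2 (hI.modulus_pos one_pos)
  have h4 := hI.one_le_T
  have h5 : (0 : ℝ) ≤ n := n.cast_nonneg
  have h6 : (0 : ℝ) ≤ m := m.cast_nonneg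
  have h7 : (0 : ℝ) ≤ d := d.cast_nonneg
  have h8 : (I.dims : ℝ) = n + m + d + I.T := by simp [Problem.dims]
  unfold Problem.size
  refine ⟨?_, ?_, ?_, ?_, ?_, ?_, ?_, ?_, ?_⟩ <;> linarith

/-- The parameters are products of quantities that are each at most `size`; along the chain `osc`,
1/`drift`, `quota`, `cap` the exponents grow as 3, 5, 15, 23. Additive constants are absorbed
because `size` is at least 1. -/
theorem osc_le : I.osc ≤ 2 * I.size ^ 3 := by
  obtain ⟨-, -, -, -, h5, h6, h7, -, h9⟩ := hI.parameters_le_size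
  have h3 : 0 < 1 / I.ω 1 := one_div_pos.2 (hI.modulus_pos one_pos)
  calc I.osc = d * I.T * (1 / I.ω 1) + 1 := by rw [Problem.osc, mul_one_div]
    _ ≤ I.size * I.size * I.size + I.size ^ 3 := by
        have := one_le_pow₀ h9 (n := 3)
        gcongr
    _ = _ := by ring

theorem one_div_drift_le : 1 / I.drift ≤ 256 * I.size ^ 5 := by
  obtain ⟨h1, -, -, -, h5, -, -, -, h9⟩ := hI.parameters_le_size
  have h10 := hI.osc_le
  have := hI.one_le_osc
  have := hI.one_le_T
  have := hI.accuracy_pos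
  calc 1 / I.drift = 4 * I.T * (32 * I.osc * (1 / I.ε)) := by
        rw [Problem.drift, Problem.threshold]
        field_simp
    _ ≤ 4 * I.size * (32 * (2 * I.size ^ 3) * I.size) := by gcongr
    _ = _ := by ring

theorem quota_le (s : Fin n) : I.quota ≤ 2 ^ 19 * I.size ^ 15 := by
  obtain ⟨-, h2, h3, h4, -, -, -, -, h9⟩ := hI.parameters_le_size
  have h10 := hI.one_div_drift_le
  have := hI.drift_pos
  have := hI.failure_mem.1
  have : (n : ℝ) ≠ 0 := Nat.cast_ne_zero.2 s.pos.ne'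
  calc I.quota = 4 * n * m * (n * (1 / I.drift)) ^ 2 * (1 / I.β) + 1 := by
        rw [Problem.quota, Problem.tol]
        field_simp
    _ ≤ 4 * I.size * I.size * (I.size * (256 * I.size ^ 5)) ^ 2 * I.size +
          2 ^ 18 * I.size ^ 15 := by
        have := one_le_pow₀ h9 (n := 15)
        gcongr
        linarith
    _ = _ := by ring

theorem cap_add_one_le (s : Fin n) : I.cap + 1 ≤ 2 ^ 31 * I.size ^ 23 := by
  obtain ⟨-, h2, h3, h4, -, -, -, -, h9⟩ := hI.parameters_le_size
  have h10 := hI.one_div_drift_le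
  have h11 := hI.quota_le s
  have := hI.one_le_quota s
  have := hI.drift_pos
  have := hI.failure_mem.1
  calc I.cap + 1 = 2 * (n * m * (I.quota + 1) + 1) * (1 / I.drift) * (1 / I.β) + 1 := by
        rw [Problem.cap]
        field_simp
    _ ≤ 2 * (I.size * I.size * (2 ^ 19 * I.size ^ 15 + 2 ^ 19 * I.size ^ 15) +
          2 ^ 20 * I.size ^ 17) * (256 * I.size ^ 5) * I.size + 2 ^ 30 * I.size ^ 23 := by
        have := one_le_pow₀ h9 (n := 15)
        have := one_le_pow₀ h9 (n := 17)
        have := one_le_pow₀ h9 (n := 23)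
        gcongr <;> linarith
    _ = _ := by ring

theorem grid_le : (I.grid : ℝ) ≤ d * I.T ^ 2 / I.ω (I.ε / 4) + 2 := by
  have h1 : (I.T : ℝ) / I.mesh = d * I.T ^ 2 / I.ω (I.ε / 4) := by
    rw [Problem.mesh, div_div_eq_mul_div]
    ring
  have h2 : 0 < I.ω (I.ε / 4) := hI.modulus_pos (by linarith [hI.accuracy_pos])
  have h3 := Nat.ceil_lt_add_one (a := (I.T : ℝ) / I.mesh + 1) (by
    rw [h1]
    positivity)
  rw [h1] at h3
  unfold Problem.grid
  rw [h1]
  linarith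

theorem one_le_base_pow : 1 ≤ (d * I.T ^ 2 / I.ω (I.ε / 4) + 2) ^ d := by
  have h2 : 0 < I.ω (I.ε / 4) := hI.modulus_pos (by linarith [hI.accuracy_pos])
  have h3 : 0 ≤ d * I.T ^ 2 / I.ω (I.ε / 4) := by positivity
  exact one_le_pow₀ (by linarith)

theorem cap_add_one_le_actionBound (s : Fin n) : I.cap + 1 ≤ I.actionBound (2 ^ 43) 27 := by
  have h9 := hI.parameters_le_size.2.2.2.2.2.2.2.2
  refine (hI.cap_add_one_le s).trans ?_
  unfold Problem.actionBound
  push_cast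
  gcongr <;> norm_num

theorem const_le_timeBound : 45 ≤ I.timeBound (2 ^ 43) 27 := by
  have h9 := hI.parameters_le_size.2.2.2.2.2.2.2.2
  have h1 := hI.one_le_base_pow
  have h2 := one_le_pow₀ h9 (n := 27)
  calc (45 : ℝ) ≤ ((2 ^ 43 : ℕ) : ℝ) * 1 * 1 := by norm_num
    _ ≤ _ := by
        unfold Problem.timeBound
        gcongr

theorem time_le_timeBound (s : Fin n) {A : ℕ} (hA : (A : ℝ) ≤ I.cap + 1) :
    (A * (1000 * I.dims ^ 4) + 3000 * I.dims ^ 4 * I.grid ^ d : ℝ) ≤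
      I.timeBound (2 ^ 43) 27 := by
  obtain ⟨-, -, -, -, -, -, -, h8, h9⟩ := hI.parameters_le_size
  have h1 := hI.one_le_base_pow
  have h2 := hA.trans (hI.cap_add_one_le s)
  have h3 := hI.grid_le
  unfold Problem.timeBound
  set B : ℝ := d * I.T ^ 2 / I.ω (I.ε / 4) + 2
  calc (A * (1000 * I.dims ^ 4) + 3000 * I.dims ^ 4 * I.grid ^ d : ℝ) ≤
        2 ^ 31 * I.size ^ 23 * (1000 * I.size ^ 4) * 1 + 3000 * I.size ^ 4 * B ^ d := by
        rw [mul_one]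
        gcongr
    _ ≤ 2 ^ 31 * I.size ^ 23 * (1000 * I.size ^ 4) * B ^ d + 3000 * I.size ^ 27 * B ^ d := by
        gcongr
        norm_num
    _ = (2 ^ 31 * 1000 + 3000) * I.size ^ 27 * B ^ d := by ring
    _ ≤ _ := by
        gcongr
        norm_num

end Problem.Valid

/-! ### The main theorem -/

theorem mainTheorem3 :
    ∃ (L : Learner) (C k : ℕ), ∀ (n m d : ℕ) [NeZero m], 1 ≤ d →
      ∀ (I : Problem n m d), I.Valid → ∀ (M : MOMDP n m d) (s₁ : Fin n),
        (∀ N : ℕ, ∀ c ∈ (L.run I M s₁ N).support,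
          (c.actions : ℝ) ≤ I.actionBound C k ∧ (c.memory.time : ℝ) ≤ I.timeBound C k) ∧
        ∀ N : ℕ, I.actionBound C k < N →
          ENNReal.ofReal (1 - I.β) ≤ (L.run I M s₁ N).toOuterMeasure
            {c | c.halted = true ∧
              (∀ (τ : List (Fin n × Fin m)) (s : Fin n), τ.length < I.T →
                ((L.decideStep I (L.decideMem I c.memory τ) s).time : ℝ) ≤
                  (L.decideMem I c.memory τ).time + I.timeBound C k) ∧
              M.value I.W I.γ I.T (L.output I c.memory) c.state ≥
                M.optValue I.W I.γ I.T c.state - I.ε} := by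
  -- The exponent is 23 for the number of actions plus 4 for the polynomial cost of a round; the
  -- constant dominates 2^31 * 1000 + 3000.
  refine ⟨learner, 2 ^ 43, 27, fun n m d _ hd I hI M s₁ => ⟨fun N c hc => ?_, fun N hN => ?_⟩⟩
  · have h := (learner_reachable hI hd M s₁ N).1 c hc
    refine ⟨h.actions_le.trans (hI.cap_add_one_le_actionBound s₁), ?_⟩
    refine le_trans ?_ (hI.time_le_timeBound s₁ h.actions_le)
    have ht : c.memory.time ≤ c.actions * (1000 * I.dims ^ 4) +
        3000 * I.dims ^ 4 * I.grid ^ d := by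
      refine h.time_le.trans ?_
      split_ifs <;> simp
    exact_mod_cast ht
  · refine (learner_succeeds hI hd M s₁
      ((hI.cap_add_one_le_actionBound s₁).trans_lt hN)).trans (PMF.toOuterMeasure_mono _ ?_)
    -- Monotonicity of the outer measure is needed only on the support, hence the discarded
    -- component; the bound on decision times holds for every memory.
    rintro c ⟨⟨h1, h2⟩, -⟩
    refine ⟨h1, fun τ s _ => ?_, h2⟩
    obtain ⟨-, -, -, -, -, -, h3⟩ := exec_policy I s (fun _ => 0) (learner.decideMem I c.memory τ)
    have h4 := hI.const_le_timeBound
    have h5 : (learner.decideStep I (learner.decideMem I c.memory τ) s).time =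
        (learner.decideMem I c.memory τ).time + 45 := h3
    rw [h5, Nat.cast_add]
    exact add_le_add_right h4 _
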